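/- **Setting.** Let $\mathcal A$ be an abelian category and let $H$ be an abstract group, small with respect to the universe in which the morphism sets of $\mathcal A$ lie. Let $\mathrm{Pro}(\mathcal A)$ be the (abelian, complete) category of pro-objects of $\mathcal A$. It contains $\mathcal A$ as a full subcategory, and the inclusion is exact. For $\mathcal B=\mathcal A$ or $\mathcal B=\mathrm{Pro}(\mathcal A)$, let $H\text{-}\mathcal B$ be the abelian category of objects of $\mathcal B$ with a left action of $H$, and let $\mathrm{Fo}\colon H\text{-}\mathcal B\to\mathcal B$ be the forgetful functor. Let $$(\,\cdot\,)^H\colon H\text{-}\mathrm{Pro}(\mathcal A)\to\mathrm{Pro}(\mathcal A),\qquad A^H=\bigcap_{\gamma\in H}\ker(e-\gamma\colon A\to A),$$ be the (left exact) fixed point functor. The group $H$ is of type $FP_\infty$ if the trivial $\mathbb ZH$-module $\mathbb Z$ has a resolution $\cdots\to F_1\to F_0\to\mathbb Z\to 0$ by finitely generated free $\mathbb ZH$-modules. It is of type $FL$ if there is such a resolution with $F_i=0$ for all large $i$. For a resolution $F_*$ by finitely generated free modules and $A\in H\text{-}\mathcal A$, let $\mathrm{Hom}(F_*,A)^H$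 be the complex in $\mathcal A$ whose $i$-th term is $\prod_{j\in J_i}A$, where $(x_{i,j})_{j\in J_i}$ is a basis of $F_i$. Its differential is as follows: if $F_i\to F_{i-1}$ sends $x_{i,j}$ to $\sum_{k,h} n^{k,h}_j\,h(x_{i-1,k})$, then the $j$-th component of $\prod_{J_{i-1}}A\to\prod_{J_i}A$ is $\sum_{k,h}n_j^{k,h}\,h\circ p_k$, where $p_k$ is the $k$-th projection. For a bounded below complex $K$ in $H\text{-}\mathcal A$, let $\mathrm{Tot}\,\mathrm{Hom}(F_*,K)^H$ be the total complex of the bicomplex $\mathrm{Hom}(F_q,K^p)^H$. **Theorem.** The functor $(\,\cdot\,)^H\colon H\text{-}\mathrm{Pro}(\mathcal A)\to\mathrm{Pro}(\mathcal A)$ is right derivable on $D^+$. Let $$R\Gamma(H,\cdot)\colon D^+(H\text{-}\mathrm{Pro}(\mathcal A))\to D^+(\mathrm{Pro}(\mathcal A))$$ be its total right derived functor, and let $H^p(H,\cdot)$, $p\in\mathbb Z$, be the cohomology objects of $R\Gamma(H,\cdot)$. (a) If $H$ is of type $FP_\infty$, there are an additive functor $$R\Gamma_{\mathcal A}(H,\cdot)\colon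 D^+(H\text{-}\mathcal A)\to D^+(\mathcal A)$$ and a natural isomorphism which makes the square $$\begin{array}{ccc} D^+(H\text{-}\mathcal A)&\xrightarrow{R\Gamma_{\mathcal A}(H,\cdot)}&D^+(\mathcal A)\\ \downarrow&&\downarrow\\ D^+(H\text{-}\mathrm{Pro}(\mathcal A))&\xrightarrow{R\Gamma(H,\cdot)}&D^+(\mathrm{Pro}(\mathcal A))\end{array}$$ commutative. For every resolution $F_*$ of $\mathbb Z$ by finitely generated free $\mathbb ZH$-modules, the functor is identified with the one induced by $K\mapsto\mathrm{Tot}\,\mathrm{Hom}(F_*,K)^H$, and these identifications are compatible with all morphisms of resolutions (over $\mathrm{id}_{\mathbb Z}$). The isomorphism in the square is compatible with the canonical morphisms from $K^H$ (formed in $\mathrm{Pro}(\mathcal A)$) to $\mathrm{Tot}\,\mathrm{Hom}(F_*,K)^H$ and to $R\Gamma(H,K)$. Any two such functors are isomorphic by a unique isomorphism compatible with the identifications for all $F_*$. (b) If $H$ is of type $FL$, a functor $R\Gamma_{\mathcal A}(H,\cdot)$ as in (a) sends $D^b(H\text{-}\mathcal A)$ to $D^b(\mathcal A)$. It thus induces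 a functor $D^b(H\text{-}\mathcal A)\to D^b(\mathcal A)$, and restricting the square in (a) gives a square, commutative up to the restricted natural isomorphism, formed by this functor, by $R\Gamma(H,\cdot)\colon D^+(H\text{-}\mathrm{Pro}(\mathcal A))\to D^+(\mathrm{Pro}(\mathcal A))$ and by the natural functors $D^b(H\text{-}\mathcal A)\to D^+(H\text{-}\mathrm{Pro}(\mathcal A))$ and $D^b(\mathcal A)\to D^+(\mathrm{Pro}(\mathcal A))$. (c) Assume that $H$ is of type $FP_\infty$ and that $\mathcal A$ is semi-simple, i.e. every short exact sequence in $\mathcal A$ splits. Let $A$ be an object of $H\text{-}\mathcal A$ and $p\in\mathbb Z$. Then $H^p(H,A)$ is isomorphic to an object of $\mathcal A$, and every irreducible factor of it (simple object of $\mathcal A$ which is a direct factor) is an irreducible factor of $\mathrm{Fo}(A)$. -/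

import Mathlib

open CategoryTheory Limits

universe w₁ w₂ w₃ w₄ v u

noncomputable section

namespace GroupCohomologyPro

/-! ### Pro-objects -/

section Pro

variable (C : Type u) [Category.{v} C]

/-- The category of pro-objects of `C`: formal small cofiltered limits of objects of `C`,
i.e. the opposite of the category of ind-objects of the opposite category. -/
def Pro : Type (max u (v + 1)) := (Ind Cᵒᵖ)ᵒᵖ

instance : Category.{v} (Pro C) := inferInstanceAs (Category.{v} (Ind Cᵒᵖ)ᵒᵖ)

lemma preservesFiniteLimits_of_isIndObject {D : Type u} [Category.{v} D] {A : Dᵒᵖ ⥤ Type v}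
    (hA : IsIndObject A) : PreservesFiniteLimits A := by
  let P := hA.presentation
  have e : A ≅ colimit (P.F ⋙ yoneda) :=
    P.isColimit.coconePointUniqueUpToIso (colimit.isColimit _)
  have e' := e ≪≫ colimitIsoFlipCompColim (P.F ⋙ yoneda)
  have : PreservesFiniteLimits (P.F ⋙ yoneda).flip := by
    constructor
    intro J _ _
    apply preservesLimitsOfShape_of_evaluation
    intro k
    exact inferInstanceAs (PreservesLimitsOfShape J (yoneda.obj (P.F.obj k)))
  have : PreservesFiniteLimits ((P.F ⋙ yoneda).flip ⋙ (colim : (P.I ⥤ Type v) ⥤ Type v)) :=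
    comp_preservesFiniteLimits _ _
  exact preservesFiniteLimits_of_natIso e'.symm

/-- The inclusion of ind-objects into left exact functors. -/
def indToLeftExact (D : Type u) [Category.{v} D] : Ind D ⥤ (Dᵒᵖ ⥤ₗ Type v) :=
  ObjectProperty.lift _ (Ind.inclusion D) (fun X => by
    have := preservesFiniteLimits_of_isIndObject (Ind.isIndObject_inclusion_obj X)
    simpa only [leftExactFunctor_iff] using this)

/-- The inclusion of ind-objects into left exact functors is fully faithful. -/
def indToLeftExactFullyFaithful (D : Type u) [Category.{v} D] :
    (indToLeftExact D).FullyFaithful :=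
  Functor.FullyFaithful.ofCompFaithful (G := ObjectProperty.ι _)
    (Ind.inclusion.fullyFaithful (C := D))

end Pro

section ProAbelian

variable (C : Type u) [Category.{v} C] [Abelian C]

attribute [local instance] HasFiniteBiproducts.of_hasFiniteCoproducts in
instance indPreadditive : Preadditive (Ind C) :=
  .ofFullyFaithful (((indToLeftExactFullyFaithful C).comp
    (AddCommGrpCat.leftExactFunctorForgetEquivalence _).symm.fullyFaithfulFunctor).comp
      (ObjectProperty.fullyFaithfulι _))

instance : HasFiniteBiproducts (Ind C) := HasFiniteBiproducts.of_hasFiniteCoproducts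

lemma ind_isIso_coimageImageComparison
  {X Y : Ind C} (f : X ⟶ Y) : IsIso (Abelian.coimageImageComparison f) := by
  obtain ⟨I, _, _, F, G, ϕ, ⟨i⟩⟩ := Ind.exists_nonempty_arrow_mk_iso_ind_lim (f := f)
  let i' : Arrow.mk (Abelian.coimageImageComparison f) ≅
      Arrow.mk (Abelian.coimageImageComparison ((Ind.lim I).map ϕ)) :=
    Abelian.coimageImageComparisonFunctor.mapIso i
  have := Iso.isIso_hom i'
  rw [Arrow.isIso_iff_isIso_of_isIso i'.hom,
    Arrow.isIso_iff_isIso_of_isIso (Abelian.PreservesCoimageImageComparison.iso (Ind.lim I) ϕ).inv]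
  infer_instance

instance indAbelian : Abelian (Ind C) :=
  have : ∀ {X Y : Ind C} (f : X ⟶ Y), IsIso (Abelian.coimageImageComparison f) :=
    ind_isIso_coimageImageComparison C
  .ofCoimageImageComparisonIsIso

instance : Abelian (Pro C) := inferInstanceAs (Abelian (Ind Cᵒᵖ)ᵒᵖ)

instance : HasLimits (Pro C) := inferInstanceAs (HasLimits (Ind Cᵒᵖ)ᵒᵖ)

/-- The embedding of `C` in its category of pro-objects. -/
def proEmbedding (C : Type u) [Category.{v} C] : C ⥤ Pro C := (Ind.yoneda (C := Cᵒᵖ)).rightOp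

instance : PreservesFiniteLimits (proEmbedding C) :=
  preservesFiniteLimits_rightOp (Ind.yoneda (C := Cᵒᵖ))

instance : PreservesFiniteColimits (proEmbedding C) :=
  preservesFiniteColimits_rightOp (Ind.yoneda (C := Cᵒᵖ))

instance : (proEmbedding C).Additive := Functor.additive_of_preserves_binary_products _

end ProAbelian

section FixedPoints

/-- The automorphism of the underlying object given by an element of the group. -/
def actHom {V : Type*} [Category* V] {H : Type*} [Group H] (A : Action V H) (γ : H) :
    A.V ⟶ A.V := A.ρ γ

variable (V : Type*) [Category* V] [Preadditive V] [HasKernels V]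
  (H : Type v) [Group H] [HasProductsOfShape H V]

/-- The fixed point functor `A ↦ ⋂_{γ ∈ H} Ker (e - γ)`; the intersection is formed as the kernel
of the morphism `A ⟶ ∏_{γ ∈ H} A` with components `e - γ`. -/
def fixedPoints : Action V H ⥤ V where
  obj A := kernel (Pi.lift fun γ : H => 𝟙 A.V - actHom A γ)
  map {A B} f := kernel.map _ _ f.hom (Limits.Pi.map fun _ => f.hom) (by
    refine Pi.hom_ext _ _ fun γ => ?_
    simp [actHom, f.comm γ])

variable {V H}

/-- The inclusion of the fixed points of `A` in the underlying object of `A`. -/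
def fixedPointsι (A : Action V H) : (fixedPoints V H).obj A ⟶ A.V := kernel.ι _

instance (A : Action V H) : Mono (fixedPointsι A) :=
  inferInstanceAs (Mono (kernel.ι (Pi.lift fun γ : H => 𝟙 A.V - actHom A γ)))

lemma fixedPointsι_naturality {A B : Action V H} (f : A ⟶ B) :
    (fixedPoints V H).map f ≫ fixedPointsι B = fixedPointsι A ≫ f.hom :=
  kernel.lift_ι _ _ _

lemma fixedPointsι_actHom (A : Action V H) (γ : H) :
    fixedPointsι A ≫ actHom A γ = fixedPointsι A := by
  have := kernel.condition (Pi.lift fun γ : H => 𝟙 A.V - actHom A γ) =≫ Pi.π _ γ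
  rw [Category.assoc, Pi.lift_π, zero_comp, Preadditive.comp_sub, sub_eq_zero,
    Category.comp_id] at this
  exact this.symm

instance : (fixedPoints V H).Additive where
  map_add {A B f g} := by
    rw [← cancel_mono (fixedPointsι B), Preadditive.add_comp]
    simp only [fixedPointsι_naturality]
    exact Preadditive.comp_add _ _ _ _ _ _

end FixedPoints

section Plus

variable {C : Type*} {D : Type*} [Category* C] [Category* D] [Abelian C] [Abelian D]
  [HasDerivedCategory C] [HasDerivedCategory D]
  (F : C ⥤ D) [F.Additive] [PreservesFiniteLimits F] [PreservesFiniteColimits F]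

/-- The functor between bounded below derived categories induced by an exact functor. -/
def mapDerivedPlus : DerivedCategory.Plus C ⥤ DerivedCategory.Plus D :=
  ObjectProperty.lift _ (DerivedCategory.Plus.ι ⋙ F.mapDerivedCategory) (by
    rintro ⟨X, n, ⟨K, e, hK⟩⟩
    exact ⟨n, ⟨(F.mapHomologicalComplex _).obj K,
      F.mapDerivedCategory.mapIso e ≪≫ F.mapDerivedCategoryFactors.app K, inferInstance⟩⟩)

/-- The functor `mapDerivedPlus F` is computed by applying `F` to complexes. -/
def mapDerivedPlusFactors :
    DerivedCategory.Plus.Q ⋙ mapDerivedPlus F ≅ F.mapCochainComplexPlus ⋙ DerivedCategory.Plus.Q :=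
  ((ObjectProperty.fullyFaithfulι _).whiskeringRight _).preimageIso
    (Functor.isoWhiskerLeft (CochainComplex.Plus.ι C)
      (Functor.isoWhiskerRight (DerivedCategory.quotientCompQhIso C) F.mapDerivedCategory ≪≫
      F.mapDerivedCategoryFactors ≪≫
      Functor.isoWhiskerLeft (F.mapHomologicalComplex _) (DerivedCategory.quotientCompQhIso D).symm))

/-- The inclusion of the bounded derived category in the bounded below derived category. -/
def boundedToPlus (C : Type*) [Category* C] [Abelian C] [HasDerivedCategory C] :
    DerivedCategory.Bounded C ⥤ DerivedCategory.Plus C :=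
  ObjectProperty.ιOfLE (fun _ h => h.1)

end Plus

section Total

variable {V : Type*} [Category* V] [Preadditive V] [HasFiniteCoproducts V]

lemma hasCoproduct_of_isZero {ι : Type*} (X : ι → V) (s : Set ι) (hs : s.Finite)
    (h : ∀ i, i ∉ s → IsZero (X i)) : HasCoproduct X := by
  classical
  have : Finite s := hs
  let c : Cofan X := Cofan.mk (∐ fun i : s => X i) fun i =>
    if hi : i ∈ s then Sigma.ι (fun i : s => X i) ⟨i, hi⟩ else 0
  refine ⟨⟨c, Cofan.IsColimit.mk c (fun t => Limits.Sigma.desc fun i : s => t.inj i.1) ?_ ?_⟩⟩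
  · intro t i
    by_cases hi : i ∈ s
    · simp [c, Cofan.inj, hi]
    · exact (h i hi).eq_of_src _ _
  · intro t m hm
    refine Limits.Sigma.hom_ext (f := fun i : s => X i.1) _ _ fun i => ?_
    have := hm i
    simpa [c, Cofan.inj] using this

lemma hasTotal_of_isZero (K : HomologicalComplex₂ V (ComplexShape.up ℤ) (ComplexShape.up ℤ))
    (a b : ℤ) (h₁ : ∀ p q, p < a → IsZero ((K.X p).X q))
    (h₂ : ∀ p q, q < b → IsZero ((K.X p).X q)) : K.HasTotal (ComplexShape.up ℤ) := by
  intro n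
  refine hasCoproduct_of_isZero _
    {i | a ≤ i.1.1 ∧ b ≤ i.1.2} ?_ ?_
  · refine Set.Finite.subset (Set.Finite.preimage Subtype.val_injective.injOn
      ((Set.finite_Icc a (n - b)).prod (Set.finite_Icc b (n - a)))) ?_
    rintro ⟨⟨p, q⟩, hpq⟩ ⟨hp, hq⟩
    have : p + q = n := hpq
    simp only [Set.mem_preimage, Set.mem_prod, Set.mem_Icc] at *
    omega
  · rintro ⟨⟨p, q⟩, hpq⟩ h
    simp only [Set.mem_ofPred_eq, not_and_or, not_le] at h
    rcases h with h | h
    · exact h₁ _ _ h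
    · exact h₂ _ _ h

end Total

/-! ### Groups of type `FP_∞` and `FL` -/

section Resolutions

/-- The group ring `ℤH`. -/
abbrev GroupRing (H : Type v) [Group H] : Type v := MonoidAlgebra ℤ H

/-- A resolution `⋯ ⟶ F₁ ⟶ F₀ ⟶ ℤ ⟶ 0` of the trivial `ℤH`-module `ℤ` by finitely generated
free `ℤH`-modules. -/
structure FreeResolution (H : Type v) [Group H] where
  complex : ChainComplex (ModuleCat.{v} (GroupRing H)) ℕ
  free : ∀ n, Module.Free (GroupRing H) (complex.X n)
  finite : ∀ n, Module.Finite (GroupRing H) (complex.X n)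
  ε : complex.X 0 →ₗ[GroupRing H] (Representation.trivial ℤ H ℤ).asModule
  surjective_ε : Function.Surjective ε
  exact_zero : Function.Exact (complex.d 1 0).hom ε
  exact_succ : ∀ n, Function.Exact (complex.d (n + 2) (n + 1)).hom (complex.d (n + 1) n).hom

attribute [instance] FreeResolution.free FreeResolution.finite

/-- A group is of type `FP_∞` if `ℤ` has a resolution by finitely generated free modules. -/
def IsTypeFPInfty (H : Type v) [Group H] : Prop := Nonempty (FreeResolution H)

/-- A group is of type `FL` if `ℤ` has a finite resolution by finitely generated free modules. -/
def IsTypeFL (H : Type v) [Group H] : Prop :=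
  ∃ F : FreeResolution H, ∃ n : ℕ, ∀ i, n < i → IsZero (F.complex.X i)

/-- A morphism of resolutions: a morphism of complexes over the identity of `ℤ`. -/
structure FreeResolution.Hom {H : Type v} [Group H] (F F' : FreeResolution H) where
  hom : F.complex ⟶ F'.complex
  comm : ∀ x, F'.ε ((hom.f 0).hom x) = F.ε x

end Resolutions

section HomComplex

variable {V : Type*} [Category* V] [Abelian V] {H : Type v} [Group H]

/-- The action of an element of the group ring on the underlying object. -/
def smulHom (A : Action V H) (x : GroupRing H) : A.V ⟶ A.V :=
  MonoidAlgebra.lift ℤ (End A.V) H A.ρ x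

lemma smulHom_mul (A : Action V H) (x y : GroupRing H) :
    smulHom A (x * y) = smulHom A y ≫ smulHom A x := by
  simp [smulHom, End.mul_def]

lemma smulHom_one (A : Action V H) : smulHom A 1 = 𝟙 A.V := by
  simp [smulHom, End.one_def]

lemma smulHom_zero (A : Action V H) : smulHom A 0 = 0 := by
  simp [smulHom]

lemma smulHom_add (A : Action V H) (x y : GroupRing H) :
    smulHom A (x + y) = smulHom A x + smulHom A y := by
  simp [smulHom]

lemma smulHom_sum (A : Action V H) {ι : Type*} (s : Finset ι) (x : ι → GroupRing H) :
    smulHom A (∑ i ∈ s, x i) = ∑ i ∈ s, smulHom A (x i) := 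
  map_sum (AddMonoidHom.mk' (smulHom A) (smulHom_add A)) _ _

lemma smulHom_zsmul (A : Action V H) (r : ℤ) (x : GroupRing H) :
    smulHom A (r • x) = r • smulHom A x :=
  map_zsmul (AddMonoidHom.mk' (smulHom A) (smulHom_add A)) _ _

lemma smulHom_comm {A B : Action V H} (f : A ⟶ B) (x : GroupRing H) :
    smulHom A x ≫ f.hom = f.hom ≫ smulHom B x := by
  induction x using MonoidAlgebra.induction_on with
  | of g => simpa [smulHom] using f.comm g
  | add x y hx hy => simp [smulHom_add, hx, hy]
  | smul r x hx =>
    rw [smulHom_zsmul, smulHom_zsmul, Preadditive.zsmul_comp, Preadditive.comp_zsmul, hx]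

/-- The index set of the chosen basis of a free `ℤH`-module. -/
abbrev BasisIndex (M : ModuleCat.{v} (GroupRing H)) [Module.Free (GroupRing H) M] : Type v :=
  Module.Free.ChooseBasisIndex (GroupRing H) M

/-- The chosen basis of a free `ℤH`-module. -/
abbrev basis (M : ModuleCat.{v} (GroupRing H)) [Module.Free (GroupRing H) M] :
    Module.Basis (BasisIndex M) (GroupRing H) M :=
  Module.Free.chooseBasis (GroupRing H) M

section

variable (M : ModuleCat.{v} (GroupRing H)) [Module.Free (GroupRing H) M]
  [Module.Finite (GroupRing H) M]

/-- For a finitely generated free `ℤH`-module `M` (with basis `(b_j)_j`) and an object `A` with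
an action of `H`, this is `Hom(M, A)^H = ∏_j A`, which represents the functor
`B ↦ Hom_{ℤH}(M, Hom(B, A))`. -/
def homObj (A : Action V H) : V := ∏ᶜ fun _ : BasisIndex M => A.V

/-- The projections of `Hom(M, A)^H = ∏_j A`: evaluation at the basis vectors of `M`. -/
def homπ (A : Action V H) (j : BasisIndex M) : homObj M A ⟶ A.V := Pi.π (fun _ => A.V) j

/-- The universal property of `Hom(M, A)^H = ∏_j A`. -/
def homLift (A : Action V H) {B : V} (f : BasisIndex M → (B ⟶ A.V)) : B ⟶ homObj M A :=
  Pi.lift f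

lemma homLift_π (A : Action V H) {B : V} (f : BasisIndex M → (B ⟶ A.V)) (j : BasisIndex M) :
    homLift M A f ≫ homπ M A j = f j := Pi.lift_π _ _

variable {M} in
lemma homObj_ext {A : Action V H} {B : V} {f g : B ⟶ homObj M A}
    (h : ∀ j, f ≫ homπ M A j = g ≫ homπ M A j) : f = g := Pi.hom_ext _ _ h

/-- The morphism `Hom(M, A)^H ⟶ Hom(M, B)^H` induced by an equivariant morphism `A ⟶ B`. -/
def homPost {A B : Action V H} (φ : A ⟶ B) : homObj M A ⟶ homObj M B :=
  homLift M B fun j => homπ M A j ≫ φ.hom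

lemma homPost_π {A B : Action V H} (φ : A ⟶ B) (j : BasisIndex M) :
    homPost M φ ≫ homπ M B j = homπ M A j ≫ φ.hom := homLift_π _ _ _ _

lemma homPost_id (A : Action V H) : homPost M (𝟙 A) = 𝟙 _ :=
  homObj_ext fun j => by simp [homPost_π]

lemma homPost_comp {A B D : Action V H} (φ : A ⟶ B) (ψ : B ⟶ D) :
    homPost M (φ ≫ ψ) = homPost M φ ≫ homPost M ψ :=
  homObj_ext fun j => by
    rw [Category.assoc, homPost_π, homPost_π, ← Category.assoc, homPost_π, Category.assoc]; rfl

lemma homPost_add {A B : Action V H} (φ ψ : A ⟶ B) :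
    homPost M (φ + ψ) = homPost M φ + homPost M ψ :=
  homObj_ext fun j => by simp [homPost_π]

end

section

variable {M N P : ModuleCat.{v} (GroupRing H)} [Module.Free (GroupRing H) M]
  [Module.Finite (GroupRing H) M] [Module.Free (GroupRing H) N]
  [Module.Finite (GroupRing H) N] [Module.Free (GroupRing H) P]
  [Module.Finite (GroupRing H) P]

/-- The morphism `Hom(N, A)^H ⟶ Hom(M, A)^H` given by precomposition with `f : M ⟶ N`: if
`f b_j = ∑_k a_{jk} b_k`, its `j`-th component is `∑_k a_{jk} ∘ p_k`. -/
def homMap (f : M ⟶ N) (A : Action V H) : homObj N A ⟶ homObj M A :=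
  homLift M A fun j => ∑ k, homπ N A k ≫ smulHom A ((basis N).repr (f.hom (basis M j)) k)

lemma homMap_π (f : M ⟶ N) (A : Action V H) (j : BasisIndex M) :
    homMap f A ≫ homπ M A j =
      ∑ k, homπ N A k ≫ smulHom A ((basis N).repr (f.hom (basis M j)) k) :=
  homLift_π _ _ _ _

lemma homMap_π_assoc (f : M ⟶ N) (A : Action V H) (j : BasisIndex M) {X : V} (g : A.V ⟶ X) :
    homMap f A ≫ homπ M A j ≫ g =
      ∑ k, homπ N A k ≫ smulHom A ((basis N).repr (f.hom (basis M j)) k) ≫ g := by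
  rw [← Category.assoc, homMap_π, Preadditive.sum_comp]
  simp

lemma homMap_comp (f : M ⟶ N) (g : N ⟶ P) (A : Action V H) :
    homMap (f ≫ g) A = homMap g A ≫ homMap f A := by
  refine homObj_ext fun j => ?_
  rw [Category.assoc, homMap_π, homMap_π, Preadditive.comp_sum]
  simp_rw [homMap_π_assoc, ← smulHom_mul]
  rw [Finset.sum_comm]
  refine Finset.sum_congr rfl fun l _ => ?_
  rw [← Preadditive.comp_sum, ← smulHom_sum]
  congr 2
  rw [ModuleCat.hom_comp, LinearMap.comp_apply]
  generalize f.hom (basis M j) = x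
  nth_rewrite 1 [← (basis N).sum_repr x]
  rw [map_sum, map_sum, Finsupp.finsetSum_apply]
  simp

lemma homMap_zero (A : Action V H) : homMap (0 : M ⟶ N) A = 0 :=
  homObj_ext fun j => by simp [homMap_π, smulHom_zero]

lemma homMap_id (A : Action V H) : homMap (𝟙 M) A = 𝟙 _ := by
  classical
  refine homObj_ext fun j => ?_
  rw [homMap_π, Finset.sum_eq_single j]
  · simp [smulHom_one]
  · intro k _ hk
    simp [smulHom_zero, hk.symm]
  · simp

lemma homMap_naturality (f : M ⟶ N) {A B : Action V H} (φ : A ⟶ B) :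
    homMap f A ≫ homPost M φ = homPost N φ ≫ homMap f B := by
  refine homObj_ext fun j => ?_
  rw [Category.assoc, Category.assoc, homPost_π, homMap_π_assoc, homMap_π, Preadditive.comp_sum]
  refine Finset.sum_congr rfl fun k _ => ?_
  rw [smulHom_comm, ← Category.assoc, ← Category.assoc, homPost_π]

end

/-- The complex `Hom(F_*, A)^H`, functorially in `A`. -/
def homComplexNat (F : FreeResolution H) : Action V H ⥤ CochainComplex V ℕ where
  obj A :=
    { X := fun i => homObj (F.complex.X i) A
      d := fun i j => homMap (F.complex.d j i) A
      shape := fun i j h => by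
        rw [F.complex.shape _ _ h, homMap_zero]
      d_comp_d' := fun i j k _ _ => by
        rw [← homMap_comp, F.complex.d_comp_d, homMap_zero] }
  map φ :=
    { f := fun i => homPost (F.complex.X i) φ
      comm' := fun i j _ => (homMap_naturality _ φ).symm }
  map_id A := by
    ext i
    exact homPost_id _ _
  map_comp φ ψ := by
    ext i
    exact homPost_comp _ _ _

instance (F : FreeResolution H) : (homComplexNat (V := V) F).Additive where
  map_add {A B f g} := by
    ext i
    exact homPost_add _ _ _

/-- The complex `Hom(F_*, A)^H`, as a complex indexed by `ℤ` which is zero in negative degrees. -/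
def homComplex (F : FreeResolution H) : Action V H ⥤ CochainComplex V ℤ :=
  homComplexNat F ⋙ ComplexShape.embeddingUpNat.extendFunctor V

instance (F : FreeResolution H) : (homComplex (V := V) F).Additive := by
  unfold homComplex; infer_instance

/-- In degree `i ≥ 0`, the complex `Hom(F_*, A)^H` is `Hom(F_i, A)^H`. -/
def homComplexXIso (F : FreeResolution H) (A : Action V H) (i : ℕ) (n : ℤ) (h : (i : ℤ) = n) :
    ((homComplex F).obj A).X n ≅ homObj (F.complex.X i) A :=
  ((homComplexNat F).obj A).extendXIso ComplexShape.embeddingUpNat h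

lemma homComplex_d (F : FreeResolution H) (A : Action V H) (i j : ℕ) (n m : ℤ)
    (hn : (i : ℤ) = n) (hm : (j : ℤ) = m) :
    ((homComplex F).obj A).d n m = (homComplexXIso F A i n hn).hom ≫
      homMap (F.complex.d j i) A ≫ (homComplexXIso F A j m hm).inv :=
  HomologicalComplex.extend_d_eq _ ComplexShape.embeddingUpNat hn hm

lemma homComplex_map_f (F : FreeResolution H) {A B : Action V H} (f : A ⟶ B) (i : ℕ) (n : ℤ)
    (hn : (i : ℤ) = n) :
    ((homComplex F).map f).f n = (homComplexXIso F A i n hn).hom ≫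
      homPost (F.complex.X i) f ≫ (homComplexXIso F B i n hn).inv :=
  HomologicalComplex.extendMap_f _ ComplexShape.embeddingUpNat hn

/-- A morphism of resolutions `F ⟶ F'` induces `Hom(F'_*, A)^H ⟶ Hom(F_*, A)^H`. -/
def homComplexNatMap {F F' : FreeResolution H} (φ : F.Hom F') :
    homComplexNat (V := V) F' ⟶ homComplexNat F where
  app A :=
    { f := fun i => homMap (φ.hom.f i) A
      comm' := fun i j _ => by
        dsimp [homComplexNat]
        rw [← homMap_comp, ← homMap_comp, φ.hom.comm] }
  naturality A B f := by
    ext i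
    exact (homMap_naturality (φ.hom.f i) f).symm

/-- The natural transformation `homComplexNatMap`, on the complexes indexed by `ℤ`. -/
def homComplexMap {F F' : FreeResolution H} (φ : F.Hom F') :
    homComplex (V := V) F' ⟶ homComplex F :=
  Functor.whiskerRight (homComplexNatMap φ) _

/-- For a complex `K`, the bicomplex `Hom(F_q, K^p)^H`. -/
abbrev homBicomplex (F : FreeResolution H) (K : CochainComplex (Action V H) ℤ) :
    HomologicalComplex₂ V (ComplexShape.up ℤ) (ComplexShape.up ℤ) :=
  ((homComplex F).mapHomologicalComplex (ComplexShape.up ℤ)).obj K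

lemma isZero_homBicomplex_of_lt_zero (F : FreeResolution H) (K : CochainComplex (Action V H) ℤ)
    (p q : ℤ) (hq : q < 0) : IsZero (((homBicomplex F K).X p).X q) := 
  HomologicalComplex.isZero_extend_X _ _ _ (by
    intro i; simp; omega)

lemma isZero_homBicomplex_of_lt (F : FreeResolution H) (K : CochainComplex (Action V H) ℤ)
    (n : ℤ) [K.IsStrictlyGE n] (p q : ℤ) (hp : p < n) : IsZero (((homBicomplex F K).X p).X q) :=
  Functor.map_isZero (homComplex F ⋙ HomologicalComplex.eval _ _ q)
    (K.isZero_of_isStrictlyGE n p hp)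

instance (F : FreeResolution H) (K : CochainComplex.Plus (Action V H)) :
    (homBicomplex F K.obj).HasTotal (ComplexShape.up ℤ) := by
  obtain ⟨n, hn⟩ := K.property
  exact hasTotal_of_isZero _ n 0 (fun p q => isZero_homBicomplex_of_lt F _ n p q)
    (isZero_homBicomplex_of_lt_zero F _)

/-- For a bounded below complex `K`, the total complex of the bicomplex `Hom(F_q, K^p)^H`. -/
def homTotal (F : FreeResolution H) : CochainComplex.Plus (Action V H) ⥤ CochainComplex.Plus V where
  obj K := ⟨(homBicomplex F K.obj).total (ComplexShape.up ℤ), by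
    obtain ⟨n, hn⟩ := K.property
    refine ⟨n, (CochainComplex.isStrictlyGE_iff _ _).2 fun i hi => ?_⟩
    rw [IsZero.iff_id_eq_zero]
    ext p q h
    have h : p + q = i := h
    refine IsZero.eq_of_src ?_ _ _
    by_cases hp : p < n
    · exact isZero_homBicomplex_of_lt F _ n p q hp
    · exact isZero_homBicomplex_of_lt_zero F _ p q (by omega)⟩
  map f := ObjectProperty.homMk (HomologicalComplex₂.total.map
    (((homComplex F).mapHomologicalComplex _).map f.hom) _)
  map_id K := by
    ext : 1
    simp [HomologicalComplex₂.total.map_id]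
  map_comp f g := by
    ext : 1
    simp [HomologicalComplex₂.total.map_comp]

/-- The inclusion of the summand `Hom(F_q, K^p)^H` in the total complex. -/
def homTotalι (F : FreeResolution H) (K : CochainComplex.Plus (Action V H)) (p q n : ℤ)
    (h : p + q = n) : ((homComplex F).obj (K.obj.X p)).X q ⟶ ((homTotal F).obj K).obj.X n :=
  (homBicomplex F K.obj).ιTotal (ComplexShape.up ℤ) p q n h

lemma homTotalι_d (F : FreeResolution H) (K : CochainComplex.Plus (Action V H))
    (p q n p' q' m : ℤ) (h : p + q = n) (hp : p + 1 = p') (hq : q + 1 = q') (hm : n + 1 = m) :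
    homTotalι F K p q n h ≫ ((homTotal F).obj K).obj.d n m =
      ((homComplex F).map (K.obj.d p p')).f q ≫ homTotalι F K p' q m (by omega) +
      (p.negOnePow : ℤ) •
        (((homComplex F).obj (K.obj.X p)).d q q' ≫ homTotalι F K p q' m (by omega)) := by
  have h₁ : (ComplexShape.up ℤ).Rel p p' := hp
  have h₂ : (ComplexShape.up ℤ).Rel q q' := hq
  have h₃ : p' + q = m := by omega
  have h₄ : p + q' = m := by omega
  change (homBicomplex F K.obj).ιTotal (ComplexShape.up ℤ) p q n h ≫
    ((homBicomplex F K.obj).D₁ (ComplexShape.up ℤ) n m +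
      (homBicomplex F K.obj).D₂ (ComplexShape.up ℤ) n m) = _
  rw [Preadditive.comp_add, HomologicalComplex₂.ι_D₁, HomologicalComplex₂.ι_D₂,
    (homBicomplex F K.obj).d₁_eq (ComplexShape.up ℤ) h₁ q m h₃,
    (homBicomplex F K.obj).d₂_eq (ComplexShape.up ℤ) p h₂ m h₄]
  exact congrArg₂ _ (one_smul _ _) rfl

/-- The morphism of total complexes induced by a morphism of resolutions. -/
def homTotalMap {F F' : FreeResolution H} (φ : F.Hom F') :
    homTotal (V := V) F' ⟶ homTotal F where
  app K := ObjectProperty.homMk (HomologicalComplex₂.total.map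
    ((NatTrans.mapHomologicalComplex (homComplexMap φ) _).app K.obj) _)
  naturality K L f := by
    ext : 1
    simp [homTotal, ← HomologicalComplex₂.total.map_comp]

end HomComplex

section Comparison

variable {C : Type u} [Category.{v} C] [Abelian C] {H : Type v} [Group H]

variable (C H) in
/-- The functor from objects of `C` with an action of `H` to pro-objects with an action of `H`. -/
abbrev proAction : Action C H ⥤ Action (Pro C) H := (proEmbedding C).mapAction H

/-- The morphism `A = Hom(ℤ, A) ⟶ Hom(F₀, A)` induced by the augmentation, with values in
`Hom(F₀, A)^H = ∏_j A`; it is meaningful on fixed points. -/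
def augHom (F : FreeResolution H) (A : Action C H) : A.V ⟶ homObj (F.complex.X 0) A :=
  homLift _ A fun j => ((Representation.trivial ℤ H ℤ).asModuleEquiv (F.ε (basis _ j))) • 𝟙 A.V

/-- The inclusion of the fixed points of `A`, computed in pro-objects, in `A`. -/
def proFixedι (A : Action C H) :
    (fixedPoints (Pro C) H).obj ((proAction C H).obj A) ⟶ (proEmbedding C).obj A.V :=
  fixedPointsι ((proAction C H).obj A)

lemma proFixedι_naturality {A B : Action C H} (f : A ⟶ B) :
    (fixedPoints (Pro C) H).map ((proAction C H).map f) ≫ proFixedι B =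
      proFixedι A ≫ (proEmbedding C).map f.hom :=
  fixedPointsι_naturality ((proAction C H).map f)

lemma proFixedι_smulHom_of (A : Action C H) (g : H) :
    proFixedι A ≫ (proEmbedding C).map (smulHom A (MonoidAlgebra.of ℤ H g)) = proFixedι A := by
  have : smulHom A (MonoidAlgebra.of ℤ H g) = actHom A g := by
    simp [smulHom]; rfl
  rw [this]
  exact fixedPointsι_actHom ((proAction C H).obj A) g

/-- The morphism `A^H = Hom(ℤ, A)^H ⟶ Hom(F₀, A)^H` of pro-objects induced by the augmentation
of the resolution `F`. -/
def fixedAug (F : FreeResolution H) (A : Action C H) :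
    (fixedPoints (Pro C) H).obj ((proAction C H).obj A) ⟶
      (proEmbedding C).obj (homObj (F.complex.X 0) A) :=
  proFixedι A ≫ (proEmbedding C).map (augHom F A)

lemma proFixedι_smulHom (F : FreeResolution H) (A : Action C H) (x : GroupRing H)
    (m : F.complex.X 0) :
    ((Representation.trivial ℤ H ℤ).asModuleEquiv (F.ε m)) •
      (proFixedι A ≫ (proEmbedding C).map (smulHom A x)) =
    ((Representation.trivial ℤ H ℤ).asModuleEquiv (F.ε (x • m))) • proFixedι A := by
  induction x using MonoidAlgebra.induction_on with
  | of g =>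
    rw [proFixedι_smulHom_of, map_smul, Representation.asModuleEquiv_map_smul]
    simp
  | add x y hx hy =>
    rw [smulHom_add, Functor.map_add, Preadditive.comp_add, smul_add, hx, hy, add_smul x y m,
      map_add, map_add, add_smul]
  | smul r x hx =>
    rw [smulHom_zsmul, Functor.map_zsmul, Preadditive.comp_zsmul, smul_comm, hx, smul_assoc r x m]
    rw [map_zsmul, map_zsmul, smul_assoc]

lemma fixedAug_homMap (F : FreeResolution H) (A : Action C H) :
    fixedAug F A ≫ (proEmbedding C).map (homMap (F.complex.d 1 0) A) = 0 := by
  have key : ∀ j, fixedAug F A ≫ (proEmbedding C).map (homMap (F.complex.d 1 0) A ≫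
      homπ _ A j) = 0 := by
    intro j
    have h : augHom F A ≫ homMap (F.complex.d 1 0) A ≫ homπ _ A j =
        ∑ k, ((Representation.trivial ℤ H ℤ).asModuleEquiv (F.ε (basis _ k))) •
          smulHom A ((basis _).repr ((F.complex.d 1 0).hom (basis _ j)) k) := by
      rw [homMap_π, Preadditive.comp_sum]
      refine Finset.sum_congr rfl fun k _ => ?_
      rw [← Category.assoc, augHom, homLift_π, Preadditive.zsmul_comp, Category.id_comp]
    rw [fixedAug, Category.assoc, ← Functor.map_comp, h, Functor.map_sum, Preadditive.comp_sum]
    simp_rw [Functor.map_zsmul, Preadditive.comp_zsmul, proFixedι_smulHom]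
    rw [← Finset.sum_smul, ← map_sum, ← map_sum, (basis _).sum_repr]
    rw [(F.exact_zero _).2 ⟨_, rfl⟩, map_zero, zero_smul]
  have : PreservesFiniteProducts (proEmbedding C) := inferInstance
  have hc := isLimitOfPreserves (proEmbedding C)
    (productIsProduct fun _ : BasisIndex (F.complex.X 1) => A.V)
  refine hc.hom_ext ?_
  rintro ⟨j⟩
  refine Eq.trans ?_ ((key j).trans zero_comp.symm)
  rw [Functor.map_comp]
  exact Category.assoc _ _ _

lemma fixedAug_naturality (F : FreeResolution H) {A B : Action C H} (f : A ⟶ B) :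
    (fixedPoints (Pro C) H).map ((proAction C H).map f) ≫ fixedAug F B =
      fixedAug F A ≫ (proEmbedding C).map (homPost _ f) := by
  have h : f.hom ≫ augHom F B = augHom F A ≫ homPost _ f := by
    refine homObj_ext fun j => ?_
    rw [Category.assoc, Category.assoc, homPost_π, ← Category.assoc (augHom F A), augHom, augHom,
      homLift_π, homLift_π]
    simp
  rw [fixedAug, ← Category.assoc, proFixedι_naturality, Category.assoc, ← Functor.map_comp, h,
    Functor.map_comp, fixedAug, Category.assoc]

/-- The morphism `fixedAug`, viewed as a morphism to the term of degree zero of `homComplex`. -/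
def fixedAugX (F : FreeResolution H) (A : Action C H) :
    (fixedPoints (Pro C) H).obj ((proAction C H).obj A) ⟶
      (proEmbedding C).obj (((homComplex F).obj A).X 0) :=
  fixedAug F A ≫ (proEmbedding C).map (homComplexXIso F A 0 0 rfl).inv

lemma fixedAugX_d (F : FreeResolution H) (A : Action C H) :
    fixedAugX F A ≫ (proEmbedding C).map (((homComplex F).obj A).d 0 1) = 0 := by
  rw [fixedAugX, Category.assoc, ← Functor.map_comp, homComplex_d F A 0 1 0 1 rfl rfl,
    Iso.inv_hom_id_assoc, Functor.map_comp, ← Category.assoc, fixedAug_homMap, zero_comp]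

lemma fixedAugX_naturality (F : FreeResolution H) {A B : Action C H} (f : A ⟶ B) :
    (fixedPoints (Pro C) H).map ((proAction C H).map f) ≫ fixedAugX F B =
      fixedAugX F A ≫ (proEmbedding C).map (((homComplex F).map f).f 0) := by
  rw [fixedAugX, ← Category.assoc, fixedAug_naturality, fixedAugX, Category.assoc, Category.assoc,
    ← Functor.map_comp, ← Functor.map_comp, homComplex_map_f F f 0 0 rfl, Iso.inv_hom_id_assoc]

/-- For a bounded below complex `K`, the morphism of complexes of pro-objects from the fixed points
`K^H` to the total complex of `Hom(F_q, K^p)^H` which is induced by the augmentation of `F`. -/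
def fixedToHomTotal (F : FreeResolution H) (K : CochainComplex.Plus (Action C H)) :
    (fixedPoints (Pro C) H).mapCochainComplexPlus.obj
      ((proAction C H).mapCochainComplexPlus.obj K) ⟶
    (proEmbedding C).mapCochainComplexPlus.obj ((homTotal F).obj K) :=
  ObjectProperty.homMk
    { f := fun n => fixedAugX F (K.obj.X n) ≫
        (proEmbedding C).map (homTotalι F K n 0 n (add_zero n))
      comm' := fun n m hnm => by
        change (fixedAugX F (K.obj.X n) ≫ (proEmbedding C).map _) ≫
          (proEmbedding C).map (((homTotal F).obj K).obj.d n m) =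
          (fixedPoints (Pro C) H).map ((proAction C H).map (K.obj.d n m)) ≫
            fixedAugX F (K.obj.X m) ≫ (proEmbedding C).map _
        rw [← Category.assoc ((fixedPoints (Pro C) H).map _), fixedAugX_naturality, Category.assoc,
          Category.assoc, ← Functor.map_comp, ← Functor.map_comp,
          homTotalι_d F K n 0 n m 1 m (add_zero n) hnm (zero_add 1) hnm, Functor.map_add,
          Preadditive.comp_add, Functor.map_zsmul, Preadditive.comp_zsmul,
          Functor.map_comp _ (((homComplex F).obj (K.obj.X n)).d 0 1),
          ← Category.assoc (fixedAugX F (K.obj.X n))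
            ((proEmbedding C).map (((homComplex F).obj (K.obj.X n)).d 0 1)),
          fixedAugX_d, zero_comp, smul_zero, add_zero] }

end Comparison

/-! ### Derived functors -/

section Derived

variable (C : Type u) [Category.{v} C] [Abelian C] (H : Type v) [Group H]
  [HasDerivedCategory.{w₁} (Action C H)] [HasDerivedCategory.{w₂} C]
  [HasDerivedCategory.{w₃} (Action (Pro C) H)] [HasDerivedCategory.{w₄} (Pro C)]

/-- The functor `K⁺(H-Pro(C)) ⥤ D⁺(Pro(C))` induced by the fixed point functor
`H-Pro(C) ⥤ Pro(C)`. The functor `RΓ(H, ·)` on pro-objects is its right derived functor. -/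
abbrev fixedPointsPlus : HomotopyCategory.Plus (Action (Pro C) H) ⥤ DerivedCategory.Plus (Pro C) :=
  (fixedPoints (Pro C) H).mapHomotopyCategoryPlus ⋙ DerivedCategory.Plus.Qh

variable {C H}

/-- Let `RΓ`, with the natural transformation `α`, be the right derived functor
`D⁺(H-Pro(C)) ⥤ D⁺(Pro(C))` of the fixed point functor. A lift of `RΓ` to `C` consists of
* an additive functor `D⁺(H-C) ⥤ D⁺(C)`;
* for every resolution `F` of `ℤ` by finitely generated free modules, a natural isomorphism between
  this functor and the functor induced by `K ↦ Tot (Hom(F_*, K)^H)`; these isomorphisms are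
  compatible with all morphisms of resolutions;
* a natural isomorphism making the square formed with `RΓ` and with the functors from
  `D⁺(H-C)` and `D⁺(C)` to `D⁺(H-Pro(C))` and `D⁺(Pro(C))` commutative; it is compatible with the
  canonical morphisms from the complex `K^H` of fixed points to `Tot (Hom(F_*, K)^H)` (given by the
  augmentation `F₀ ⟶ ℤ`) and to `RΓ(H, K)` (given by `α`). -/
structure RGammaLift
    (RΓ : DerivedCategory.Plus (Action (Pro C) H) ⥤ DerivedCategory.Plus (Pro C))
    (α : fixedPointsPlus C H ⟶ DerivedCategory.Plus.Qh ⋙ RΓ) where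
  functor : DerivedCategory.Plus (Action C H) ⥤ DerivedCategory.Plus C
  additive : functor.Additive
  resolutionIso (F : FreeResolution H) :
    homTotal F ⋙ DerivedCategory.Plus.Q ≅ DerivedCategory.Plus.Q ⋙ functor
  resolutionIso_comp {F F' : FreeResolution H} (φ : F.Hom F') :
    Functor.whiskerRight (homTotalMap φ) DerivedCategory.Plus.Q ≫ (resolutionIso F).hom =
      (resolutionIso F').hom
  square : functor ⋙ mapDerivedPlus (proEmbedding C) ≅ mapDerivedPlus (proAction C H) ⋙ RΓ
  square_comp (F : FreeResolution H) (K : CochainComplex.Plus (Action C H)) :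
    DerivedCategory.Plus.Q.map (fixedToHomTotal F K) ≫
      (mapDerivedPlusFactors (proEmbedding C)).inv.app ((homTotal F).obj K) ≫
      (mapDerivedPlus (proEmbedding C)).map ((resolutionIso F).hom.app K) ≫
      square.hom.app (DerivedCategory.Plus.Q.obj K) ≫
      RΓ.map ((mapDerivedPlusFactors (proAction C H)).hom.app K) =
    α.app ((HomotopyCategory.Plus.quotient _).obj
      ((proAction C H).mapCochainComplexPlus.obj K))

/-- The cohomology object `H^p(H, A)` in `Pro(C)`, for `A` an object of `C` with an action of `H`,
computed with the functor `RΓ`. -/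
abbrev cohomology
    (RΓ : DerivedCategory.Plus (Action (Pro C) H) ⥤ DerivedCategory.Plus (Pro C))
    (p : ℤ) (A : Action C H) : Pro C :=
  (DerivedCategory.Plus.homologyFunctor (Pro C) p).obj
    (RΓ.obj ((DerivedCategory.Plus.singleFunctor (Action (Pro C) H) 0).obj
      ((proAction C H).obj A)))

end Derived

section Semisimple

/-- An abelian category is semi-simple if all its short exact sequences split. -/
def IsSemisimpleCategory (C : Type*) [Category* C] [Abelian C] : Prop :=
  ∀ S : ShortComplex C, S.ShortExact → Nonempty S.Splitting

/-- `S` is an irreducible (i.e. simple) direct factor of `X`. -/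
def IsIrreducibleFactor {C : Type*} [Category* C] [Abelian C] (S X : C) : Prop :=
  Simple S ∧ Nonempty (Retract S X)

end Semisimple

end GroupCohomologyPro

end

noncomputable section

namespace GroupCohomologyPro

/-! ### Quasi-isomorphisms tested by morphisms out of complexes, and filtered complexes -/

section Corefinements

variable {V : Type*} [Category* V] [Abelian V]

/-! The fixed point functor is derived by coinduced objects; injective objects are not used. Let `V`
be an abelian category in which powers indexed by `H` are exact. An object `A` with an action embeds
in the coinduced object `A^H` of functions on `H`, by `a ↦ (h ↦ h a)`, and evaluation at `1` splits
this embedding in `V`. Iterating the construction on cokernels gives a resolution of `A` which is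
functorial. The fixed points of a coinduced object `B^H` are `B`, so the fixed points of the
resolution have as terms the underlying objects of the iterated cokernels. These are functors which
preserve quasi-isomorphisms, hence so does their total complex
(`quasiIso_fixedCoindResolution_map`). On complexes whose terms are retracts of coinduced objects
("relatively injective"), nothing changes: their coinduced resolutions split equivariantly, and
every additive functor preserves the exactness. A formal criterion
(`isRightDerivedFunctor_of_resolution`) turns this into the existence of the derived functor. It
applies to pro-objects, since powers in `Pro C` are copowers in a category of ind-objects, where
filtered colimits, hence coproducts, are exact.

Let now `F` be a resolution of `ℤ` by finitely generated free modules. The functor `Hom(F_*, ·)^H`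
involves finite products only, so its total complex preserves quasi-isomorphisms over every abelian
category (`quasiIso_homTotal_map`). Its cohomology in degree zero is the object of fixed points. On
a coinduced object, `Hom(F_*, B^H)^H` amounts to additive maps from `F_*` to `B`, and `F_*` is
contractible as an augmented complex of abelian groups (`exists_contraction`), so the higher
cohomology vanishes. The same criterion then shows that `Tot Hom(F_*, K)^H` computes the derived
functor on pro-objects (`exists_iso_homTotal`). The same formula makes sense in `C`, and the exact
embedding of `C` in `Pro C` commutes with it (`homTotalComparison`). This gives the lift and the
square of (a). Two resolutions are related by morphisms which are unique up to homotopy, hence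
unique in the derived category (`plusQ_map_homTotalMap`). Therefore the lift does not depend on `F`,
and uniqueness follows because the derived category is a localization of complexes
(`existsUnique_iso_of_rGammaLift`).

For (b), a finite `F` sends bounded complexes to bounded ones. For (c), the cohomology of `Hom(F_*,
A)^H` is a subquotient of a finite power of `A`. In the semi-simple case it is a direct factor, and
a simple factor `S` has a nonzero morphism to `A`, which is then a split monomorphism.

The technical tool is a comparison theorem for total complexes of bicomplexes in a quadrant
(`FilteredDecomposition.quasiIso`), used both for rows and for columns. It is proved without
spectral sequences, by enlarging the target of test morphisms along monomorphisms. -/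

lemma mono_fromOpcycles_iff_exactAt (K : CochainComplex V ℤ) {n m : ℤ} (h : n + 1 = m) :
    Mono (K.fromOpcycles n m) ↔ K.ExactAt n := by
  rw [K.exactAt_iff_isZero_homology]
  constructor
  · intro _
    have : K.homologyι n = 0 := by
      rw [← cancel_mono (K.fromOpcycles n m), K.homologyι_comp_fromOpcycles, zero_comp]
    rw [IsZero.iff_id_eq_zero, ← cancel_mono (K.homologyι n), this, comp_zero, comp_zero]
  · intro hz
    exact Preadditive.mono_of_isZero_kernel' _ (K.homologyIsKernel n m (by simpa using h)) hz

/-- The morphism `w` factors through the opcycles, which embed in the next term by exactness; the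
pushout of this embedding provides the larger target. This is the dual of lifting a cycle after an
epimorphic refinement. -/
lemma exists_mono_of_exactAt (K : CochainComplex V ℤ) {n m : ℤ} (h : n + 1 = m)
    (hK : K.ExactAt n) {A : V} (w : K.X n ⟶ A) (hw : ∀ l, l + 1 = n → K.d l n ≫ w = 0) :
    ∃ (A' : V) (i : A ⟶ A') (_ : Mono i) (w' : K.X m ⟶ A'), w ≫ i = K.d n m ≫ w' := by
  have := (mono_fromOpcycles_iff_exactAt K h).2 hK
  let w₁ : K.opcycles n ⟶ A := K.descOpcycles w (n - 1) (by simp) (hw _ (by simp))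
  refine ⟨pushout (K.fromOpcycles n m) w₁, pushout.inr _ _, inferInstance, pushout.inl _ _, ?_⟩
  rw [← K.p_fromOpcycles n m, Category.assoc, pushout.condition, ← Category.assoc]
  simp [w₁]

lemma quasiIso_iff_acyclic_mappingCone {X Y : CochainComplex V ℤ} (f : X ⟶ Y) :
    QuasiIso f ↔ (CochainComplex.mappingCone f).Acyclic := by
  rw [← HomotopyCategory.quotient_obj_mem_subcategoryAcyclic_iff_acyclic,
    ← HomologicalComplex.mem_quasiIso_iff, ← HomotopyCategory.quotient_map_mem_quasiIso_iff,
    HomotopyCategory.quasiIso_eq_trW_subcategoryAcyclic]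
  exact ObjectProperty.trW_iff_of_distinguished _ _
    (HomotopyCategory.mappingCone_triangleh_distinguished f)

-- The pair `(y, x)` is a morphism out of degree `n` of the mapping cone which vanishes on
-- boundaries. The cone is acyclic, so `exists_mono_of_exactAt` applies; the sign of `y'` is that of
-- the differential of the cone.
open CochainComplex.mappingCone in
lemma exists_mono_of_quasiIso {X Y : CochainComplex V ℤ} (f : X ⟶ Y) [hf : QuasiIso f]
    (n n' n'' : ℤ) (h : n + 1 = n') (h' : n' + 1 = n'') {A : V}
    (x : Y.X n ⟶ A) (y : X.X n' ⟶ A)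
    (hx : ∀ l, l + 1 = n → Y.d l n ≫ x = 0) (hxy : f.f n ≫ x = X.d n n' ≫ y) :
    ∃ (A' : V) (i : A ⟶ A') (_ : Mono i) (x' : Y.X n' ⟶ A') (y' : X.X n'' ⟶ A'),
      x ≫ i = Y.d n n' ≫ x' ∧ y ≫ i = f.f n' ≫ x' - X.d n' n'' ≫ y' := by
  rw [quasiIso_iff_acyclic_mappingCone] at hf
  obtain ⟨A', i, hi, w', hw'⟩ := exists_mono_of_exactAt _ h (hf n)
    ((snd f).v n n (add_zero n) ≫ x + (fst f).1.v n n' h ≫ y) (by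
      intro l hl
      rw [ext_from_iff f n l hl]
      constructor
      · rw [← Category.assoc, inl_v_d f n l n' (by omega) (by omega), Preadditive.sub_comp]
        simp [hxy]
      · rw [← Category.assoc, inr_f_d]
        simp [hx l hl])
  refine ⟨A', i, hi, (inr f).f n' ≫ w', (inl f).v n'' n' (by omega) ≫ w', ?_, ?_⟩
  · have := (inr f).f n ≫= hw'
    rw [← Category.assoc ((inr f).f n) (HomologicalComplex.d _ _ _), inr_f_d] at this
    simpa using this
  · have := (inl f).v n' n (by omega) ≫= hw'
    rw [← Category.assoc ((inl f).v n' n _) (HomologicalComplex.d _ _ _), inl_v_d f n' n n''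
      (by omega) (by omega)] at this
    simpa using this

-- It is enough to test the universal pair, given by the projection of the mapping cone to its
-- opcycles: its solution factors a monomorphism through `fromOpcycles`, which is then a
-- monomorphism.
open CochainComplex.mappingCone in
lemma quasiIso_of_exists_mono {X Y : CochainComplex V ℤ} (f : X ⟶ Y)
    (H : ∀ (n n' n'' : ℤ) (_ : n + 1 = n') (_ : n' + 1 = n'') (A : V)
      (x : Y.X n ⟶ A) (y : X.X n' ⟶ A)
      (_ : ∀ l, l + 1 = n → Y.d l n ≫ x = 0) (_ : f.f n ≫ x = X.d n n' ≫ y),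
      ∃ (A' : V) (i : A ⟶ A') (_ : Mono i) (x' : Y.X n' ⟶ A') (y' : X.X n'' ⟶ A'),
        x ≫ i = Y.d n n' ≫ x' ∧ y ≫ i = f.f n' ≫ x' - X.d n' n'' ≫ y') :
    QuasiIso f := by
  rw [quasiIso_iff_acyclic_mappingCone]
  intro n
  set K := CochainComplex.mappingCone f
  rw [← mono_fromOpcycles_iff_exactAt K (rfl : n + 1 = n + 1)]
  -- The two components of `K.pOpcycles n`, where `K` is the cone.
  obtain ⟨A', i, hi, x', y', h₁, h₂⟩ := H n (n + 1) (n + 1 + 1) rfl rfl _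
    ((inr f).f n ≫ K.pOpcycles n) ((inl f).v (n + 1) n (by omega) ≫ K.pOpcycles n)
    (by
      intro l hl
      rw [← Category.assoc, ← inr_f_d, Category.assoc, K.d_pOpcycles, comp_zero])
    (by
      have := inl_v_d f n (n - 1) (n + 1) (by omega) (by omega) =≫ K.pOpcycles n
      rw [Category.assoc, K.d_pOpcycles, comp_zero, Preadditive.sub_comp, Category.assoc,
        Category.assoc] at this
      exact sub_eq_zero.1 this.symm)
  have fac : i = K.fromOpcycles n (n + 1) ≫ ((snd f).v (n + 1) (n + 1) (add_zero _) ≫ x' +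
      (fst f).1.v (n + 1) (n + 1 + 1) rfl ≫ y') := by
    rw [← cancel_epi (K.pOpcycles n), ← Category.assoc (K.pOpcycles n) (K.fromOpcycles _ _),
      K.p_fromOpcycles, ext_from_iff f (n + 1) n rfl]
    constructor
    · rw [← Category.assoc, h₂, ← Category.assoc, inl_v_d f (n + 1) n (n + 1 + 1)
        (by omega) (by omega)]
      simp [sub_eq_add_neg]
    · rw [← Category.assoc, h₁, ← Category.assoc, inr_f_d]
      simp
  exact mono_of_mono_fac fac.symm

/-- A decomposition of the terms `X^n` of a complex as sums of objects `G(s)^m` with `s + m = n`,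
such that the differential of `X` increases the index `s`, and induces the differential of `G(s)`,
up to the sign `ε s`, on the graded piece of index `s`. -/
structure FilteredDecomposition (X : CochainComplex V ℤ) (G : ℤ → CochainComplex V ℤ)
    (ε : ℤ → ℤˣ) where
  ι (s m n : ℤ) (h : s + m = n) : (G s).X m ⟶ X.X n
  π (s m n : ℤ) (h : s + m = n) : X.X n ⟶ (G s).X m
  hom_ext {n : ℤ} {A : V} (f g : X.X n ⟶ A) (hfg : ∀ s m h, ι s m n h ≫ f = ι s m n h ≫ g) : f = g
  ι_π (s m n : ℤ) (h : s + m = n) : ι s m n h ≫ π s m n h = 𝟙 _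
  ι_π_of_ne (s m s' m' n : ℤ) (h : s + m = n) (h' : s' + m' = n) (hs : s ≠ s') :
    ι s m n h ≫ π s' m' n h' = 0
  ι_d (s m m' n n' : ℤ) (h : s + m = n) (h' : s + m' = n') (hm : m + 1 = m') {A : V}
    (f : X.X n' ⟶ A) (hf : ∀ t k hk, s < t → ι t k n' hk ≫ f = 0) :
    ι s m n h ≫ X.d n n' ≫ f = (ε s : ℤ) • ((G s).d m m' ≫ ι s m' n' h' ≫ f)

namespace FilteredDecomposition

variable {X Y : CochainComplex V ℤ} {G G' : ℤ → CochainComplex V ℤ} {ε : ℤ → ℤˣ}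
  (D : FilteredDecomposition X G ε) (D' : FilteredDecomposition Y G' ε)

-- The differential never lowers the filtration index. So morphisms obtained by projecting to a
-- piece of index `t` are still zero, after the differential, on the pieces of larger index.
include D in
lemma ι_d_π_of_lt (s m n n' t k : ℤ) (h : s + m = n) (hn : n + 1 = n') (hk : t + k = n')
    (hst : t < s) : D.ι s m n h ≫ X.d n n' ≫ D.π t k n' hk = 0 := by
  rw [D.ι_d s m (m + 1) n n' h (by omega) rfl _ fun t' k' hk' ht' =>
    D.ι_π_of_ne _ _ _ _ _ _ _ (by omega), D.ι_π_of_ne _ _ _ _ _ _ _ (by omega)]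
  simp

lemma ι_d_π (s m m' n n' : ℤ) (h : s + m = n) (h' : s + m' = n') (hm : m + 1 = m') :
    D.ι s m n h ≫ X.d n n' ≫ D.π s m' n' h' = (ε s : ℤ) • (G s).d m m' := by
  rw [D.ι_d s m m' n n' h h' hm _ fun t' k' hk' ht' =>
    D.ι_π_of_ne _ _ _ _ _ _ _ (by omega), D.ι_π]
  simp

lemma smul_smul_unit (e : ℤˣ) {A B : V} (f : A ⟶ B) : (e : ℤ) • (e : ℤ) • f = f := by
  rw [smul_smul, ← Units.val_mul, Int.units_mul_self, Units.val_one, one_smul]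

/-- A morphism of complexes which is compatible with decompositions is a quasi-isomorphism if it
induces quasi-isomorphisms on the graded pieces. -/
theorem quasiIso (f : X ⟶ Y) (g : ∀ s, G s ⟶ G' s)
    (hfg : ∀ s m n h, D.ι s m n h ≫ f.f n = (g s).f m ≫ D'.ι s m n h)
    (a b : ℤ) (ha : ∀ s m, s < a → IsZero ((G s).X m)) (ha' : ∀ s m, s < a → IsZero ((G' s).X m))
    (hb : ∀ s m, m < b → IsZero ((G s).X m)) (hb' : ∀ s m, m < b → IsZero ((G' s).X m))
    [∀ s, QuasiIso (g s)] : QuasiIso f := by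
  refine quasiIso_of_exists_mono f fun n n' n'' hn hn' => ?_
  -- Induction on the number of filtration indices on which the pair `(x, y)` may be nonzero. The
  -- target `A` is universally quantified because each step enlarges it.
  have key (k : ℕ) : ∀ (A : V) (x : Y.X n ⟶ A) (y : X.X n' ⟶ A)
      (_ : ∀ l, l + 1 = n → Y.d l n ≫ x = 0) (_ : f.f n ≫ x = X.d n n' ≫ y)
      (_ : ∀ s m h, a + k ≤ s → D'.ι s m n h ≫ x = 0)
      (_ : ∀ s m h, a + k ≤ s → D.ι s m n' h ≫ y = 0),
      ∃ (A' : V) (i : A ⟶ A') (_ : Mono i) (x' : Y.X n' ⟶ A') (y' : X.X n'' ⟶ A'),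
        x ≫ i = Y.d n n' ≫ x' ∧ y ≫ i = f.f n' ≫ x' - X.d n' n'' ≫ y' := by
    induction k with
    | zero =>
      intro A x y hx hxy hx₀ hy₀
      refine ⟨A, 𝟙 A, inferInstance, 0, 0, ?_, ?_⟩
      · have : x = 0 := D'.hom_ext _ _ fun s m h => by
          by_cases hs : s < a
          · exact (ha' s m hs).eq_of_src _ _
          · rw [hx₀ s m h (by simpa using hs), comp_zero]
        simp [this]
      · have : y = 0 := D.hom_ext _ _ fun s m h => by
          by_cases hs : s < a
          · exact (ha s m hs).eq_of_src _ _
          · rw [hy₀ s m h (by simpa using hs), comp_zero]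
        simp [this]
    | succ k hk =>
      intro A x y hx hxy hx₀ hy₀
      push_cast at hx₀ hy₀
      obtain ⟨s, hs⟩ : ∃ s : ℤ, s = a + k := ⟨_, rfl⟩
      obtain ⟨m, hm⟩ : ∃ m, s + m = n := ⟨n - s, by omega⟩
      have hm' : s + (m + 1) = n' := by omega
      have hm'' : s + (m + 1 + 1) = n'' := by omega
      -- On the largest index `s` where `x` and `y` may be nonzero, they form a pair for `g s`,
      -- since the components of the differential to larger indices do not contribute. The factor `ε
      -- s` compensates the sign in `ι_d`.
      obtain ⟨A', i, hi, x', y', h₁, h₂⟩ := exists_mono_of_quasiIso (g s) m (m + 1) (m + 1 + 1)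
        rfl rfl (D'.ι s m n hm ≫ x) ((ε s : ℤ) • (D.ι s (m + 1) n' hm' ≫ y))
        (by
          intro l hl
          have := D'.ι_d s l m (n - 1) n (by omega) hm hl x fun t k hk ht =>
            hx₀ t k hk (by omega)
          rw [hx (n - 1) (by omega), comp_zero] at this
          rw [← smul_smul_unit (ε s) (_ ≫ _), ← this, smul_zero])
        (by
          rw [← Category.assoc, ← hfg, Category.assoc, hxy,
            D.ι_d s m (m + 1) n n' hm hm' rfl y fun t k hk ht => hy₀ t k hk (by omega),
            Preadditive.comp_zsmul])
      -- Extension by zero of the solution on the piece of index `s`. Only `u` carries a sign: in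
      -- the formula for `y`, the factor `ε s` of the differential already gives the sign for `w`.
      let u : Y.X n' ⟶ A' := (ε s : ℤ) • (D'.π s (m + 1) n' hm' ≫ x')
      let w : X.X n'' ⟶ A' := D.π s (m + 1 + 1) n'' hm'' ≫ y'
      have hw : X.d n' n'' ≫ f.f n'' = f.f n' ≫ Y.d n' n'' := (f.comm _ _).symm
      have hu (t k h) (ht : s < t) : D'.ι t k n h ≫ Y.d n n' ≫ u = 0 := by
        have := D'.ι_d_π_of_lt t k n n' s (m + 1) h hn hm' ht =≫ x'
        simp only [Category.assoc, zero_comp] at this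
        simp [u, this]
      have hu' : D'.ι s m n hm ≫ Y.d n n' ≫ u = (G' s).d m (m + 1) ≫ x' := by
        have := D'.ι_d_π s m (m + 1) n n' hm hm' rfl =≫ x'
        simp only [Category.assoc, Preadditive.zsmul_comp] at this
        simp only [u, Preadditive.comp_zsmul, this, smul_smul_unit]
      have hfu (t k h) (ht : s < t) : D.ι t k n' h ≫ f.f n' ≫ u = 0 := by
        rw [← Category.assoc, hfg]
        have := D'.ι_π_of_ne t k s (m + 1) n' h hm' (by omega) =≫ x'
        simp only [Category.assoc, zero_comp] at this
        simp [u, this]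
      have hfu' : D.ι s (m + 1) n' hm' ≫ f.f n' ≫ u = (ε s : ℤ) • ((g s).f (m + 1) ≫ x') := by
        rw [← Category.assoc, hfg]
        have := D'.ι_π s (m + 1) n' hm' =≫ x'
        simp only [Category.assoc, Category.id_comp] at this
        simp [u, this]
      have hdw (t k h) (ht : s < t) : D.ι t k n' h ≫ X.d n' n'' ≫ w = 0 := by
        have := D.ι_d_π_of_lt t k n' n'' s (m + 1 + 1) h hn' hm'' ht =≫ y'
        simpa only [Category.assoc, zero_comp] using this
      have hdw' : D.ι s (m + 1) n' hm' ≫ X.d n' n'' ≫ w =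
          (ε s : ℤ) • ((G s).d (m + 1) (m + 1 + 1) ≫ y') := by
        have := D.ι_d_π s (m + 1) (m + 1 + 1) n' n'' hm' hm'' rfl =≫ y'
        simpa only [Category.assoc, Preadditive.zsmul_comp] using this
      -- Subtracting the coboundary of `(u, w)` kills the piece of index `s` and keeps zero on
      -- larger indices, so the induction hypothesis applies to the difference.
      obtain ⟨A'', j, hj, x'', y'', h₃, h₄⟩ := hk A' (x ≫ i - Y.d n n' ≫ u)
        (y ≫ i - f.f n' ≫ u + X.d n' n'' ≫ w)
        (by
          intro l hl
          rw [Preadditive.comp_sub, ← Category.assoc, hx l hl, zero_comp, ← Category.assoc,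
            Y.d_comp_d, zero_comp, sub_zero])
        (by
          rw [Preadditive.comp_sub, Preadditive.comp_add, Preadditive.comp_sub, ← Category.assoc,
            hxy, Category.assoc, ← Category.assoc (X.d n n') (X.d n' n''), X.d_comp_d, zero_comp,
            add_zero, ← Category.assoc (f.f n), ← Category.assoc (X.d n n') (f.f n'), f.comm])
        (by
          intro t r ht hst
          rw [Preadditive.comp_sub]
          obtain hst | rfl := lt_or_eq_of_le (hs.le.trans hst)
          · rw [hu t r ht hst, ← Category.assoc, hx₀ t r ht (by omega), zero_comp, sub_zero]
          · obtain rfl : r = m := by omega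
            rw [hu', ← h₁, Category.assoc, sub_self])
        (by
          intro t r ht hst
          rw [Preadditive.comp_add, Preadditive.comp_sub]
          obtain hst | rfl := lt_or_eq_of_le (hs.le.trans hst)
          · rw [hfu t r ht hst, hdw t r ht hst, ← Category.assoc, hy₀ t r ht (by omega),
              zero_comp, sub_zero, add_zero]
          · obtain rfl : r = m + 1 := by omega
            have h₅ : (D.ι s (m + 1) n' hm' ≫ y) ≫ i = (ε s : ℤ) • ((g s).f (m + 1) ≫ x' -
                (G s).d (m + 1) (m + 1 + 1) ≫ y') := by
              rw [← h₂, Preadditive.zsmul_comp, smul_smul_unit]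
            rw [hfu', hdw', ← Category.assoc, h₅, smul_sub]
            abel)
      refine ⟨A'', i ≫ j, mono_comp _ _, u ≫ j + x'', w ≫ j + y'', ?_, ?_⟩
      · rw [Preadditive.comp_add, ← h₃, Preadditive.sub_comp]
        simp
      · rw [Preadditive.comp_add, Preadditive.comp_add]
        rw [Preadditive.add_comp, Preadditive.sub_comp] at h₄
        simp only [Category.assoc] at h₄ ⊢
        rw [add_sub_add_comm, ← h₄]
        abel
  intro A x y hx hxy
  -- With this bound, `s ≥ a + k` forces the second index of a piece of total degree at most `n'` to
  -- be less than `b`, where the pieces are zero.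
  refine key (n' + 1 - a - b).toNat A x y hx hxy ?_ ?_
  · intro s m h hs
    exact (hb' s m (by omega)).eq_of_src _ _
  · intro s m h hs
    exact (hb s m (by omega)).eq_of_src _ _

end FilteredDecomposition

end Corefinements

/-! ### Total complexes of bicomplexes, filtered by columns and by rows -/

section Bicomplexes

variable {V : Type*} [Category* V] [Abelian V]

/-- The bicomplexes, viewed as complexes of complexes, with both gradings by integers. -/
abbrev Bicomplex (V : Type*) [Category* V] [Abelian V] :=
  HomologicalComplex₂ V (ComplexShape.up ℤ) (ComplexShape.up ℤ)

variable (B : Bicomplex V) [B.HasTotal (ComplexShape.up ℤ)]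

/-- The total complex of a bicomplex. -/
abbrev tot : CochainComplex V ℤ := B.total (ComplexShape.up ℤ)

/-- The inclusion of a summand in the total complex. -/
def totι (p q n : ℤ) (h : p + q = n) : (B.X p).X q ⟶ (tot B).X n :=
  B.ιTotal (ComplexShape.up ℤ) p q n h

variable {B} in
lemma tot_hom_ext {n : ℤ} {A : V} {f g : (tot B).X n ⟶ A}
    (h : ∀ p q h, totι B p q n h ≫ f = totι B p q n h ≫ g) : f = g :=
  HomologicalComplex₂.total.hom_ext _ h

/-- Constructor for morphisms from the terms of the total complex. -/
def totDesc {n : ℤ} {A : V} (f : ∀ p q, p + q = n → ((B.X p).X q ⟶ A)) : (tot B).X n ⟶ A :=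
  B.totalDesc f

@[simp]
lemma totι_totDesc {n : ℤ} {A : V} (f : ∀ p q, p + q = n → ((B.X p).X q ⟶ A)) (p q h) :
    totι B p q n h ≫ totDesc B f = f p q h :=
  HomologicalComplex₂.ι_totalDesc _ _ _ _ _

lemma totι_d (p q n p' q' m : ℤ) (h : p + q = n) (hp : p + 1 = p') (hq : q + 1 = q')
    (hm : n + 1 = m) :
    totι B p q n h ≫ (tot B).d n m =
      (B.d p p').f q ≫ totι B p' q m (by omega) +
      (p.negOnePow : ℤ) • ((B.X p).d q q' ≫ totι B p q' m (by omega)) := by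
  have h₁ : (ComplexShape.up ℤ).Rel p p' := hp
  have h₂ : (ComplexShape.up ℤ).Rel q q' := hq
  have h₃ : p' + q = m := by omega
  have h₄ : p + q' = m := by omega
  change B.ιTotal (ComplexShape.up ℤ) p q n h ≫
    (B.D₁ (ComplexShape.up ℤ) n m + B.D₂ (ComplexShape.up ℤ) n m) = _
  rw [Preadditive.comp_add, HomologicalComplex₂.ι_D₁, HomologicalComplex₂.ι_D₂,
    B.d₁_eq (ComplexShape.up ℤ) h₁ q m h₃, B.d₂_eq (ComplexShape.up ℤ) p h₂ m h₄]
  exact congrArg₂ _ (one_smul _ _) rfl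

/-- The projection of the total complex to a summand. -/
def totπ (p q n : ℤ) (h : p + q = n) : (tot B).X n ⟶ (B.X p).X q :=
  totDesc B fun p' q' h' => if hp : p' = p then (B.XXIsoOfEq _ _ _ hp (by omega)).hom else 0

@[simp]
lemma totι_π (p q n : ℤ) (h : p + q = n) : totι B p q n h ≫ totπ B p q n h = 𝟙 _ := by
  simp [totπ]

lemma totι_π_of_ne (p q p' q' n : ℤ) (h : p + q = n) (h' : p' + q' = n) (hp : p ≠ p') :
    totι B p q n h ≫ totπ B p' q' n h' = 0 := by
  simp [totπ, hp]

/-- The decomposition of the total complex, with respect to the first index. -/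
def columnDecomposition : FilteredDecomposition (tot B) B.X Int.negOnePow where
  ι := totι B
  π := totπ B
  hom_ext _ _ h := tot_hom_ext h
  ι_π := totι_π B
  ι_π_of_ne := totι_π_of_ne B
  ι_d s m m' n n' h h' hm A f hf := by
    rw [← Category.assoc, totι_d B s m n (s + 1) m' n' h rfl hm (by omega), Preadditive.add_comp,
      Category.assoc, hf _ _ _ (by omega), comp_zero, zero_add, Preadditive.zsmul_comp,
      Category.assoc]

/-- The row of index `q` of a bicomplex. -/
@[simps]
def row (q : ℤ) : CochainComplex V ℤ where
  X p := (B.X p).X q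
  d p p' := (B.d p p').f q
  shape p p' h := by rw [B.shape p p' h, HomologicalComplex.zero_f]
  d_comp_d' p p' p'' _ _ := by rw [← HomologicalComplex.comp_f, B.d_comp_d, HomologicalComplex.zero_f]

/-- The morphism of rows of index `q` induced by a morphism of bicomplexes. -/
@[simps]
def rowMap {B B' : Bicomplex V} (f : B ⟶ B') (q : ℤ) : row B q ⟶ row B' q where
  f p := (f.f p).f q
  comm' p p' _ := by
    exact (HomologicalComplex.comp_f _ _ q).symm.trans
      ((congrArg (fun φ => φ.f q) (f.comm p p')).trans (HomologicalComplex.comp_f _ _ q))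

/-- The decomposition of the total complex, with respect to the second index. -/
def rowDecomposition : FilteredDecomposition (tot B) (row B) 1 where
  ι q p n h := totι B p q n (by omega)
  π q p n h := totπ B p q n (by omega)
  hom_ext _ _ h := tot_hom_ext fun p q hpq => h q p (by omega)
  ι_π q p n h := totι_π B _ _ _ _
  ι_π_of_ne q p q' p' n h h' hq := totι_π_of_ne B _ _ _ _ _ _ _ (by omega)
  ι_d s m m' n n' h h' hm A f hf := by
    -- The signed part of the total differential raises the second index, so it is killed by `f`;
    -- what is left has no sign, whence `ε = 1`.
    have hf' : totι B m (s + 1) n' (by omega) ≫ f = 0 := hf (s + 1) m (by omega) (by omega)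
    change totι B m s n _ ≫ (tot B).d n n' ≫ f =
      ((1 : ℤˣ) : ℤ) • ((B.d m m').f s ≫ totι B m' s n' _ ≫ f)
    rw [← Category.assoc, totι_d B m s n m' (s + 1) n' (by omega) hm rfl (by omega),
      Preadditive.add_comp, Category.assoc, Preadditive.zsmul_comp, Category.assoc,
      hf', comp_zero, smul_zero, add_zero, Units.val_one, one_smul]

variable {B} {B' : Bicomplex V} [B'.HasTotal (ComplexShape.up ℤ)]

/-- The morphism between total complexes induced by a morphism of bicomplexes. -/
abbrev totMap (f : B ⟶ B') : tot B ⟶ tot B' := HomologicalComplex₂.total.map f _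

@[simp]
lemma totι_totMap (f : B ⟶ B') (p q n : ℤ) (h : p + q = n) :
    totι B p q n h ≫ (totMap f).f n = (f.f p).f q ≫ totι B' p q n h :=
  HomologicalComplex₂.ιTotal_map _ _ _ _ _ _ _ _

/-- A bicomplex is zero outside of the quadrant of indices `(p, q)` with `a ≤ p` and `b ≤ q`. -/
structure IsSupportedGE (B : Bicomplex V) (a b : ℤ) : Prop where
  left (p q : ℤ) (hp : p < a) : IsZero ((B.X p).X q)
  right (p q : ℤ) (hq : q < b) : IsZero ((B.X p).X q)

lemma IsSupportedGE.hasTotal {a b : ℤ} {B : Bicomplex V} (h : IsSupportedGE B a b) :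
    B.HasTotal (ComplexShape.up ℤ) :=
  hasTotal_of_isZero B a b h.1 h.2

lemma IsSupportedGE.mono {a b a' b' : ℤ} {B : Bicomplex V} (h : IsSupportedGE B a b)
    (ha : a' ≤ a) (hb : b' ≤ b) : IsSupportedGE B a' b' :=
  ⟨fun p q hp => h.1 p q (by omega), fun p q hq => h.2 p q (by omega)⟩

lemma IsSupportedGE.isStrictlyGE {a b : ℤ} (h : IsSupportedGE B a b) :
    (tot B).IsStrictlyGE (a + b) := by
  refine (CochainComplex.isStrictlyGE_iff _ _).2 fun i hi => ?_
  rw [IsZero.iff_id_eq_zero]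
  refine tot_hom_ext fun p q hpq => IsZero.eq_of_src ?_ _ _
  by_cases hp : p < a
  · exact h.1 p q hp
  · exact h.2 p q (by omega)

/-- The graded pieces of the filtration by the first index are the columns, with differential
multiplied by `(-1)^p`. -/
lemma quasiIso_totMap_of_columns {a b : ℤ} (h : IsSupportedGE B a b) (h' : IsSupportedGE B' a b)
    (f : B ⟶ B') [∀ p, QuasiIso (f.f p)] : QuasiIso (totMap f) :=
  FilteredDecomposition.quasiIso (columnDecomposition B) (columnDecomposition B') _ f.f
    (totι_totMap f) a b h.1 h'.1 (fun _ _ => h.2 _ _) (fun _ _ => h'.2 _ _)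

lemma quasiIso_totMap_of_rows {a b : ℤ} (h : IsSupportedGE B a b) (h' : IsSupportedGE B' a b)
    (f : B ⟶ B') (hf : ∀ q, QuasiIso (rowMap f q)) : QuasiIso (totMap f) :=
  FilteredDecomposition.quasiIso (rowDecomposition B) (rowDecomposition B') _ (rowMap f)
    (fun q p n hpq => totι_totMap f p q n (by omega)) b a
    (fun q p hq => h.2 p q hq) (fun q p hq => h'.2 p q hq) (fun q p hp => h.1 p q hp)
    (fun q p hp => h'.1 p q hp)

/-- The identity of a term of the total complex, as a sum over its summands. -/
lemma sum_totπ_totι {a b : ℤ} (h : IsSupportedGE B a b) (n : ℤ) :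
    ∑ p ∈ Finset.Icc a (n - b), totπ B p (n - p) n (by omega) ≫ totι B p (n - p) n (by omega) =
      𝟙 _ := by
  refine tot_hom_ext fun p q hpq => ?_
  obtain rfl : q = n - p := by omega
  rw [Preadditive.comp_sum]
  by_cases hp : p ∈ Finset.Icc a (n - b)
  · rw [Finset.sum_eq_single p]
    · rw [← Category.assoc, totι_π, Category.id_comp, Category.comp_id]
    · intro p' _ hp'
      rw [← Category.assoc, totι_π_of_ne _ _ _ _ _ _ _ _ hp'.symm, zero_comp]
    · exact fun h => (h hp).elim
  · rw [Finset.mem_Icc] at hp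
    refine IsZero.eq_of_src ?_ _ _
    by_cases hp' : p < a
    · exact h.1 _ _ hp'
    · exact h.2 _ _ (by omega)

end Bicomplexes

/-! ### Additive functors commute with total complexes -/

section MapTotal

variable {V W : Type*} [Category* V] [Abelian V] [Category* W] [Abelian W] (G : V ⥤ W) [G.Additive]

/-- The bicomplex obtained by applying an additive functor. -/
abbrev mapBicomplex : Bicomplex V ⥤ Bicomplex W :=
  (G.mapHomologicalComplex (ComplexShape.up ℤ)).mapHomologicalComplex (ComplexShape.up ℤ)

variable (B : Bicomplex V) [B.HasTotal (ComplexShape.up ℤ)]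
  [((mapBicomplex G).obj B).HasTotal (ComplexShape.up ℤ)]

/-- The inclusion of a summand in the total complex of the image of a bicomplex by a functor. -/
def mapι (p q n : ℤ) (h : p + q = n) :
    G.obj ((B.X p).X q) ⟶ (tot ((mapBicomplex G).obj B)).X n :=
  totι ((mapBicomplex G).obj B) p q n h

variable {G B} in
lemma tot_map_hom_ext {n : ℤ} {A : W} {f g : (tot ((mapBicomplex G).obj B)).X n ⟶ A}
    (h : ∀ p q h, mapι G B p q n h ≫ f = mapι G B p q n h ≫ g) : f = g :=
  tot_hom_ext h

lemma mapι_d (p q n p' q' m : ℤ) (h : p + q = n) (hp : p + 1 = p') (hq : q + 1 = q')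
    (hm : n + 1 = m) :
    mapι G B p q n h ≫ (tot ((mapBicomplex G).obj B)).d n m =
      G.map ((B.d p p').f q) ≫ mapι G B p' q m (by omega) +
      (p.negOnePow : ℤ) • (G.map ((B.X p).d q q') ≫ mapι G B p q' m (by omega)) :=
  totι_d ((mapBicomplex G).obj B) p q n p' q' m h hp hq hm

/-- The components of `totMapComparison`. -/
def totMapComparisonX (n : ℤ) : (tot ((mapBicomplex G).obj B)).X n ⟶ G.obj ((tot B).X n) :=
  totDesc ((mapBicomplex G).obj B) fun p q h => G.map (totι B p q n h)

@[simp]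
lemma mapι_totMapComparisonX (p q n : ℤ) (h : p + q = n) :
    mapι G B p q n h ≫ totMapComparisonX G B n = G.map (totι B p q n h) :=
  totι_totDesc ((mapBicomplex G).obj B) (fun p q h => G.map (totι B p q n h)) p q h

lemma totMapComparisonX_d (n m : ℤ) (hnm : n + 1 = m) :
    totMapComparisonX G B n ≫ G.map ((tot B).d n m) =
      (tot ((mapBicomplex G).obj B)).d n m ≫ totMapComparisonX G B m := by
  refine tot_map_hom_ext fun p q h => ?_
  rw [← Category.assoc, mapι_totMapComparisonX, ← Category.assoc,
    mapι_d G B p q n (p + 1) (q + 1) m h rfl rfl hnm,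
    Preadditive.add_comp, Preadditive.zsmul_comp, Category.assoc, Category.assoc,
    mapι_totMapComparisonX, mapι_totMapComparisonX, ← G.map_comp,
    totι_d B p q n (p + 1) (q + 1) m h rfl rfl hnm, G.map_add, G.map_zsmul,
    G.map_comp, G.map_comp]

/-- The comparison morphism between the total complex of the image of a bicomplex by an additive
functor and the image of the total complex. -/
def totMapComparison : tot ((mapBicomplex G).obj B) ⟶
    (G.mapHomologicalComplex (ComplexShape.up ℤ)).obj (tot B) where
  f n := totMapComparisonX G B n
  comm' n m hnm := totMapComparisonX_d G B n m hnm

variable {B}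

/-- In a quadrant each term of the total complex is a finite direct sum, which every additive
functor preserves. The inverse is written with the finitely many projections and inclusions. -/
lemma isIso_totMapComparisonX {a b : ℤ} (h : IsSupportedGE B a b) (n : ℤ) :
    IsIso (totMapComparisonX G B n) := by
  refine ⟨∑ p ∈ Finset.Icc a (n - b), G.map (totπ B p (n - p) n (by omega)) ≫
    mapι G B p (n - p) n (by omega), ?_, ?_⟩
  · refine tot_map_hom_ext fun p q hpq => ?_
    obtain rfl : q = n - p := by omega
    rw [← Category.assoc, mapι_totMapComparisonX, Preadditive.comp_sum, Category.comp_id]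
    by_cases hp : p ∈ Finset.Icc a (n - b)
    · rw [Finset.sum_eq_single p]
      · rw [← Category.assoc, ← G.map_comp, totι_π, G.map_id, Category.id_comp]
      · intro p' _ hp'
        rw [← Category.assoc, ← G.map_comp, totι_π_of_ne _ _ _ _ _ _ _ _ hp'.symm, G.map_zero,
          zero_comp]
      · exact fun h => (h hp).elim
    · rw [Finset.mem_Icc] at hp
      refine IsZero.eq_of_src (G.map_isZero ?_) _ _
      by_cases hp' : p < a
      · exact h.1 _ _ hp'
      · exact h.2 _ _ (by omega)
  · rw [Preadditive.sum_comp]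
    simp only [Category.assoc, mapι_totMapComparisonX]
    simp only [← G.map_comp, ← G.map_sum, sum_totπ_totι h, G.map_id]

lemma isIso_totMapComparison {a b : ℤ} (h : IsSupportedGE B a b) :
    IsIso (totMapComparison G B) := by
  have (n : ℤ) : IsIso ((totMapComparison G B).f n) := isIso_totMapComparisonX G h n
  exact HomologicalComplex.Hom.isIso_of_components _

end MapTotal

/-! ### The total complex of `M(K^p)^q` for a functor `M` to complexes -/

section TotalPlus

variable {E V : Type*} [Category* E] [Abelian E] [Category* V] [Abelian V]

/-- A functor to cochain complexes takes values in complexes concentrated in degrees `≥ 0`. -/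
class IsNonnegative (M : E ⥤ CochainComplex V ℤ) : Prop where
  isZero (A : E) (q : ℤ) (hq : q < 0) : IsZero ((M.obj A).X q)

variable (M : E ⥤ CochainComplex V ℤ) [M.Additive] [IsNonnegative M]

/-- The bicomplex obtained by applying a functor to complexes to the terms of a complex. -/
abbrev bicomplex : CochainComplex E ℤ ⥤ Bicomplex V :=
  M.mapHomologicalComplex (ComplexShape.up ℤ)

lemma isSupportedGE_bicomplex (K : CochainComplex E ℤ) (n : ℤ) [K.IsStrictlyGE n] :
    IsSupportedGE ((bicomplex M).obj K) n 0 where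
  left _ q hp := (M ⋙ HomologicalComplex.eval _ _ q).map_isZero (K.isZero_of_isStrictlyGE n _ hp)
  right _ _ hq := IsNonnegative.isZero _ _ hq

lemma exists_isSupportedGE_bicomplex (K : CochainComplex.Plus E) :
    ∃ n, IsSupportedGE ((bicomplex M).obj K.obj) n 0 := by
  obtain ⟨n, _⟩ := K.property
  exact ⟨n, isSupportedGE_bicomplex M K.obj n⟩

lemma hasTotal_bicomplex (K : CochainComplex.Plus E) :
    ((bicomplex M).obj K.obj).HasTotal (ComplexShape.up ℤ) := by
  obtain ⟨n, h⟩ := exists_isSupportedGE_bicomplex M K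
  exact h.hasTotal

instance (K : CochainComplex.Plus E) : ((bicomplex M).obj K.obj).HasTotal (ComplexShape.up ℤ) :=
  hasTotal_bicomplex M K

/-- The functor which sends a bounded below complex `K` to the total complex of the
bicomplex `M(K^p)^q`. -/
def totalPlus : CochainComplex.Plus E ⥤ CochainComplex.Plus V where
  obj K := ⟨tot ((bicomplex M).obj K.obj), by
    obtain ⟨n, h⟩ := exists_isSupportedGE_bicomplex M K
    exact ⟨_, h.isStrictlyGE⟩⟩
  map f := ObjectProperty.homMk (totMap ((bicomplex M).map f.hom))
  map_id K := by
    ext : 1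
    simp [HomologicalComplex₂.total.map_id]
  map_comp f g := by
    ext : 1
    simp [HomologicalComplex₂.total.map_comp]

instance : (totalPlus M).Additive where
  map_add {K L f g} := by
    ext n : 3
    refine tot_hom_ext fun p q h => ?_
    refine (totι_totMap _ _ _ _ _).trans ?_
    refine Eq.trans ?_ (Preadditive.comp_add _ _ _ _ _ _).symm
    refine Eq.trans ?_ (congrArg₂ _ (totι_totMap _ _ _ _ _) (totι_totMap _ _ _ _ _)).symm
    rw [← Preadditive.add_comp]
    congr 1
    change (M.map ((f + g).hom.f p)).f q = (M.map (f.hom.f p)).f q + (M.map (g.hom.f p)).f q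
    rw [← HomologicalComplex.add_f_apply, ← M.map_add]
    rfl

/-- The inclusion of the summand `M(K^p)^q`. -/
def totalPlusι (K : CochainComplex.Plus E) (p q n : ℤ) (h : p + q = n) :
    (M.obj (K.obj.X p)).X q ⟶ ((totalPlus M).obj K).obj.X n :=
  totι ((bicomplex M).obj K.obj) p q n h

/-- The projection to the summand `M(K^p)^q`. -/
def totalPlusπ (K : CochainComplex.Plus E) (p q n : ℤ) (h : p + q = n) :
    ((totalPlus M).obj K).obj.X n ⟶ (M.obj (K.obj.X p)).X q :=
  totπ ((bicomplex M).obj K.obj) p q n h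

@[simp]
lemma totalPlusι_π (K : CochainComplex.Plus E) (p q n : ℤ) (h : p + q = n) :
    totalPlusι M K p q n h ≫ totalPlusπ M K p q n h = 𝟙 _ :=
  totι_π ((bicomplex M).obj K.obj) p q n h

lemma totalPlusι_π_assoc (K : CochainComplex.Plus E) (p q n : ℤ) (h : p + q = n) {X : V}
    (f : (M.obj (K.obj.X p)).X q ⟶ X) :
    totalPlusι M K p q n h ≫ totalPlusπ M K p q n h ≫ f = f := by
  rw [← Category.assoc, totalPlusι_π, Category.id_comp]

variable {M} in
lemma totalPlus_hom_ext {K : CochainComplex.Plus E} {n : ℤ} {A : V}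
    {f g : ((totalPlus M).obj K).obj.X n ⟶ A}
    (h : ∀ p q h, totalPlusι M K p q n h ≫ f = totalPlusι M K p q n h ≫ g) : f = g :=
  tot_hom_ext h

lemma totalPlusι_d (K : CochainComplex.Plus E) (p q n p' q' m : ℤ) (h : p + q = n)
    (hp : p + 1 = p') (hq : q + 1 = q') (hm : n + 1 = m) :
    totalPlusι M K p q n h ≫ ((totalPlus M).obj K).obj.d n m =
      (M.map (K.obj.d p p')).f q ≫ totalPlusι M K p' q m (by omega) +
      (p.negOnePow : ℤ) • ((M.obj (K.obj.X p)).d q q' ≫ totalPlusι M K p q' m (by omega)) :=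
  totι_d ((bicomplex M).obj K.obj) p q n p' q' m h hp hq hm

lemma totalPlusι_map {K L : CochainComplex.Plus E} (f : K ⟶ L) (p q n : ℤ) (h : p + q = n) :
    totalPlusι M K p q n h ≫ ((totalPlus M).map f).hom.f n =
      (M.map (f.hom.f p)).f q ≫ totalPlusι M L p q n h :=
  totι_totMap ((bicomplex M).map f.hom) p q n h

/-- For fixed `q`, applying the functor `M(·)^q` to `K` gives the row of index `q`, so this is the
criterion by rows; it serves to show that `totalPlus M` descends to derived categories. -/
lemma quasiIso_totalPlus_map {K L : CochainComplex.Plus E} (f : K ⟶ L)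
    (hf : ∀ q, QuasiIso
      (((M ⋙ HomologicalComplex.eval _ _ q).mapHomologicalComplex (ComplexShape.up ℤ)).map
        f.hom)) :
    CochainComplex.Plus.quasiIso V ((totalPlus M).map f) := by
  obtain ⟨a, h⟩ := exists_isSupportedGE_bicomplex M K
  obtain ⟨b, h'⟩ := exists_isSupportedGE_bicomplex M L
  -- The minimum gives a quadrant which contains both bicomplexes.
  exact quasiIso_totMap_of_rows (h.mono (min_le_left a b) le_rfl)
    (h'.mono (min_le_right a b) le_rfl) ((bicomplex M).map f.hom) hf

section

variable {M} {M' : E ⥤ CochainComplex V ℤ} [M'.Additive] [IsNonnegative M'] (τ : M ⟶ M')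

/-- The natural transformation between total complexes induced by a natural transformation. -/
def totalPlusNatTrans : totalPlus M ⟶ totalPlus M' where
  app K := ObjectProperty.homMk (totMap ((NatTrans.mapHomologicalComplex τ _).app K.obj))
  naturality K L f := by
    ext : 1
    simp [totalPlus, ← HomologicalComplex₂.total.map_comp]

lemma totalPlusι_natTrans_app (K : CochainComplex.Plus E) (p q n : ℤ) (h : p + q = n) :
    totalPlusι M K p q n h ≫ ((totalPlusNatTrans τ).app K).hom.f n =
      (τ.app (K.obj.X p)).f q ≫ totalPlusι M' K p q n h :=
  totι_totMap ((NatTrans.mapHomologicalComplex τ _).app K.obj) p q n h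

lemma quasiIso_totalPlusNatTrans_app (K : CochainComplex.Plus E)
    (h : ∀ n, QuasiIso (τ.app (K.obj.X n))) :
    CochainComplex.Plus.quasiIso V ((totalPlusNatTrans τ).app K) := by
  obtain ⟨a, ha⟩ := exists_isSupportedGE_bicomplex M K
  obtain ⟨b, hb⟩ := exists_isSupportedGE_bicomplex M' K
  have (p : ℤ) : QuasiIso (((NatTrans.mapHomologicalComplex τ (ComplexShape.up ℤ)).app K.obj).f p) :=
    h p
  exact quasiIso_totMap_of_columns (ha.mono (min_le_left a b) le_rfl)
    (hb.mono (min_le_right a b) le_rfl) ((NatTrans.mapHomologicalComplex τ _).app K.obj)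

end

section Augmentation

variable {M} {G : E ⥤ V} [G.Additive]

instance : IsNonnegative (G ⋙ CochainComplex.singleFunctor V 0) where
  isZero _ _ hq := HomologicalComplex.isZero_single_obj_X _ _ _ _ hq.ne

instance : (G ⋙ CochainComplex.singleFunctor V 0).Additive := inferInstance

variable (τ : G ⋙ CochainComplex.singleFunctor V 0 ⟶ M)

variable (G) in
/-- The term in degree zero of a single complex. -/
def singleX₀ (A : E) : G.obj A ≅ ((G ⋙ CochainComplex.singleFunctor V 0).obj A).X 0 :=
  (HomologicalComplex.singleObjXSelf (ComplexShape.up ℤ) 0 (G.obj A)).symm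

lemma singleX₀_naturality {A B : E} (f : A ⟶ B) :
    G.map f ≫ (singleX₀ G B).hom =
      (singleX₀ G A).hom ≫ ((G ⋙ CochainComplex.singleFunctor V 0).map f).f 0 :=
  ((((HomologicalComplex.singleObjXSelf (ComplexShape.up ℤ) 0 (G.obj A)).inv ≫=
    HomologicalComplex.single_map_f_self (ComplexShape.up ℤ) 0 (G.map f))).trans
      (Iso.inv_hom_id_assoc _ _)).symm

/-- The degree zero component of an augmentation. -/
def augX (A : E) : G.obj A ⟶ (M.obj A).X 0 :=
  (singleX₀ G A).hom ≫ (τ.app A).f 0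

lemma augX_naturality {A B : E} (f : A ⟶ B) :
    G.map f ≫ augX τ B = augX τ A ≫ (M.map f).f 0 := by
  have := congrArg (fun φ => φ.f 0) (τ.naturality f)
  simp only [HomologicalComplex.comp_f] at this
  rw [augX, augX, Category.assoc, ← this, ← Category.assoc, ← Category.assoc, singleX₀_naturality]

lemma augX_d (A : E) : augX τ A ≫ (M.obj A).d 0 1 = 0 := by
  have : ((G ⋙ CochainComplex.singleFunctor V 0).obj A).d 0 1 = 0 := rfl
  rw [augX, Category.assoc, (τ.app A).comm, this, zero_comp, comp_zero]

/-- The morphism from `G(K)` to the total complex of `M(K^p)^q` given by an augmentation. -/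
def augTotal : G.mapCochainComplexPlus ⟶ totalPlus M where
  app K := ObjectProperty.homMk
    { f := fun n => augX τ (K.obj.X n) ≫ totalPlusι M K n 0 n (add_zero n)
      comm' := fun n m hnm => by
        change (augX τ (K.obj.X n) ≫ totalPlusι M K n 0 n _) ≫ ((totalPlus M).obj K).obj.d n m =
          G.map (K.obj.d n m) ≫ augX τ (K.obj.X m) ≫ totalPlusι M K m 0 m _
        rw [Category.assoc, totalPlusι_d M K n 0 n m 1 m (add_zero n) hnm (zero_add 1) hnm,
          Preadditive.comp_add, Preadditive.comp_zsmul, ← Category.assoc (augX τ _) (HomologicalComplex.d _ _ _),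
          augX_d, zero_comp, smul_zero, add_zero, ← Category.assoc, ← augX_naturality,
          Category.assoc] }
  naturality K L f := by
    ext n : 3
    change G.map (f.hom.f n) ≫ augX τ (L.obj.X n) ≫ totalPlusι M L n 0 n _ =
      (augX τ (K.obj.X n) ≫ totalPlusι M K n 0 n _) ≫ ((totalPlus M).map f).hom.f n
    rw [Category.assoc, totalPlusι_map, ← Category.assoc, augX_naturality, Category.assoc]

/-- The components of `augTotal`. -/
def augTotalX (K : CochainComplex.Plus E) (n : ℤ) :
    G.obj (K.obj.X n) ⟶ ((totalPlus M).obj K).obj.X n :=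
  augX τ (K.obj.X n) ≫ totalPlusι M K n 0 n (add_zero n)

lemma isIso_augTotalX_id (K : CochainComplex.Plus E) (n : ℤ) :
    IsIso (augTotalX (𝟙 (G ⋙ CochainComplex.singleFunctor V 0)) K n) := by
  have he : augX (𝟙 (G ⋙ CochainComplex.singleFunctor V 0)) (K.obj.X n) = (singleX₀ G _).hom :=
    Category.comp_id _
  rw [augTotalX, he]
  refine ⟨totalPlusπ _ K n 0 n (add_zero n) ≫ (singleX₀ G _).inv, ?_, ?_⟩
  · rw [Category.assoc, totalPlusι_π_assoc, Iso.hom_inv_id]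
  · refine totalPlus_hom_ext fun p q hpq => ?_
    by_cases hq : q = 0
    · subst hq
      obtain rfl : p = n := by omega
      rw [Category.assoc, totalPlusι_π_assoc, Category.comp_id, Iso.inv_hom_id_assoc]
    · exact (HomologicalComplex.isZero_single_obj_X _ _ _ _ hq).eq_of_src _ _

lemma isIso_augTotal_id (K : CochainComplex.Plus E) :
    IsIso ((augTotal (𝟙 (G ⋙ CochainComplex.singleFunctor V 0))).app K) := by
  have h (n : ℤ) :
      IsIso (((augTotal (𝟙 (G ⋙ CochainComplex.singleFunctor V 0))).app K).hom.f n) :=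
    isIso_augTotalX_id K n
  have : IsIso ((CochainComplex.Plus.ι V).map
      ((augTotal (𝟙 (G ⋙ CochainComplex.singleFunctor V 0))).app K)) :=
    HomologicalComplex.Hom.isIso_of_components (f := ((augTotal (𝟙 _)).app K).hom)
  exact isIso_of_fully_faithful (CochainComplex.Plus.ι V) _

lemma augTotalX_eq (K : CochainComplex.Plus E) (n : ℤ) : augTotalX τ K n =
    augTotalX (𝟙 (G ⋙ CochainComplex.singleFunctor V 0)) K n ≫
      ((totalPlusNatTrans τ).app K).hom.f n := by
  rw [augTotalX, augTotalX, Category.assoc, totalPlusι_natTrans_app, ← Category.assoc]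
  congr 1
  rw [augX, augX, NatTrans.id_app, HomologicalComplex.id_f, Category.comp_id]

/-- The complex `G(K)` is itself a total complex, for the functor of single complexes, up to the
isomorphism `isIso_augTotal_id`. Thus an augmentation is a morphism of bicomplexes, and the
criterion by columns applies. -/
lemma augTotal_eq : augTotal τ =
    augTotal (𝟙 (G ⋙ CochainComplex.singleFunctor V 0)) ≫ totalPlusNatTrans τ := by
  ext K n : 5
  exact augTotalX_eq τ K n

lemma quasiIso_augTotal_app (K : CochainComplex.Plus E)
    (h : ∀ n, QuasiIso (τ.app (K.obj.X n))) :
    CochainComplex.Plus.quasiIso V ((augTotal τ).app K) := by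
  have := isIso_augTotal_id (G := G) K
  rw [augTotal_eq, NatTrans.comp_app]
  have h₁ : CochainComplex.Plus.quasiIso V
      ((augTotal (𝟙 (G ⋙ CochainComplex.singleFunctor V 0))).app K) := by
    have : QuasiIso ((CochainComplex.Plus.ι V).map
      ((augTotal (𝟙 (G ⋙ CochainComplex.singleFunctor V 0))).app K)) := inferInstance
    exact this
  exact MorphismProperty.comp_mem _ _ _ h₁ (quasiIso_totalPlusNatTrans_app τ K h)

end Augmentation

end TotalPlus

section HomTotal

variable {V : Type*} [Category* V] [Abelian V] {H : Type v} [Group H]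

instance (F : FreeResolution H) : IsNonnegative (homComplex (V := V) F) where
  isZero _ _ hq := HomologicalComplex.isZero_extend_X _ _ _ (by intro i; simp; omega)

/-- By definition `homTotal F` is `totalPlus (homComplex F)`, so all results on `totalPlus` apply to
it. -/
lemma homTotalMap_eq {F F' : FreeResolution H} (φ : F.Hom F') :
  homTotalMap (V := V) φ = totalPlusNatTrans (homComplexMap φ) := rfl

end HomTotal

/-! ### Augmented complexes and splices of short exact sequences -/

section Augmentations

variable {E V : Type*} [Category* E] [Abelian E] [Category* V] [Abelian V]
  {M : E ⥤ CochainComplex V ℤ} {G : E ⥤ V} [G.Additive] [M.Additive]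

variable (σ : ∀ A, G.obj A ⟶ (M.obj A).X 0)
  (hd : ∀ A, σ A ≫ (M.obj A).d 0 1 = 0)
  (hσ : ∀ {A B : E} (f : A ⟶ B), G.map f ≫ σ B = σ A ≫ (M.map f).f 0)

/-- The components of an augmentation, given by morphisms to the terms of degree zero. -/
def augOfXApp (A : E) : (G ⋙ CochainComplex.singleFunctor V 0).obj A ⟶ M.obj A :=
  HomologicalComplex.mkHomFromSingle (σ A) (fun k (hk : 0 + 1 = k) => by
    subst hk
    exact hd A)

lemma augOfXApp_f (A : E) : (singleX₀ G A).hom ≫ (augOfXApp σ hd A).f 0 = σ A :=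
  ((singleX₀ G A).hom ≫= HomologicalComplex.mkHomFromSingle_f (σ A) _).trans
    (Iso.inv_hom_id_assoc _ _)

/-- Constructor for augmentations of functors to cochain complexes. -/
def augOfX : G ⋙ CochainComplex.singleFunctor V 0 ⟶ M where
  app A := augOfXApp σ hd A
  naturality A B f := by
    refine HomologicalComplex.from_single_hom_ext ?_
    refine (cancel_epi (singleX₀ G A).hom).1 ?_
    change (singleX₀ G A).hom ≫ ((G ⋙ CochainComplex.singleFunctor V 0).map f).f 0 ≫
        (augOfXApp σ hd B).f 0 =
      (singleX₀ G A).hom ≫ (augOfXApp σ hd A).f 0 ≫ (M.map f).f 0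
    rw [← Category.assoc, ← singleX₀_naturality, Category.assoc, augOfXApp_f,
      ← Category.assoc (singleX₀ G A).hom, augOfXApp_f, hσ]

lemma augX_augOfX (A : E) : augX (augOfX σ hd hσ) A = σ A := augOfXApp_f σ hd A

lemma exact_of_iso_comp {A A' B D : V} (e : A ≅ A') {f : A ⟶ B} {f' : A' ⟶ B} {g : B ⟶ D}
    (w : f ≫ g = 0) {w' : f' ≫ g = 0} (h : (ShortComplex.mk f' g w').Exact)
    (hf : f = e.hom ≫ f') : (ShortComplex.mk f g w).Exact := by
  subst hf
  exact (ShortComplex.exact_iff_of_iso (S₁ := ShortComplex.mk _ _ w) (S₂ := ShortComplex.mk _ _ w')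
    (ShortComplex.isoMk e (Iso.refl _) (Iso.refl _)
      (Category.comp_id _).symm ((Category.id_comp _).trans (Category.comp_id _).symm))).2 h

/-- An augmentation is a quasi-isomorphism if the augmented complex is exact. -/
lemma quasiIso_augmentation [IsNonnegative M] (τ : G ⋙ CochainComplex.singleFunctor V 0 ⟶ M)
    (A : E) [Mono (augX τ A)] (h₀ : (ShortComplex.mk _ _ (augX_d τ A)).Exact)
    (h : ∀ n : ℤ, 0 < n → (M.obj A).ExactAt n) : QuasiIso (τ.app A) := by
  rw [quasiIso_iff]
  intro i
  rcases lt_trichotomy i 0 with hi | rfl | hi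
  · rw [quasiIsoAt_iff_exactAt]
    · exact HomologicalComplex.ExactAt.of_isZero (IsNonnegative.isZero _ _ hi)
    · exact HomologicalComplex.ExactAt.of_isZero (HomologicalComplex.isZero_single_obj_X _ _ _ _ hi.ne)
  -- In degree zero the source has zero differentials and the target has no incoming differential,
  -- so the condition is that `augX τ A` is a kernel of the first differential.
  · rw [quasiIsoAt_iff' (τ.app A) (-1) 0 1 (by simp) (by simp)]
    rw [ShortComplex.quasiIso_iff_of_zeros]
    · have : ((HomologicalComplex.shortComplexFunctor' V (ComplexShape.up ℤ) (-1) 0 1).map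
        (τ.app A)).τ₂ = (singleX₀ G A).inv ≫ augX τ A := (Iso.inv_hom_id_assoc _ _).symm
      constructor
      · exact exact_of_iso_comp (singleX₀ G A).symm _ h₀ this
      · rw [this]
        exact mono_comp (singleX₀ G A).inv (augX τ A)
    · rfl
    · rfl
    · exact IsZero.eq_of_src (IsNonnegative.isZero _ _ (by norm_num)) _ _
  · rw [quasiIsoAt_iff_exactAt]
    · exact h i hi
    · exact HomologicalComplex.ExactAt.of_isZero (HomologicalComplex.isZero_single_obj_X _ _ _ _ hi.ne')
    
/-- A factorization of the differentials of a complex in non-negative degrees which exhibits the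
complex as a splice of short exact sequences. -/
structure Splice (X : CochainComplex V ℤ) where
  B : ℕ → V
  a (n : ℕ) : B n ⟶ X.X n
  b (n : ℕ) : X.X n ⟶ B (n + 1)
  zero (n : ℕ) : a n ≫ b n = 0
  shortExact (n : ℕ) : (ShortComplex.mk _ _ (zero n)).ShortExact
  d_eq (n : ℕ) : X.d n (n + 1 : ℕ) = b n ≫ a (n + 1)

namespace Splice

variable {X : CochainComplex V ℤ} (S : Splice X)

instance (n : ℕ) : Mono (S.a n) := (S.shortExact n).mono_f
instance (n : ℕ) : Epi (S.b n) := (S.shortExact n).epi_g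

/-- Exactness in the middle is unchanged if the first object is covered by an epimorphism (`b`) and
the last one is embedded by a monomorphism (`a`). -/
lemma exactAt {X : CochainComplex V ℤ} (S : Splice X) (n : ℤ) (hn : 0 < n) : X.ExactAt n := by
  obtain ⟨k, rfl⟩ : ∃ k : ℕ, n = (k + 1 : ℕ) := ⟨(n - 1).toNat, by omega⟩
  rw [X.exactAt_iff' (k : ℕ) (k + 1 : ℕ) (k + 1 + 1 : ℕ) (by simp) (by simp)]
  have h := (S.shortExact (k + 1)).exact
  let T := ShortComplex.mk (S.a (k + 1)) (X.d (k + 1 : ℕ) (k + 1 + 1 : ℕ)) (by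
    rw [S.d_eq, ← Category.assoc, S.zero, zero_comp])
  have hT : T.Exact := by
    let φ : ShortComplex.mk _ _ (S.zero (k + 1)) ⟶ T :=
      { τ₁ := 𝟙 _
        τ₂ := 𝟙 _
        τ₃ := S.a (k + 1 + 1)
        comm₂₃ := (Category.id_comp _).trans (S.d_eq (k + 1)) }
    have : Epi φ.τ₁ := inferInstanceAs (Epi (𝟙 _))
    have : IsIso φ.τ₂ := inferInstanceAs (IsIso (𝟙 _))
    have : Mono φ.τ₃ := inferInstanceAs (Mono (S.a (k + 1 + 1)))
    exact (ShortComplex.exact_iff_of_epi_of_isIso_of_mono φ).1 h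
  let ψ : X.sc' (k : ℕ) (k + 1 : ℕ) (k + 1 + 1 : ℕ) ⟶ T :=
    { τ₁ := S.b k
      τ₂ := 𝟙 _
      τ₃ := 𝟙 _
      comm₁₂ := (S.d_eq k).symm.trans (Category.comp_id _).symm
      comm₂₃ := (Category.id_comp _).trans (Category.comp_id _).symm }
  have : Epi ψ.τ₁ := inferInstanceAs (Epi (S.b k))
  have : IsIso ψ.τ₂ := inferInstanceAs (IsIso (𝟙 _))
  have : Mono ψ.τ₃ := inferInstanceAs (Mono (𝟙 _))
  exact (ShortComplex.exact_iff_of_epi_of_isIso_of_mono ψ).2 hT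

lemma exact_zero (w : S.a 0 ≫ X.d (0 : ℕ) (0 + 1 : ℕ) = 0) :
    (ShortComplex.mk _ _ w).Exact := by
  let φ : ShortComplex.mk _ _ (S.zero 0) ⟶ ShortComplex.mk _ _ w :=
    { τ₁ := 𝟙 _
      τ₂ := 𝟙 _
      τ₃ := S.a (0 + 1)
      comm₂₃ := (Category.id_comp _).trans (S.d_eq 0) }
  have : Epi φ.τ₁ := inferInstanceAs (Epi (𝟙 _))
  have : IsIso φ.τ₂ := inferInstanceAs (IsIso (𝟙 _))
  have : Mono φ.τ₃ := inferInstanceAs (Mono (S.a (0 + 1)))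
  exact (ShortComplex.exact_iff_of_epi_of_isIso_of_mono φ).1 (S.shortExact 0).exact

lemma quasiIso [IsNonnegative M] (τ : G ⋙ CochainComplex.singleFunctor V 0 ⟶ M) (A : E)
    (S : Splice (M.obj A)) (e : G.obj A ≅ S.B 0) (h : augX τ A = e.hom ≫ S.a 0) :
    QuasiIso (τ.app A) := by
  have : Mono (augX τ A) := by
    rw [h]
    infer_instance
  refine quasiIso_augmentation τ A ?_ S.exactAt
  have w : S.a 0 ≫ (M.obj A).d (0 : ℕ) (0 + 1 : ℕ) = 0 := by
    rw [S.d_eq, ← Category.assoc, S.zero, zero_comp]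
  exact exact_of_iso_comp e _ (S.exact_zero w) h

end Splice

end Augmentations

/-! ### Powers, fixed points and equivariant morphisms -/

section Powers

variable {V : Type*} [Category* V] (J : Type*) [HasProductsOfShape J V]

/-- The power of an object indexed by `J`. -/
def power (B : V) : V := ∏ᶜ fun _ : J => B

variable {J}

/-- The projections of a power. -/
def powerπ (B : V) (j : J) : power J B ⟶ B := Pi.π (fun _ => B) j

/-- The universal property of a power. -/
def powerLift {A B : V} (f : J → (A ⟶ B)) : A ⟶ power J B := Pi.lift f

lemma powerLift_π {A B : V} (f : J → (A ⟶ B)) (j : J) : powerLift f ≫ powerπ B j = f j :=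
  Pi.lift_π _ _

lemma powerLift_π_assoc {A B D : V} (f : J → (A ⟶ B)) (j : J) (g : B ⟶ D) :
    powerLift f ≫ powerπ B j ≫ g = f j ≫ g := by
  rw [← Category.assoc, powerLift_π]

lemma power_hom_ext {A B : V} {f g : A ⟶ power J B} (h : ∀ j, f ≫ powerπ B j = g ≫ powerπ B j) :
    f = g := Limits.Pi.hom_ext _ _ h

variable (V J)

/-- The functor which sends an object to its power indexed by `J`. -/
def powerFunctor : V ⥤ V where
  obj B := power J B
  map f := powerLift fun j => powerπ _ j ≫ f
  map_id A := power_hom_ext fun j => by rw [powerLift_π, Category.comp_id, Category.id_comp]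
  map_comp f g := power_hom_ext fun j => by
    rw [powerLift_π, Category.assoc, powerLift_π, powerLift_π_assoc, Category.assoc]

/-- The power functor is the limit of constant diagrams. -/
def powerFunctorIso : powerFunctor V J ≅ Functor.const (Discrete J) ⋙ lim :=
  NatIso.ofComponents (fun B => lim.mapIso (Discrete.natIso fun _ => Iso.refl B)) (fun {A B} f => by
    refine limit.hom_ext fun j => ?_
    simp only [Category.assoc]
    erw [limMap_π, limMap_π, limMap_π_assoc, powerLift_π_assoc]
    change (powerπ A j.as ≫ f) ≫ 𝟙 B = powerπ A j.as ≫ 𝟙 A ≫ f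
    rw [Category.id_comp, Category.comp_id])

variable [Abelian V]

instance : (powerFunctor V J).Additive where
  map_add {A B f g} := power_hom_ext fun j => by
    refine (powerLift_π _ _).trans ((Preadditive.comp_add _ _ _ _ _ _).trans ?_)
    refine Eq.trans ?_ (Preadditive.add_comp _ _ _ _ _ _).symm
    exact (congrArg₂ _ (powerLift_π (fun j => powerπ A j ≫ f) j)
      (powerLift_π (fun j => powerπ A j ≫ g) j)).symm

instance : PreservesFiniteLimits (powerFunctor V J) :=
  preservesFiniteLimits_of_natIso (powerFunctorIso V J).symm

instance [HasExactLimitsOfShape (Discrete J) V] : PreservesFiniteColimits (powerFunctor V J) :=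
  preservesFiniteColimits_of_natIso (powerFunctorIso V J).symm

end Powers

section FixedPointsLift

variable {V : Type*} [Category* V] [Abelian V]
  {H : Type v} [Group H] [HasProductsOfShape H V]

/-- The universal property of the fixed points. -/
def fixedPointsLift (A : Action V H) {B : V} (f : B ⟶ A.V) (hf : ∀ γ, f ≫ actHom A γ = f) :
    B ⟶ (fixedPoints V H).obj A :=
  kernel.lift _ f (by
    refine Limits.Pi.hom_ext _ _ fun γ => ?_
    rw [Category.assoc, Pi.lift_π, Preadditive.comp_sub, hf, Category.comp_id, sub_self, zero_comp])

lemma fixedPointsLift_ι (A : Action V H) {B : V} (f : B ⟶ A.V) (hf : ∀ γ, f ≫ actHom A γ = f) :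
    fixedPointsLift A f hf ≫ fixedPointsι A = f :=
  kernel.lift_ι _ _ _

end FixedPointsLift

section Action

variable {V : Type*} [Category* V] {H : Type*} [Group H]

lemma actHom_one (A : Action V H) : actHom A 1 = 𝟙 _ := map_one A.ρ

lemma actHom_mul (A : Action V H) (g h : H) : actHom A (g * h) = actHom A h ≫ actHom A g :=
  map_mul A.ρ g h

lemma actHom_comm {A B : Action V H} (f : A ⟶ B) (g : H) :
    actHom A g ≫ f.hom = f.hom ≫ actHom B g := f.comm g

/-- Constructor for equivariant morphisms. -/
def actionHomMk {A B : Action V H} (f : A.V ⟶ B.V)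
    (hf : ∀ g, actHom A g ≫ f = f ≫ actHom B g) : A ⟶ B := ⟨f, hf⟩

lemma actionHom_ext {A B : Action V H} {f g : A ⟶ B} (h : f.hom = g.hom) : f = g :=
  Action.Hom.ext h

end Action

/-! ### Coinduced objects -/

section Coinduction

variable (V : Type*) [Category* V] (H : Type v) [Group H] [HasProductsOfShape H V]

variable {V H} in
/-- Translations on a power indexed by a group. -/
def translation (B : V) (g : H) : power H B ⟶ power H B :=
  powerLift fun h => powerπ B (h * g)

variable {V H} in
lemma translation_π (B : V) (g h : H) : translation B g ≫ powerπ B h = powerπ B (h * g) :=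
  powerLift_π _ _

/-- The functor of coinduction from the trivial group to `H`. -/
def coind : V ⥤ Action V H where
  obj B :=
    { V := power H B
      ρ :=
        { toFun := translation B
          map_one' := power_hom_ext fun h => by
            rw [translation_π, mul_one]
            exact (Category.id_comp _).symm
          map_mul' := fun g g' => power_hom_ext fun h => by
            rw [translation_π, End.mul_def, Category.assoc, translation_π, translation_π,
              mul_assoc] } }
  map {A B} f := actionHomMk ((powerFunctor V H).map f) fun g => by
    refine power_hom_ext fun h => ?_
    change (translation A g ≫ powerLift fun j => powerπ _ j ≫ f) ≫ _ =
      ((powerLift fun j => powerπ _ j ≫ f) ≫ translation B g) ≫ _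
    rw [Category.assoc, Category.assoc, translation_π, powerLift_π, powerLift_π, ← Category.assoc,
      translation_π]
  map_id A := actionHom_ext ((powerFunctor V H).map_id A)
  map_comp f g := actionHom_ext ((powerFunctor V H).map_comp f g)

variable {V H}

/-- The projections of a coinduced object. -/
def coindπ (B : V) (h : H) : ((coind V H).obj B).V ⟶ B := powerπ B h

/-- Constructor for morphisms to a coinduced object. -/
def coindLift {A B : V} (f : H → (A ⟶ B)) : A ⟶ ((coind V H).obj B).V := powerLift f

lemma coindLift_π {A B : V} (f : H → (A ⟶ B)) (h : H) : coindLift f ≫ coindπ B h = f h :=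
  powerLift_π f h

lemma coind_hom_ext {A B : V} {f g : A ⟶ ((coind V H).obj B).V}
    (h : ∀ j, f ≫ coindπ B j = g ≫ coindπ B j) : f = g := power_hom_ext h

lemma coind_actHom_π (B : V) (g h : H) :
    actHom ((coind V H).obj B) g ≫ coindπ B h = coindπ B (h * g) := translation_π B g h

lemma coind_map_π {A B : V} (f : A ⟶ B) (h : H) :
    ((coind V H).map f).hom ≫ coindπ B h = coindπ A h ≫ f := powerLift_π _ _

/-- The embedding of an object in the coinduced object. -/
def coindUnitApp (A : Action V H) : A ⟶ (coind V H).obj A.V :=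
  actionHomMk (coindLift fun h => actHom A h) fun g => coind_hom_ext fun h => by
    rw [Category.assoc, coindLift_π, Category.assoc, coind_actHom_π, coindLift_π, actHom_mul]

lemma coindUnitApp_π (A : Action V H) (h : H) :
    (coindUnitApp A).hom ≫ coindπ A.V h = actHom A h := coindLift_π _ _

lemma coindUnitApp_naturality {A B : Action V H} (f : A ⟶ B) :
    f ≫ coindUnitApp B = coindUnitApp A ≫ (coind V H).map f.hom :=
  actionHom_ext (coind_hom_ext fun h => by
    rw [Action.comp_hom, Action.comp_hom, Category.assoc, Category.assoc, coindUnitApp_π,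
      coind_map_π, ← actHom_comm, ← coindUnitApp_π, Category.assoc])

variable (V H) in
/-- The functor which sends an action of `H` to the coinduced action. -/
abbrev coindForget : Action V H ⥤ Action V H := Action.forget V H ⋙ coind V H

section

variable [Abelian V]

instance : (coind V H).Additive where
  map_add {_ _ f g} := actionHom_ext ((powerFunctor V H).map_add (f := f) (g := g))

variable [PreservesFiniteColimits (powerFunctor V H)]

/-- Finite limits of objects with action are computed on underlying objects, where coinduction is
the power functor. -/
instance : PreservesFiniteLimits (coind V H) := by
  have : PreservesFiniteLimits (coind V H ⋙ Action.forget V H) :=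
    inferInstanceAs (PreservesFiniteLimits (powerFunctor V H))
  exact preservesFiniteLimits_of_reflects_of_preserves (coind V H) (Action.forget V H)

instance : PreservesFiniteColimits (coind V H) := by
  have : PreservesFiniteColimits (coind V H ⋙ Action.forget V H) :=
    inferInstanceAs (PreservesFiniteColimits (powerFunctor V H))
  exact preservesFiniteColimits_of_reflects_of_preserves (coind V H) (Action.forget V H)

/-- The isomorphism `fixedPointsCoind`, on objects. -/
def fixedPointsCoindApp (B : V) : (fixedPoints V H).obj ((coind V H).obj B) ≅ B where
  hom := fixedPointsι ((coind V H).obj B) ≫ coindπ B 1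
  inv := fixedPointsLift ((coind V H).obj B) (coindLift fun _ => 𝟙 B) fun γ =>
    coind_hom_ext fun h => by
      rw [Category.assoc, coind_actHom_π, coindLift_π, coindLift_π]
  hom_inv_id := by
    rw [← cancel_mono (fixedPointsι ((coind V H).obj B)), Category.assoc, fixedPointsLift_ι]
    -- Invariance under translation by `h` identifies the component at `h` with the component at
    -- `1`: fixed functions on `H` are constant.
    refine coind_hom_ext fun h => ?_
    rw [Category.assoc, Category.assoc, coindLift_π, Category.comp_id, Category.id_comp,
      ← fixedPointsι_actHom _ h, Category.assoc, coind_actHom_π, one_mul, fixedPointsι_actHom]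
  inv_hom_id := by
    rw [← Category.assoc, fixedPointsLift_ι, coindLift_π]

/-- The fixed points of a coinduced object. -/
def fixedPointsCoind : coind V H ⋙ fixedPoints V H ≅ 𝟭 V :=
  NatIso.ofComponents fixedPointsCoindApp (fun {A B} f => by
    change (fixedPoints V H).map ((coind V H).map f) ≫ fixedPointsι _ ≫ _ = (fixedPointsι _ ≫ _) ≫ f
    rw [← Category.assoc, fixedPointsι_naturality, Category.assoc, coind_map_π, Category.assoc])

end

end Coinduction

/-! ### The functorial coinduced resolution -/

section CoinducedResolution

variable (V : Type*) [Category* V] [Abelian V] (H : Type v) [Group H] [HasProductsOfShape H V]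

variable {V H} in
-- The component at `1 ∈ H` is a retraction in `V`, although it is not equivariant in general.
instance (A : Action V H) : Mono (coindUnitApp A) := by
  have h : (coindUnitApp A).hom ≫ coindπ A.V 1 = 𝟙 _ := by rw [coindUnitApp_π, actHom_one]
  have : Mono (coindUnitApp A).hom := mono_of_mono_fac h
  have : Mono ((Action.forget V H).map (coindUnitApp A)) := this
  exact (Action.forget V H).mono_of_mono_map this

/-- The cokernel of the embedding of an object in the coinduced object. -/
def cosyzygy : Action V H ⥤ Action V H where
  obj A := cokernel (coindUnitApp A)
  map f := cokernel.map _ _ f ((coind V H).map f.hom) (coindUnitApp_naturality f).symm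
  map_id A := by
    rw [← cancel_epi (cokernel.π _), cokernel.π_desc, Category.comp_id]
    exact (congrArg (· ≫ cokernel.π _) ((coind V H).map_id A.V)).trans (Category.id_comp _)
  map_comp f g := by
    rw [← cancel_epi (cokernel.π _), cokernel.π_desc, ← Category.assoc, cokernel.π_desc,
      Category.assoc, cokernel.π_desc, ← Category.assoc]
    exact congrArg (· ≫ cokernel.π _) ((coind V H).map_comp f.hom g.hom)

variable {V H}

/-- The projection of the coinduced object to the cokernel of the embedding. -/
def cosyzygyπ (A : Action V H) : (coind V H).obj A.V ⟶ (cosyzygy V H).obj A := cokernel.π _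

instance (A : Action V H) : Epi (cosyzygyπ A) := inferInstanceAs (Epi (cokernel.π _))

lemma coindUnitApp_cosyzygyπ (A : Action V H) : coindUnitApp A ≫ cosyzygyπ A = 0 :=
  cokernel.condition _

lemma shortExact_coindUnitApp (A : Action V H) :
    (ShortComplex.mk _ _ (coindUnitApp_cosyzygyπ A)).ShortExact where
  exact := ShortComplex.exact_cokernel _

lemma cosyzygyπ_naturality {A B : Action V H} (f : A ⟶ B) :
    cosyzygyπ A ≫ (cosyzygy V H).map f = (coind V H).map f.hom ≫ cosyzygyπ B :=
  cokernel.π_desc _ _ _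

instance : (cosyzygy V H).Additive where
  map_add {A B f g} := by
    rw [← cancel_epi (cosyzygyπ A), Preadditive.comp_add, cosyzygyπ_naturality,
      cosyzygyπ_naturality, cosyzygyπ_naturality, ← Preadditive.add_comp, ← Functor.map_add]
    rfl

/-- The short exact sequence of complexes `0 ⟶ K ⟶ coind K ⟶ cosyzygy K ⟶ 0`. -/
def cosyzygyComplexes (K : CochainComplex (Action V H) ℤ) :
    ShortComplex (CochainComplex (Action V H) ℤ) where
  X₁ := K
  X₂ := ((coindForget V H).mapHomologicalComplex _).obj K
  X₃ := ((cosyzygy V H).mapHomologicalComplex _).obj K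
  f :=
    { f := fun n => coindUnitApp (K.X n)
      comm' := fun i j _ => (coindUnitApp_naturality (K.d i j)).symm }
  g :=
    { f := fun n => cosyzygyπ (K.X n)
      comm' := fun i j _ => cosyzygyπ_naturality (K.d i j) }
  zero := by
    ext n : 1
    exact coindUnitApp_cosyzygyπ (K.X n)

lemma shortExact_cosyzygyComplexes (K : CochainComplex (Action V H) ℤ) :
    (cosyzygyComplexes K).ShortExact :=
  HomologicalComplex.shortExact_of_degreewise_shortExact _ fun n =>
    shortExact_coindUnitApp (K.X n)

/-- The functoriality of `cosyzygyComplexes`. -/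
def cosyzygyComplexesMap {K L : CochainComplex (Action V H) ℤ} (f : K ⟶ L) :
    cosyzygyComplexes K ⟶ cosyzygyComplexes L where
  τ₁ := f
  τ₂ := ((coindForget V H).mapHomologicalComplex _).map f
  τ₃ := ((cosyzygy V H).mapHomologicalComplex _).map f
  comm₁₂ := by
    ext n : 1
    exact coindUnitApp_naturality (f.f n)
  comm₂₃ := by
    ext n : 1
    exact (cosyzygyπ_naturality (f.f n)).symm

variable (V H) in
/-- The iterates of `cosyzygy`. -/
def iteratedCosyzygy : ℕ → Action V H ⥤ Action V H
  | 0 => 𝟭 _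
  | n + 1 => iteratedCosyzygy n ⋙ cosyzygy V H

instance additive_iteratedCosyzygy : ∀ n, (iteratedCosyzygy V H n).Additive
  | 0 => inferInstanceAs (𝟭 _ : Action V H ⥤ Action V H).Additive
  | n + 1 => by
    have := additive_iteratedCosyzygy n
    exact inferInstanceAs (iteratedCosyzygy V H n ⋙ cosyzygy V H).Additive

section

variable [PreservesFiniteColimits (powerFunctor V H)]

/-- Compare the long exact sequences of `0 ⟶ K ⟶ coind K ⟶ cosyzygy K ⟶ 0`: coinduction of the
underlying object is exact, so two of the three morphisms are quasi-isomorphisms. -/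
lemma quasiIso_map_cosyzygy {K L : CochainComplex (Action V H) ℤ} (f : K ⟶ L) [QuasiIso f] :
    QuasiIso (((cosyzygy V H).mapHomologicalComplex _).map f) := by
  have h : QuasiIso (((coindForget V H).mapHomologicalComplex (ComplexShape.up ℤ)).map f) :=
    inferInstance
  exact HomologicalComplex.HomologySequence.quasiIso_τ₃ (cosyzygyComplexesMap f)
    (shortExact_cosyzygyComplexes K) (shortExact_cosyzygyComplexes L) ‹_› h

lemma quasiIso_map_iteratedCosyzygy {K L : CochainComplex (Action V H) ℤ} (f : K ⟶ L) [QuasiIso f] :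
    ∀ n, QuasiIso (((iteratedCosyzygy V H n).mapHomologicalComplex _).map f)
  | 0 => ‹_›
  | n + 1 => by
    have := quasiIso_map_iteratedCosyzygy f n
    exact quasiIso_map_cosyzygy (((iteratedCosyzygy V H n).mapHomologicalComplex _).map f)

end

/-- The terms of the coinduced resolution. -/
abbrev coindTerm (n : ℕ) (A : Action V H) : Action V H :=
  (coind V H).obj ((iteratedCosyzygy V H n).obj A).V

/-- The inclusion of an iterated cosyzygy in the corresponding term of the coinduced resolution. -/
def coindTermι (n : ℕ) (A : Action V H) : (iteratedCosyzygy V H n).obj A ⟶ coindTerm n A :=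
  coindUnitApp _

/-- The projection of a term of the coinduced resolution to the next cosyzygy. -/
def coindTermπ (n : ℕ) (A : Action V H) :
    coindTerm n A ⟶ (iteratedCosyzygy V H (n + 1)).obj A :=
  cosyzygyπ _

lemma coindTermι_π (n : ℕ) (A : Action V H) : coindTermι n A ≫ coindTermπ n A = 0 :=
  coindUnitApp_cosyzygyπ _

lemma shortExact_coindTerm (n : ℕ) (A : Action V H) :
    (ShortComplex.mk _ _ (coindTermι_π n A)).ShortExact :=
  shortExact_coindUnitApp _

/-- The functoriality of the terms of the coinduced resolution. -/
def coindTermMap (n : ℕ) {A B : Action V H} (f : A ⟶ B) : coindTerm n A ⟶ coindTerm n B :=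
  (coind V H).map ((iteratedCosyzygy V H n).map f).hom

lemma coindTermι_naturality (n : ℕ) {A B : Action V H} (f : A ⟶ B) :
    (iteratedCosyzygy V H n).map f ≫ coindTermι n B = coindTermι n A ≫ coindTermMap n f :=
  coindUnitApp_naturality _

lemma coindTermπ_naturality (n : ℕ) {A B : Action V H} (f : A ⟶ B) :
    coindTermMap n f ≫ coindTermπ n B = coindTermπ n A ≫ (iteratedCosyzygy V H (n + 1)).map f :=
  (cosyzygyπ_naturality _).symm

lemma coindTermMap_id (n : ℕ) (A : Action V H) : coindTermMap n (𝟙 A) = 𝟙 _ := by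
  rw [coindTermMap, CategoryTheory.Functor.map_id]
  exact CategoryTheory.Functor.map_id (coind V H) _

lemma coindTermMap_comp (n : ℕ) {A B D : Action V H} (f : A ⟶ B) (g : B ⟶ D) :
    coindTermMap n (f ≫ g) = coindTermMap n f ≫ coindTermMap n g := by
  rw [coindTermMap, Functor.map_comp]
  exact Functor.map_comp (coind V H) _ _

lemma coindTermMap_add (n : ℕ) {A B : Action V H} (f g : A ⟶ B) :
    coindTermMap n (f + g) = coindTermMap n f + coindTermMap n g := by
  rw [coindTermMap, Functor.map_add]
  exact Functor.map_add (coind V H)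

/-- The coinduced resolution of an object, as a complex indexed by natural numbers. -/
def coindComplexNatObj (A : Action V H) : CochainComplex (Action V H) ℕ :=
  CochainComplex.of (fun n => coindTerm n A)
    (fun n => coindTermπ n A ≫ coindTermι (n + 1) A) (fun n => by
      rw [Category.assoc, ← Category.assoc (coindTermι (n + 1) A), coindTermι_π, zero_comp,
        comp_zero])

lemma coindComplexNatObj_d (A : Action V H) (n : ℕ) : (coindComplexNatObj A).d n (n + 1) =
    coindTermπ n A ≫ coindTermι (n + 1) A := 
  CochainComplex.of_d (fun n => coindTerm n A) (fun n => coindTermπ n A ≫ coindTermι (n + 1) A) n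

lemma coindTermMap_comm (n : ℕ) {A B : Action V H} (f : A ⟶ B) :
    coindTermMap n f ≫ coindTermπ n B ≫ coindTermι (n + 1) B =
      (coindTermπ n A ≫ coindTermι (n + 1) A) ≫ coindTermMap (n + 1) f := by
  rw [← Category.assoc, coindTermπ_naturality, Category.assoc, coindTermι_naturality,
    Category.assoc]

variable (V H) in
/-- The coinduced resolution, as a complex indexed by natural numbers. -/
def coindComplexNat : Action V H ⥤ CochainComplex (Action V H) ℕ where
  obj A := coindComplexNatObj A
  map {A B} f := 
    { f := fun n => coindTermMap n f
      comm' := fun n m hnm => by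
        obtain rfl : n + 1 = m := hnm
        refine (_ ≫= coindComplexNatObj_d B n).trans
          (Eq.trans ?_ (coindComplexNatObj_d A n =≫ coindTermMap (n + 1) f).symm)
        exact coindTermMap_comm n f }
  map_id A := by
    ext n : 1
    exact coindTermMap_id n A
  map_comp f g := by
    ext n : 1
    exact coindTermMap_comp n f g

instance : (coindComplexNat V H).Additive where
  map_add {A B f g} := by
    ext n : 1
    exact coindTermMap_add n f g

variable (V H) in
/-- The coinduced resolution. -/
def coindComplex : Action V H ⥤ CochainComplex (Action V H) ℤ :=
  coindComplexNat V H ⋙ ComplexShape.embeddingUpNat.extendFunctor _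

instance : (coindComplex V H).Additive := by
  unfold coindComplex; infer_instance

instance : IsNonnegative (coindComplex V H) where
  isZero _ _ hq := HomologicalComplex.isZero_extend_X _ _ _ (by intro i; simp; omega)

/-- The terms of the coinduced resolution. -/
def coindComplexXIso (A : Action V H) (n : ℕ) :
    ((coindComplex V H).obj A).X n ≅ coindTerm n A :=
  ((coindComplexNat V H).obj A).extendXIso ComplexShape.embeddingUpNat rfl

lemma coindComplex_d (A : Action V H) (n : ℕ) :
    ((coindComplex V H).obj A).d n (n + 1 : ℕ) =
      ((coindComplexXIso A n).hom ≫ coindTermπ n A) ≫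
        (coindTermι (n + 1) A ≫ (coindComplexXIso A (n + 1)).inv) := by
  refine (HomologicalComplex.extend_d_eq (coindComplexNatObj A) ComplexShape.embeddingUpNat
    (i := n) (j := n + 1) rfl rfl).trans ?_
  rw [coindComplexNatObj_d]
  exact ((coindComplexXIso A n).hom ≫= Category.assoc _ _ _).trans (Category.assoc _ _ _).symm

lemma coindComplex_map_f {A B : Action V H} (f : A ⟶ B) (n : ℕ) :
    ((coindComplex V H).map f).f n = (coindComplexXIso A n).hom ≫
      coindTermMap n f ≫ (coindComplexXIso B n).inv :=
  HomologicalComplex.extendMap_f ((coindComplexNat V H).map f) ComplexShape.embeddingUpNat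
    (i := n) rfl

/-- The inclusion of an iterated cosyzygy in the coinduced resolution. -/
def coindComplexι (A : Action V H) (n : ℕ) :
    (iteratedCosyzygy V H n).obj A ⟶ ((coindComplex V H).obj A).X n :=
  coindTermι n A ≫ (coindComplexXIso A n).inv

/-- The projection of the coinduced resolution to an iterated cosyzygy. -/
def coindComplexπ (A : Action V H) (n : ℕ) :
    ((coindComplex V H).obj A).X n ⟶ (iteratedCosyzygy V H (n + 1)).obj A :=
  (coindComplexXIso A n).hom ≫ coindTermπ n A

lemma coindComplexι_π (A : Action V H) (n : ℕ) : coindComplexι A n ≫ coindComplexπ A n = 0 := by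
  rw [coindComplexι, coindComplexπ, Category.assoc, Iso.inv_hom_id_assoc, coindTermι_π]

lemma shortExact_coindComplex (A : Action V H) (n : ℕ) :
    (ShortComplex.mk _ _ (coindComplexι_π A n)).ShortExact := by
  let φ : ShortComplex.mk _ _ (coindTermι_π n A) ⟶ ShortComplex.mk _ _ (coindComplexι_π A n) :=
    { τ₁ := 𝟙 _
      τ₂ := (coindComplexXIso A n).inv
      τ₃ := 𝟙 _
      comm₁₂ := Category.id_comp _
      comm₂₃ := (Iso.inv_hom_id_assoc _ _).trans (Category.comp_id _).symm }
  have h₁ : IsIso φ.τ₁ := inferInstanceAs (IsIso (𝟙 _))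
  have h₂ : IsIso φ.τ₂ := inferInstanceAs (IsIso (coindComplexXIso A n).inv)
  have h₃ : IsIso φ.τ₃ := inferInstanceAs (IsIso (𝟙 _))
  have : IsIso φ := ShortComplex.isIso_of_isIso φ
  exact ShortComplex.shortExact_of_iso (asIso φ) (shortExact_coindTerm n A)

lemma coindComplexι_naturality {A B : Action V H} (f : A ⟶ B) (n : ℕ) :
    (iteratedCosyzygy V H n).map f ≫ coindComplexι B n =
      coindComplexι A n ≫ ((coindComplex V H).map f).f n := by
  rw [coindComplexι, coindComplexι, coindComplex_map_f, Category.assoc, Iso.inv_hom_id_assoc,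
    ← Category.assoc, coindTermι_naturality, Category.assoc]

/-- The coinduced resolution is a splice of short exact sequences. -/
def coindSplice (A : Action V H) : Splice ((coindComplex V H).obj A) where
  B n := (iteratedCosyzygy V H n).obj A
  a n := coindComplexι A n
  b n := coindComplexπ A n
  zero n := coindComplexι_π A n
  shortExact n := shortExact_coindComplex A n
  d_eq n := coindComplex_d A n

/-- The morphism from an object to the term in degree zero of the coinduced resolution. -/
def coindAugX (A : Action V H) : A ⟶ ((coindComplex V H).obj A).X 0 := coindComplexι A 0

lemma coindAugX_d (A : Action V H) : coindAugX A ≫ ((coindComplex V H).obj A).d 0 1 = 0 := by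
  have h : coindComplexι A 0 ≫ ((coindComplex V H).obj A).d (0 : ℕ) (0 + 1 : ℕ) = 0 := by
    rw [(coindSplice A).d_eq, ← Category.assoc]
    exact (coindComplexι_π A 0 =≫ _).trans zero_comp
  exact h

lemma coindAugX_naturality {A B : Action V H} (f : A ⟶ B) :
    (𝟭 (Action V H)).map f ≫ coindAugX B = coindAugX A ≫ ((coindComplex V H).map f).f 0 :=
  coindComplexι_naturality f 0

variable (V H) in
/-- The augmentation of the coinduced resolution. -/
def coindAug : 𝟭 (Action V H) ⋙ CochainComplex.singleFunctor _ 0 ⟶ coindComplex V H :=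
  augOfX coindAugX coindAugX_d coindAugX_naturality

lemma augX_coindAug (A : Action V H) : augX (coindAug V H) A = coindAugX A :=
  augX_augOfX (M := coindComplex V H) (G := 𝟭 _) coindAugX coindAugX_d coindAugX_naturality A

lemma quasiIso_coindAug (A : Action V H) : QuasiIso ((coindAug V H).app A) := by
  refine Splice.quasiIso (coindAug V H) A (coindSplice A) (Iso.refl A) ?_
  rw [augX_coindAug]
  exact (Category.id_comp (coindAugX A)).symm

end CoinducedResolution

/-! ### Applying an additive functor to the total complex of `M(K^p)^q` -/

section TotalComparison

variable {E V W : Type*} [Category* E] [Abelian E] [Category* V] [Abelian V]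
  [Category* W] [Abelian W] (M : E ⥤ CochainComplex V ℤ) [M.Additive] [IsNonnegative M]
  (G : V ⥤ W) [G.Additive]

/-- The functor to complexes obtained by applying an additive functor to the terms. -/
abbrev compMap : E ⥤ CochainComplex W ℤ := M ⋙ G.mapHomologicalComplex (ComplexShape.up ℤ)

instance : IsNonnegative (compMap M G) where
  isZero A q hq := G.map_isZero (IsNonnegative.isZero (M := M) A q hq)

/-- The components of the comparison between the total complex of `G(M(K^p)^q)` and the image by
`G` of the total complex of `M(K^p)^q`. -/
def totalPlusComparisonX (K : CochainComplex.Plus E) (n : ℤ) :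
    ((totalPlus (compMap M G)).obj K).obj.X n ⟶ G.obj (((totalPlus M).obj K).obj.X n) :=
  have : ((mapBicomplex G).obj ((bicomplex M).obj K.obj)).HasTotal (ComplexShape.up ℤ) :=
    hasTotal_bicomplex (compMap M G) K
  (totMapComparison G ((bicomplex M).obj K.obj)).f n

/-- The inclusion of a summand in the total complex of `G(M(K^p)^q)`. -/
def compMapι (K : CochainComplex.Plus E) (p q n : ℤ) (h : p + q = n) :
    G.obj ((M.obj (K.obj.X p)).X q) ⟶ ((totalPlus (compMap M G)).obj K).obj.X n :=
  totalPlusι (compMap M G) K p q n h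

lemma compMapι_totalPlusComparisonX (K : CochainComplex.Plus E) (p q n : ℤ) (h : p + q = n) :
    compMapι M G K p q n h ≫ totalPlusComparisonX M G K n = G.map (totalPlusι M K p q n h) :=
  have : ((mapBicomplex G).obj ((bicomplex M).obj K.obj)).HasTotal (ComplexShape.up ℤ) :=
    hasTotal_bicomplex (compMap M G) K
  mapι_totMapComparisonX G ((bicomplex M).obj K.obj) p q n h

lemma compMapι_map {K L : CochainComplex.Plus E} (f : K ⟶ L) (p q n : ℤ) (h : p + q = n) :
    compMapι M G K p q n h ≫ ((totalPlus (compMap M G)).map f).hom.f n =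
      G.map ((M.map (f.hom.f p)).f q) ≫ compMapι M G L p q n h :=
  totalPlusι_map (compMap M G) f p q n h

variable {M G} in
lemma compMap_hom_ext {K : CochainComplex.Plus E} {n : ℤ} {A : W}
    {f g : ((totalPlus (compMap M G)).obj K).obj.X n ⟶ A}
    (h : ∀ p q h, compMapι M G K p q n h ≫ f = compMapι M G K p q n h ≫ g) : f = g :=
  totalPlus_hom_ext h

/-- The comparison between the total complex of `G(M(K^p)^q)` and the image by `G` of the total
complex of `M(K^p)^q`. -/
def totalPlusComparisonApp (K : CochainComplex.Plus E) :
    (totalPlus (compMap M G)).obj K ⟶ G.mapCochainComplexPlus.obj ((totalPlus M).obj K) :=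
  have : ((mapBicomplex G).obj ((bicomplex M).obj K.obj)).HasTotal (ComplexShape.up ℤ) :=
    hasTotal_bicomplex (compMap M G) K
  ObjectProperty.homMk (totMapComparison G ((bicomplex M).obj K.obj))

lemma totalPlusComparisonX_naturality {K L : CochainComplex.Plus E} (f : K ⟶ L) (n : ℤ) :
    ((totalPlus (compMap M G)).map f).hom.f n ≫ totalPlusComparisonX M G L n =
      totalPlusComparisonX M G K n ≫ G.map (((totalPlus M).map f).hom.f n) := by
  refine compMap_hom_ext fun p q h => ?_
  rw [← Category.assoc, compMapι_map, Category.assoc, compMapι_totalPlusComparisonX,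
    ← Category.assoc, compMapι_totalPlusComparisonX, ← G.map_comp, ← G.map_comp, totalPlusι_map]

instance (K : CochainComplex.Plus E) : IsIso (totalPlusComparisonApp M G K) := by
  have : ((mapBicomplex G).obj ((bicomplex M).obj K.obj)).HasTotal (ComplexShape.up ℤ) :=
    hasTotal_bicomplex (compMap M G) K
  obtain ⟨n, h⟩ := exists_isSupportedGE_bicomplex M K
  have : IsIso ((CochainComplex.Plus.ι W).map (totalPlusComparisonApp M G K)) :=
    isIso_totMapComparison G h
  exact isIso_of_fully_faithful (CochainComplex.Plus.ι W) _

/-- The total complex of `G(M(K^p)^q)` is the image by `G` of the total complex of `M(K^p)^q`. -/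
def totalPlusComparison :
    totalPlus (compMap M G) ≅ totalPlus M ⋙ G.mapCochainComplexPlus :=
  NatIso.ofComponents (fun K => asIso (totalPlusComparisonApp M G K)) (fun {K L} f => by
    ext n : 3
    exact totalPlusComparisonX_naturality M G f n)

end TotalComparison

section MapQuasiIso

variable {E V : Type*} [Category* E] [Abelian E] [Category* V] [Abelian V]

lemma quasiIso_map_of_natIso {F G : E ⥤ V} [F.Additive] [G.Additive] (e : F ≅ G)
    {K L : CochainComplex E ℤ} (f : K ⟶ L)
    (h : QuasiIso ((F.mapHomologicalComplex (ComplexShape.up ℤ)).map f)) :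
    QuasiIso ((G.mapHomologicalComplex (ComplexShape.up ℤ)).map f) :=
  ((HomologicalComplex.quasiIso V (ComplexShape.up ℤ)).arrow_mk_iso_iff
    (((Functor.mapArrowFunctor _ _).mapIso
      (NatIso.mapHomologicalComplex e (ComplexShape.up ℤ))).app (Arrow.mk f))).1 h

lemma quasiIso_map_of_isZero {F : E ⥤ V} [F.Additive] (hF : ∀ A, IsZero (F.obj A))
    {K L : CochainComplex E ℤ} (f : K ⟶ L) :
    QuasiIso ((F.mapHomologicalComplex (ComplexShape.up ℤ)).map f) := by
  rw [quasiIso_iff]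
  intro i
  rw [quasiIsoAt_iff_exactAt]
  · exact HomologicalComplex.ExactAt.of_isZero (hF _)
  · exact HomologicalComplex.ExactAt.of_isZero (hF _)

end MapQuasiIso

/-! ### Relatively injective objects -/

section RelativelyInjective

variable {V : Type*} [Category* V] [Abelian V] {H : Type v} [Group H] [HasProductsOfShape H V]

/-- An object with an action of `H` is relatively injective if it is a retract of the
corresponding coinduced object. -/
def IsRelativelyInjective (A : Action V H) : Prop :=
  ∃ r : (coind V H).obj A.V ⟶ A, coindUnitApp A ≫ r = 𝟙 A

/-- The retraction is coinduced from the evaluation at `1`. It sends `h ↦ h φ` to `h ↦ (h φ)(1) =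
φ(h)`. -/
lemma isRelativelyInjective_coind (B : V) : IsRelativelyInjective ((coind V H).obj B) := by
  refine ⟨(coind V H).map (coindπ B 1), actionHom_ext (coind_hom_ext fun h => ?_)⟩
  rw [Action.comp_hom, Category.assoc, coind_map_π, ← Category.assoc, coindUnitApp_π,
    coind_actHom_π, one_mul]
  exact (Category.id_comp _).symm

/-- Finite sums of retracts of relatively injective objects are relatively injective. -/
lemma isRelativelyInjective_of_sum {ι : Type*} (s : Finset ι) {A : Action V H}
    (B : ι → Action V H) (i : ∀ j, A ⟶ B j) (p : ∀ j, B j ⟶ A) (h : ∑ j ∈ s, i j ≫ p j = 𝟙 A)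
    (hB : ∀ j, IsRelativelyInjective (B j)) : IsRelativelyInjective A := by
  choose r hr using hB
  refine ⟨∑ j ∈ s, (coind V H).map (i j).hom ≫ r j ≫ p j, ?_⟩
  rw [Preadditive.comp_sum, ← h]
  refine Finset.sum_congr rfl fun j _ => ?_
  rw [← Category.assoc, ← coindUnitApp_naturality, Category.assoc, ← Category.assoc (coindUnitApp _),
    hr, Category.id_comp]

lemma IsRelativelyInjective.of_retract {A B : Action V H} (hB : IsRelativelyInjective B)
    (i : A ⟶ B) (p : B ⟶ A) (h : i ≫ p = 𝟙 A) : IsRelativelyInjective A :=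
  isRelativelyInjective_of_sum {()} (fun _ => B) (fun _ => i) (fun _ => p) (by simpa using h)
    (fun _ => hB)

lemma IsRelativelyInjective.of_isZero {A : Action V H} (hA : IsZero A) :
    IsRelativelyInjective A := ⟨0, hA.eq_of_src _ _⟩

/-- The splitting of the short exact sequence `0 ⟶ A ⟶ coind A ⟶ cosyzygy A ⟶ 0`, if `A` is
relatively injective. -/
lemma IsRelativelyInjective.nonempty_splitting {A : Action V H} (hA : IsRelativelyInjective A) :
    Nonempty (ShortComplex.mk _ _ (coindUnitApp_cosyzygyπ A)).Splitting := by
  obtain ⟨r, hr⟩ := hA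
  exact ⟨ShortComplex.Splitting.ofExactOfRetraction _ (shortExact_coindUnitApp A).exact r hr
    (inferInstanceAs (Epi (cosyzygyπ A)))⟩

/-- An equivariant retraction of the embedding makes the cokernel a direct factor of a coinduced
object. Hence the whole coinduced resolution of `A` splits. -/
lemma IsRelativelyInjective.cosyzygy {A : Action V H} (hA : IsRelativelyInjective A) :
    IsRelativelyInjective ((cosyzygy V H).obj A) := by
  obtain ⟨s⟩ := hA.nonempty_splitting
  exact (isRelativelyInjective_coind A.V).of_retract s.s (cosyzygyπ A) s.s_g

lemma IsRelativelyInjective.iteratedCosyzygy {A : Action V H} (hA : IsRelativelyInjective A) :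
    ∀ n, IsRelativelyInjective ((iteratedCosyzygy V H n).obj A)
  | 0 => hA
  | n + 1 => (hA.iteratedCosyzygy n).cosyzygy

lemma isRelativelyInjective_coindComplex (A : Action V H) (q : ℤ) :
    IsRelativelyInjective (((coindComplex V H).obj A).X q) := by
  by_cases hq : q < 0
  · exact .of_isZero (IsNonnegative.isZero A q hq)
  · obtain ⟨n, rfl⟩ := Int.eq_ofNat_of_zero_le (not_lt.1 hq)
    exact (isRelativelyInjective_coind _).of_retract (coindComplexXIso A n).hom
      (coindComplexXIso A n).inv (Iso.hom_inv_id _)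

variable (V H) in
/-- The functor which sends a bounded below complex to its coinduced resolution. -/
abbrev coindResolution : CochainComplex.Plus (Action V H) ⥤ CochainComplex.Plus (Action V H) :=
  totalPlus (coindComplex V H)

lemma isRelativelyInjective_coindResolution (K : CochainComplex.Plus (Action V H)) (n : ℤ) :
    IsRelativelyInjective (((coindResolution V H).obj K).obj.X n) := by
  obtain ⟨a, h⟩ := exists_isSupportedGE_bicomplex (coindComplex V H) K
  -- Each term is a finite sum, over the first index, of terms of coinduced resolutions; the `0` is
  -- the lower bound of the second index.
  exact isRelativelyInjective_of_sum (Finset.Icc a (n - 0)) _ _ _ (sum_totπ_totι h n)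
    (fun p => isRelativelyInjective_coindComplex _ _)

variable (V H) in
/-- The embedding of a bounded below complex in its coinduced resolution. -/
def coindResolutionι : 𝟭 (CochainComplex.Plus (Action V H)) ⟶ coindResolution V H where
  app K := (augTotal (coindAug V H)).app K
  naturality _ _ f := (augTotal (coindAug V H)).naturality f

lemma quasiIso_coindResolutionι (K : CochainComplex.Plus (Action V H)) :
    CochainComplex.Plus.quasiIso _ ((coindResolutionι V H).app K) :=
  quasiIso_augTotal_app (coindAug V H) K (fun _ => quasiIso_coindAug _)

end RelativelyInjective

/-! ### Fixed points of the coinduced resolution -/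

section FixedPointsResolution

variable (V : Type*) [Category* V] [Abelian V] (H : Type v) [Group H] [HasProductsOfShape H V]

/-- The fixed points of the coinduced resolution. -/
abbrev fixedCoindComplex : Action V H ⥤ CochainComplex V ℤ :=
  compMap (coindComplex V H) (fixedPoints V H)

/-- The functor which sends a bounded below complex to the fixed points of its coinduced
resolution. -/
abbrev fixedCoindResolution : CochainComplex.Plus (Action V H) ⥤ CochainComplex.Plus V :=
  coindResolution V H ⋙ (fixedPoints V H).mapCochainComplexPlus

variable {V H}

/-- The terms of the fixed points of the coinduced resolution. -/
def fixedCoindXIso (A : Action V H) (n : ℕ) :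
    (fixedPoints V H).obj (((coindComplex V H).obj A).X n) ≅ ((iteratedCosyzygy V H n).obj A).V :=
  (fixedPoints V H).mapIso (coindComplexXIso A n) ≪≫ fixedPointsCoindApp _

lemma fixedCoindXIso_naturality {A B : Action V H} (f : A ⟶ B) (n : ℕ) :
    (fixedPoints V H).map (((coindComplex V H).map f).f n) ≫ (fixedCoindXIso B n).hom =
      (fixedCoindXIso A n).hom ≫ ((iteratedCosyzygy V H n).map f).hom := by
  rw [coindComplex_map_f, fixedCoindXIso, fixedCoindXIso, Iso.trans_hom, Iso.trans_hom,
    Functor.mapIso_hom, Functor.mapIso_hom, ← Category.assoc, ← Functor.map_comp, Category.assoc,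
    Category.assoc, Iso.inv_hom_id, Category.comp_id, Functor.map_comp, Category.assoc,
    Category.assoc]
  congr 1
  exact fixedPointsCoind.hom.naturality ((iteratedCosyzygy V H n).map f).hom

/-- The terms of the fixed points of the coinduced resolution, functorially. -/
def fixedCoindComplexEval (n : ℕ) :
    fixedCoindComplex V H ⋙ HomologicalComplex.eval _ _ (n : ℤ) ≅
      iteratedCosyzygy V H n ⋙ Action.forget V H :=
  NatIso.ofComponents (fun A => fixedCoindXIso A n)
    (fun f => fixedCoindXIso_naturality f n)

/-- Taking fixed points cancels coinduction, so the row of index `q ≥ 0` is the underlying complex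
of the `q`-th iterated cosyzygy of `K`. This preserves quasi-isomorphisms even though fixed points
do not. -/
lemma quasiIso_fixedCoindResolution_map [PreservesFiniteColimits (powerFunctor V H)]
    {K L : CochainComplex.Plus (Action V H)} (f : K ⟶ L)
    (hf : CochainComplex.Plus.quasiIso _ f) :
    CochainComplex.Plus.quasiIso V ((fixedCoindResolution V H).map f) := by
  have : QuasiIso f.hom := hf
  have h : CochainComplex.Plus.quasiIso V ((totalPlus (fixedCoindComplex V H)).map f) := by
    refine quasiIso_totalPlus_map _ f fun q => ?_
    by_cases hq : q < 0
    · exact quasiIso_map_of_isZero (fun A => IsNonnegative.isZero (M := fixedCoindComplex V H) A q hq) _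
    · obtain ⟨n, rfl⟩ := Int.eq_ofNat_of_zero_le (not_lt.1 hq)
      refine quasiIso_map_of_natIso (fixedCoindComplexEval n).symm _ ?_
      have := quasiIso_map_iteratedCosyzygy f.hom n
      exact inferInstanceAs (QuasiIso (((Action.forget V H).mapHomologicalComplex _).map
        (((iteratedCosyzygy V H n).mapHomologicalComplex _).map f.hom)))
  exact ((CochainComplex.Plus.quasiIso V).arrow_mk_iso_iff
    (((Functor.mapArrowFunctor _ _).mapIso
      (totalPlusComparison (coindComplex V H) (fixedPoints V H))).app (Arrow.mk f))).1 h

/-- The augmentation of the fixed points of the coinduced resolution. -/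
def fixedCoindAugX (A : Action V H) : (fixedPoints V H).obj A ⟶ ((fixedCoindComplex V H).obj A).X 0 :=
  (fixedPoints V H).map (coindAugX A)

lemma fixedCoindAugX_d (A : Action V H) :
    fixedCoindAugX A ≫ ((fixedCoindComplex V H).obj A).d 0 1 = 0 :=
  ((fixedPoints V H).map_comp _ _).symm.trans
    ((congrArg (fixedPoints V H).map (coindAugX_d A)).trans ((fixedPoints V H).map_zero _ _))

lemma fixedCoindAugX_naturality {A B : Action V H} (f : A ⟶ B) :
    (fixedPoints V H).map f ≫ fixedCoindAugX B =
      fixedCoindAugX A ≫ ((fixedCoindComplex V H).map f).f 0 :=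
  ((fixedPoints V H).map_comp _ _).symm.trans
    ((congrArg (fixedPoints V H).map (coindAugX_naturality f)).trans
      ((fixedPoints V H).map_comp _ _))

variable (V H) in
/-- The augmentation of the fixed points of the coinduced resolution. -/
def fixedCoindAug :
    fixedPoints V H ⋙ CochainComplex.singleFunctor V 0 ⟶ fixedCoindComplex V H :=
  augOfX fixedCoindAugX fixedCoindAugX_d fixedCoindAugX_naturality

lemma augX_fixedCoindAug (A : Action V H) : augX (fixedCoindAug V H) A = fixedCoindAugX A :=
  augX_augOfX (M := fixedCoindComplex V H) (G := fixedPoints V H) fixedCoindAugX fixedCoindAugX_d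
    fixedCoindAugX_naturality A

/-- The sequence splits equivariantly, because all cosyzygies of `A` are relatively injective;
additive functors preserve split sequences. -/
lemma shortExact_map_fixedPoints {A : Action V H} (hA : IsRelativelyInjective A) (n : ℕ) :
    ((ShortComplex.mk _ _ (coindComplexι_π A n)).map (fixedPoints V H)).ShortExact := by
  obtain ⟨r, hr⟩ := hA.iteratedCosyzygy n
  have h : coindComplexι A n ≫ (coindComplexXIso A n).hom ≫ r = 𝟙 _ := by
    rw [coindComplexι, Category.assoc, Iso.inv_hom_id_assoc]
    exact hr
  have s := ShortComplex.Splitting.ofExactOfRetraction _ (shortExact_coindComplex A n).exact _ h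
    (shortExact_coindComplex A n).epi_g
  exact (s.map (fixedPoints V H)).shortExact

/-- If `A` is relatively injective, the fixed points of the coinduced resolution of `A` are a
splice of short exact sequences. -/
def fixedCoindSplice {A : Action V H} (hA : IsRelativelyInjective A) :
    Splice ((fixedCoindComplex V H).obj A) where
  B n := (fixedPoints V H).obj ((iteratedCosyzygy V H n).obj A)
  a n := (fixedPoints V H).map (coindComplexι A n)
  b n := (fixedPoints V H).map (coindComplexπ A n)
  zero n := ((ShortComplex.mk _ _ (coindComplexι_π A n)).map (fixedPoints V H)).zero
  shortExact n := shortExact_map_fixedPoints hA n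
  d_eq n := (congrArg (fixedPoints V H).map (coindComplex_d A n)).trans
    ((fixedPoints V H).map_comp _ _)

lemma quasiIso_fixedCoindAug {A : Action V H} (hA : IsRelativelyInjective A) :
    QuasiIso ((fixedCoindAug V H).app A) := by
  refine Splice.quasiIso (fixedCoindAug V H) A (fixedCoindSplice hA) (Iso.refl _) ?_
  rw [augX_fixedCoindAug]
  exact (Category.id_comp (fixedCoindAugX A)).symm

lemma fixedPoints_map_coindResolutionι (K : CochainComplex.Plus (Action V H)) :
    (fixedPoints V H).mapCochainComplexPlus.map ((coindResolutionι V H).app K) =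
      (augTotal (fixedCoindAug V H)).app K ≫
        (totalPlusComparison (coindComplex V H) (fixedPoints V H)).hom.app K := by
  ext n : 3
  change (fixedPoints V H).map (augX (coindAug V H) (K.obj.X n) ≫ totalPlusι _ K n 0 n _) =
    (augX (fixedCoindAug V H) (K.obj.X n) ≫ compMapι (coindComplex V H) (fixedPoints V H) K n 0 n _)
      ≫ totalPlusComparisonX (coindComplex V H) (fixedPoints V H) K n
  rw [augX_fixedCoindAug, augX_coindAug, Functor.map_comp]
  exact (((fixedPoints V H).map (coindAugX (K.obj.X n)) ≫=
    compMapι_totalPlusComparisonX (coindComplex V H) (fixedPoints V H) K n 0 n _).symm).trans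
    (Category.assoc _ _ _).symm

/-- Relatively injective terms are acyclic for the fixed points. This is the condition `ht` of
`isRightDerivedFunctor_fixedPoints`. -/
lemma quasiIso_fixedPoints_map_coindResolutionι (K : CochainComplex.Plus (Action V H))
    (hK : ∀ n, IsRelativelyInjective (K.obj.X n)) :
    CochainComplex.Plus.quasiIso V
      ((fixedPoints V H).mapCochainComplexPlus.map ((coindResolutionι V H).app K)) := by
  rw [fixedPoints_map_coindResolutionι]
  refine MorphismProperty.comp_mem _ _ _
    (quasiIso_augTotal_app _ K (fun n => quasiIso_fixedCoindAug (hK n))) ?_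
  have : QuasiIso ((CochainComplex.Plus.ι V).map
      ((totalPlusComparison (coindComplex V H) (fixedPoints V H)).hom.app K)) := inferInstance
  exact this

end FixedPointsResolution

/-! ### A criterion for right derived functors by means of a resolution functor -/

section DerivedCriterion

variable {C₀ C₁ D E : Type*} [Category* C₀] [Category* C₁] [Category* D] [Category* E]
  (P : C₀ ⥤ C₁) (W₀ : MorphismProperty C₀) [P.IsLocalization W₀]
  {L : C₁ ⥤ D} (W₁ : MorphismProperty C₁) [L.IsLocalization W₁]
  (W : MorphismProperty C₀) [(P ⋙ L).IsLocalization W]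
  {F : C₁ ⥤ E} {RF : D ⥤ E} (α : F ⟶ L ⋙ RF)
  (R : C₀ ⥤ C₀) (i : 𝟭 C₀ ⟶ R) (hi : ∀ K, IsIso (L.map (P.map (i.app K))))
  (hα : ∀ K, IsIso (α.app (P.obj (R.obj K))))

include hi hα

-- A transformation out of `RF` is determined at `R K` by its composite with the invertible `α`, and
-- the resolution morphism carries this to `K`. Testing on objects of `C₀` is enough since `P ⋙ L`
-- is a localization.
include W in
lemma derived_hom_ext {G : D ⥤ E} {γ γ' : RF ⟶ G}
    (h : ∀ K, α.app (P.obj K) ≫ γ.app (L.obj (P.obj K)) =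
      α.app (P.obj K) ≫ γ'.app (L.obj (P.obj K))) : γ = γ' := by
  refine Localization.natTrans_ext (P ⋙ L) W fun K => ?_
  change γ.app (L.obj (P.obj K)) = γ'.app (L.obj (P.obj K))
  have := hi K
  have := hα K
  rw [← cancel_mono (G.map (L.map (P.map (i.app K)))), ← γ.naturality, ← γ'.naturality]
  congr 1
  rw [← cancel_epi (α.app (P.obj (R.obj K)))]
  exact h _

/-- The components of the natural transformation from a derived functor given by its
universal property. -/
def derivedDescApp {G : D ⥤ E} (β : F ⟶ L ⋙ G) (K : C₀) :
    RF.obj (L.obj (P.obj K)) ⟶ G.obj (L.obj (P.obj K)) :=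
  have := hi K
  have := hα K
  RF.map (L.map (P.map (i.app K))) ≫ inv (α.app (P.obj (R.obj K))) ≫ β.app (P.obj (R.obj K)) ≫
    G.map (inv (L.map (P.map (i.app K))))

lemma derivedDescApp_naturality {G : D ⥤ E} (β : F ⟶ L ⋙ G) {K K' : C₀} (f : K ⟶ K') :
    RF.map (L.map (P.map f)) ≫ derivedDescApp P α R i hi hα β K' =
      derivedDescApp P α R i hi hα β K ≫ G.map (L.map (P.map f)) := by
  have := hi K
  have := hi K'
  have := hα K
  have := hα K'
  have h₀ : f ≫ i.app K' = i.app K ≫ R.map f := i.naturality f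
  have h₁ := α.naturality (P.map (R.map f))
  have h₂ := β.naturality (P.map (R.map f))
  dsimp at h₁ h₂
  have h₃ : inv (L.map (P.map (i.app K))) ≫ L.map (P.map f) =
      L.map (P.map (R.map f)) ≫ inv (L.map (P.map (i.app K'))) := by
    rw [IsIso.inv_comp_eq, ← Category.assoc, IsIso.eq_comp_inv, ← L.map_comp, ← L.map_comp,
      ← P.map_comp, ← P.map_comp, h₀]
  have h₄ : RF.map (L.map (P.map (R.map f))) ≫ inv (α.app (P.obj (R.obj K'))) =
      inv (α.app (P.obj (R.obj K))) ≫ F.map (P.map (R.map f)) := by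
    rw [IsIso.comp_inv_eq, Category.assoc, h₁, IsIso.inv_hom_id_assoc]
  rw [derivedDescApp, derivedDescApp]
  simp only [Category.assoc]
  rw [← G.map_comp, h₃, G.map_comp, ← reassoc_of% h₂, ← Category.assoc, ← RF.map_comp,
    ← L.map_comp, ← P.map_comp, h₀, P.map_comp, L.map_comp, RF.map_comp, Category.assoc]
  rw [reassoc_of% h₄]

lemma comp_derivedDescApp {G : D ⥤ E} (β : F ⟶ L ⋙ G) (K : C₀) :
    α.app (P.obj K) ≫ derivedDescApp P α R i hi hα β K = β.app (P.obj K) := by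
  have := hi K
  have := hα K
  have h₁ := α.naturality (P.map (i.app K))
  have h₂ := β.naturality (P.map (i.app K))
  dsimp at h₁ h₂
  rw [derivedDescApp, ← reassoc_of% h₁, IsIso.hom_inv_id_assoc, reassoc_of% h₂, ← G.map_comp,
    IsIso.hom_inv_id, G.map_id]
  exact Category.comp_id _

include W₀ W in
/-- A criterion for a functor to be a right derived functor, in terms of a resolution functor. -/
lemma isRightDerivedFunctor_of_resolution : RF.IsRightDerivedFunctor α W₁ := by
  -- The resolution functor `R` is defined on `C₀` and need not descend to `C₁`. The required
  -- transformation is therefore constructed on `C₀` and extended along the localization `P ⋙ L`.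
  refine ⟨⟨⟨IsInitial.ofUniqueHom (fun G => StructuredArrow.homMk
    (Localization.liftNatTrans (P ⋙ L) W ((P ⋙ L) ⋙ RF) ((P ⋙ L) ⋙ G.right) RF G.right
      { app := fun K => derivedDescApp P α R i hi hα G.hom K
        naturality := fun _ _ f => derivedDescApp_naturality P α R i hi hα G.hom f }) ?_) ?_⟩⟩⟩
  · refine Localization.natTrans_ext P W₀ fun K => ?_
    refine Eq.trans ?_ (comp_derivedDescApp P α R i hi hα G.hom K)
    refine congrArg (fun g => α.app (P.obj K) ≫ g)
      ((Localization.liftNatTrans_app (P ⋙ L) W ((P ⋙ L) ⋙ RF) ((P ⋙ L) ⋙ G.right) RF G.right _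
        K).trans ?_)
    exact (Category.id_comp _).trans (Category.comp_id _)
  · intro G m
    ext1
    refine derived_hom_ext P W α R i hi hα fun K => ?_
    have h := congr_app (StructuredArrow.w m) (P.obj K)
    refine h.trans ?_
    refine Eq.trans (comp_derivedDescApp P α R i hi hα G.hom K).symm ?_
    refine congrArg (fun g => α.app (P.obj K) ≫ g) (Eq.symm
      ((Localization.liftNatTrans_app (P ⋙ L) W ((P ⋙ L) ⋙ RF) ((P ⋙ L) ⋙ G.right) RF G.right _
        K).trans ?_))
    exact (Category.id_comp _).trans (Category.comp_id _)

end DerivedCriterion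

/-! ### Derived functors on bounded below complexes -/

section DerivedPlus

variable {E V : Type*} [Category* E] [Abelian E] [Category* V] [Abelian V]
  [HasDerivedCategory E] [HasDerivedCategory V]

instance isLocalization_plusQ :
    (DerivedCategory.Plus.Q (C := E)).IsLocalization (CochainComplex.Plus.quasiIso E) :=
  inferInstanceAs ((HomotopyCategory.Plus.quotient E ⋙ DerivedCategory.Plus.Qh).IsLocalization
    (CochainComplex.Plus.quasiIso E))

lemma isIso_plusQ_map {K L : CochainComplex.Plus E} (f : K ⟶ L)
    (hf : CochainComplex.Plus.quasiIso E f) : IsIso (DerivedCategory.Plus.Q.map f) :=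
  Localization.inverts DerivedCategory.Plus.Q (CochainComplex.Plus.quasiIso E) f hf

section

variable (T : CochainComplex.Plus E ⥤ CochainComplex.Plus V)
  (hT : ∀ {K L : CochainComplex.Plus E} (f : K ⟶ L), CochainComplex.Plus.quasiIso E f →
    CochainComplex.Plus.quasiIso V (T.map f))

/-- The functor between derived categories induced by a functor on complexes which preserves
quasi-isomorphisms. -/
def inducedPlus : DerivedCategory.Plus E ⥤ DerivedCategory.Plus V :=
  Localization.lift (W := CochainComplex.Plus.quasiIso E) (T ⋙ DerivedCategory.Plus.Q)
    (fun _ _ f hf => isIso_plusQ_map _ (hT f hf)) DerivedCategory.Plus.Q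

/-- The functor `inducedPlus` is computed by applying the functor to complexes. -/
def inducedPlusFac : T ⋙ DerivedCategory.Plus.Q ≅ DerivedCategory.Plus.Q ⋙ inducedPlus T hT :=
  (Localization.fac (W := CochainComplex.Plus.quasiIso E) (T ⋙ DerivedCategory.Plus.Q)
    (fun _ _ f hf => isIso_plusQ_map _ (hT f hf)) DerivedCategory.Plus.Q).symm

end

variable {G : E ⥤ V} [G.Additive] {T : CochainComplex.Plus E ⥤ CochainComplex.Plus V}
  (t : G.mapCochainComplexPlus ⟶ T) {RF : DerivedCategory.Plus E ⥤ DerivedCategory.Plus V}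
  (e : T ⋙ DerivedCategory.Plus.Q ≅ DerivedCategory.Plus.Q ⋙ RF)

/-- The components of `inducedUnit`. -/
def inducedUnitApp (K : CochainComplex.Plus E) :
    (G.mapHomotopyCategoryPlus ⋙ DerivedCategory.Plus.Qh).obj
      ((HomotopyCategory.Plus.quotient E).obj K) ⟶
    (DerivedCategory.Plus.Qh ⋙ RF).obj ((HomotopyCategory.Plus.quotient E).obj K) :=
  DerivedCategory.Plus.Q.map (t.app K) ≫ e.hom.app K

/-- The natural transformation on the homotopy category which is induced by a natural transformation
`G(K) ⟶ T(K)` on complexes. -/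
def inducedUnit : G.mapHomotopyCategoryPlus ⋙ DerivedCategory.Plus.Qh ⟶
    DerivedCategory.Plus.Qh ⋙ RF :=
  Localization.liftNatTrans (HomotopyCategory.Plus.quotient E)
    ((HomologicalComplex.homotopyEquivalences E (ComplexShape.up ℤ)).inverseImage
      (CochainComplex.Plus.ι E))
    (HomotopyCategory.Plus.quotient E ⋙ G.mapHomotopyCategoryPlus ⋙ DerivedCategory.Plus.Qh)
    (HomotopyCategory.Plus.quotient E ⋙ DerivedCategory.Plus.Qh ⋙ RF) _ _
    { app := fun K => inducedUnitApp t e K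
      naturality := fun K L f => by
        change DerivedCategory.Plus.Q.map (G.mapCochainComplexPlus.map f) ≫
            DerivedCategory.Plus.Q.map (t.app L) ≫ e.hom.app L =
          (DerivedCategory.Plus.Q.map (t.app K) ≫ e.hom.app K) ≫
            RF.map (DerivedCategory.Plus.Q.map f)
        have h := e.hom.naturality f
        dsimp only [Functor.comp_obj, Functor.comp_map] at h
        rw [Category.assoc, ← h, ← Category.assoc, ← Category.assoc, ← Functor.map_comp,
          ← Functor.map_comp, t.naturality] }

lemma inducedUnit_app (K : CochainComplex.Plus E) :
    (inducedUnit t e).app ((HomotopyCategory.Plus.quotient E).obj K) = inducedUnitApp t e K := by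
  refine (Localization.liftNatTrans_app (HomotopyCategory.Plus.quotient E)
    ((HomologicalComplex.homotopyEquivalences E (ComplexShape.up ℤ)).inverseImage
      (CochainComplex.Plus.ι E)) _ _ _ _ _ K).trans ?_
  exact (Category.id_comp _).trans (Category.comp_id _)

/-- A criterion for right derived functors. -/
lemma isRightDerivedFunctor_inducedUnit (R : CochainComplex.Plus E ⥤ CochainComplex.Plus E)
    (i : 𝟭 _ ⟶ R) (hi : ∀ K, CochainComplex.Plus.quasiIso E (i.app K))
    (ht : ∀ K, CochainComplex.Plus.quasiIso V (t.app (R.obj K))) :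
    RF.IsRightDerivedFunctor (inducedUnit t e) (HomotopyCategory.Plus.quasiIso E) := by
  refine isRightDerivedFunctor_of_resolution (HomotopyCategory.Plus.quotient E)
    ((HomologicalComplex.homotopyEquivalences E (ComplexShape.up ℤ)).inverseImage
      (CochainComplex.Plus.ι E)) (HomotopyCategory.Plus.quasiIso E)
    (CochainComplex.Plus.quasiIso E) (inducedUnit t e) R i
    (fun K => isIso_plusQ_map (i.app K) (hi K)) (fun K => ?_)
  rw [inducedUnit_app]
  have h := isIso_plusQ_map (t.app (R.obj K)) (ht K)
  exact inferInstanceAs (IsIso (DerivedCategory.Plus.Q.map (t.app (R.obj K)) ≫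
    e.hom.app (R.obj K)))

end DerivedPlus

/-! ### The derived functor of the fixed points -/

section FixedPointsDerived

variable {V : Type*} [Category* V] [Abelian V] {H : Type v} [Group H] [HasProductsOfShape H V]
  [PreservesFiniteColimits (powerFunctor V H)] [HasDerivedCategory (Action V H)] [HasDerivedCategory V]

/-- The criterion with the coinduced resolution as resolution functor. It is used twice: with the
fixed points of that resolution, to obtain existence, and with `homTotal F`, to compute the derived
functor. -/
lemma isRightDerivedFunctor_fixedPoints
    {T : CochainComplex.Plus (Action V H) ⥤ CochainComplex.Plus V}
    (t : (fixedPoints V H).mapCochainComplexPlus ⟶ T)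
    {RF : DerivedCategory.Plus (Action V H) ⥤ DerivedCategory.Plus V}
    (e : T ⋙ DerivedCategory.Plus.Q ≅ DerivedCategory.Plus.Q ⋙ RF)
    (ht : ∀ K : CochainComplex.Plus (Action V H), (∀ n, IsRelativelyInjective (K.obj.X n)) →
      CochainComplex.Plus.quasiIso V (t.app K)) :
    RF.IsRightDerivedFunctor (inducedUnit t e) (HomotopyCategory.Plus.quasiIso _) :=
  isRightDerivedFunctor_inducedUnit t e (coindResolution V H) (coindResolutionι V H)
    quasiIso_coindResolutionι
    (fun K => ht _ (isRelativelyInjective_coindResolution K))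

variable (V H) in
lemma hasRightDerivedFunctor_fixedPoints :
    ((fixedPoints V H).mapHomotopyCategoryPlus ⋙
      DerivedCategory.Plus.Qh).HasRightDerivedFunctor (HomotopyCategory.Plus.quasiIso _) := by
  let t : (fixedPoints V H).mapCochainComplexPlus ⟶ fixedCoindResolution V H :=
    { app := fun K => (fixedPoints V H).mapCochainComplexPlus.map ((coindResolutionι V H).app K)
      naturality := fun K L f => by
        have h : f ≫ (coindResolutionι V H).app L =
          (coindResolutionι V H).app K ≫ (coindResolution V H).map f :=
          (coindResolutionι V H).naturality f
        rw [← Functor.map_comp, h, Functor.map_comp]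
        rfl }
  have := isRightDerivedFunctor_fixedPoints t
    (inducedPlusFac (fixedCoindResolution V H) quasiIso_fixedCoindResolution_map)
    quasiIso_fixedPoints_map_coindResolutionι
  exact Functor.HasRightDerivedFunctor.mk' _ (inducedUnit t
    (inducedPlusFac (fixedCoindResolution V H) quasiIso_fixedCoindResolution_map))

end FixedPointsDerived

/-! ### Exactness of powers of pro-objects -/

section Copowers

variable {D : Type*} [Category* D] (J : Type*) [HasCoproductsOfShape J D]

/-- The copower of an object indexed by `J`. -/
def copower (B : D) : D := ∐ fun _ : J => B

variable {J}

/-- The inclusions in a copower. -/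
def copowerι (B : D) (j : J) : B ⟶ copower J B := Sigma.ι (fun _ => B) j

/-- The universal property of a copower. -/
def copowerDesc {A B : D} (f : J → (A ⟶ B)) : copower J A ⟶ B := Sigma.desc f

lemma copowerι_desc {A B : D} (f : J → (A ⟶ B)) (j : J) : copowerι A j ≫ copowerDesc f = f j :=
  Sigma.ι_desc _ _

lemma copower_hom_ext {A B : D} {f g : copower J A ⟶ B}
    (h : ∀ j, copowerι A j ≫ f = copowerι A j ≫ g) : f = g := Sigma.hom_ext _ _ h

variable (D J)

/-- The functor which sends an object to its copower indexed by `J`. -/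
def copowerFunctor : D ⥤ D where
  obj B := copower J B
  map f := copowerDesc fun j => f ≫ copowerι _ j
  map_id A := copower_hom_ext fun j => by rw [copowerι_desc, Category.comp_id, Category.id_comp]
  map_comp f g := copower_hom_ext fun j => by
    rw [copowerι_desc, ← Category.assoc, copowerι_desc, Category.assoc, Category.assoc,
      copowerι_desc]

/-- The copower functor is the colimit of constant diagrams. -/
def copowerFunctorIso : copowerFunctor D J ≅ Functor.const (Discrete J) ⋙ colim :=
  NatIso.ofComponents (fun B => colim.mapIso (Discrete.natIso fun _ => Iso.refl B))
    (fun {A B} f => by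
      refine colimit.hom_ext fun j => ?_
      erw [← Category.assoc, copowerι_desc, ι_colimMap_assoc, ι_colimMap, Category.assoc, ι_colimMap]
      change f ≫ 𝟙 B ≫ _ = 𝟙 A ≫ f ≫ _
      rw [Category.id_comp, Category.id_comp])

instance [Abelian D] [HasExactColimitsOfShape (Discrete J) D] :
    PreservesFiniteLimits (copowerFunctor D J) :=
  preservesFiniteLimits_of_natIso (copowerFunctorIso D J).symm

/-- Powers in the opposite category are copowers. -/
def copowerFunctorOpIso [HasProductsOfShape J Dᵒᵖ] :
    (copowerFunctor D J).op ≅ powerFunctor Dᵒᵖ J :=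
  NatIso.ofComponents (fun B => opCoproductIsoProduct fun _ => B.unop) (fun {A B} f => by
    refine power_hom_ext fun j => ?_
    have h (A : Dᵒᵖ) : (opCoproductIsoProduct fun _ : J => A.unop).hom ≫ powerπ A j =
      (copowerι A.unop j).op := opCoproductIsoProduct_hom_comp_π j
    refine (Category.assoc _ _ _).trans (((copowerFunctor D J).op.map f ≫= h B).trans ?_)
    refine Eq.trans ?_ (Category.assoc _ _ _).symm
    refine Eq.trans ?_ (_ ≫= powerLift_π (fun j => powerπ A j ≫ f) j).symm
    refine Eq.trans ?_ (Category.assoc _ _ _)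
    refine Eq.trans ?_ (h A =≫ f).symm
    exact Quiver.Hom.unop_inj (copowerι_desc (fun j => f.unop ≫ copowerι _ j) j))

instance [Abelian D] [HasExactColimitsOfShape (Discrete J) D] [HasProductsOfShape J Dᵒᵖ] :
    PreservesFiniteColimits (powerFunctor Dᵒᵖ J) :=
  have : PreservesFiniteColimits (copowerFunctor D J).op :=
    preservesFiniteColimits_op (copowerFunctor D J)
  preservesFiniteColimits_of_natIso (copowerFunctorOpIso D J)

end Copowers

section ProPowers

variable (C : Type u) [Category.{v} C] [Abelian C] (J : Type v)

/-- Powers of pro-objects are opposite to copowers of ind-objects of `Cᵒᵖ`, which are exact because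
AB5 implies AB4. -/
instance : PreservesFiniteColimits (powerFunctor (Pro C) J) := by
  have : AB4OfSize.{v} (Ind Cᵒᵖ) := AB4.of_AB5 _
  exact inferInstanceAs (PreservesFiniteColimits (powerFunctor (Ind Cᵒᵖ)ᵒᵖ J))

end ProPowers

section

variable (C : Type u) [Category.{v} C] [Abelian C] (H : Type v) [Group H]
  [HasDerivedCategory.{w₁} (Action (Pro C) H)] [HasDerivedCategory.{w₂} (Pro C)]

lemma hasRightDerivedFunctor_fixedPointsPlus :
  (fixedPointsPlus C H).HasRightDerivedFunctor
      (HomotopyCategory.Plus.quasiIso (Action (Pro C) H)) :=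
  hasRightDerivedFunctor_fixedPoints (Pro C) H

end

/-! ### The functors `Hom(M, A)^H` and their evaluation at elements of `M` -/

section HomTotalQuasiIso

attribute [local instance] HasFiniteBiproducts.of_hasFiniteProducts

variable {V : Type*} [Category* V] [Abelian V] {H : Type v} [Group H]

/-- The terms of `homComplex F`, functorially. -/
def homComplexEval (F : FreeResolution H) (n : ℕ) :
    homComplex (V := V) F ⋙ HomologicalComplex.eval _ _ (n : ℤ) ≅
      Action.forget V H ⋙ powerFunctor V (BasisIndex (F.complex.X n)) :=
  NatIso.ofComponents (fun A => homComplexXIso F A n n rfl) (fun {A B} f => by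
    refine (homComplex_map_f F f n n rfl =≫ (homComplexXIso F B n n rfl).hom).trans ?_
    rw [Category.assoc, Category.assoc, Iso.inv_hom_id, Category.comp_id]
    rfl)

/-- The rows are finite powers of the underlying complex, and finite powers are exact in every
abelian category. This is where finite generation of the `F_i` enters. -/
lemma quasiIso_homTotal_map (F : FreeResolution H) {K L : CochainComplex.Plus (Action V H)}
    (f : K ⟶ L) (hf : CochainComplex.Plus.quasiIso _ f) :
    CochainComplex.Plus.quasiIso V ((homTotal F).map f) := by
  have : QuasiIso f.hom := hf
  refine quasiIso_totalPlus_map (homComplex F) f fun q => ?_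
  by_cases hq : q < 0
  · exact quasiIso_map_of_isZero (fun A => IsNonnegative.isZero (M := homComplex F) A q hq) _
  · obtain ⟨n, rfl⟩ := Int.eq_ofNat_of_zero_le (not_lt.1 hq)
    exact quasiIso_map_of_natIso (homComplexEval F n).symm _
      (inferInstanceAs (QuasiIso (((powerFunctor V _).mapHomologicalComplex _).map
        (((Action.forget V H).mapHomologicalComplex _).map f.hom))))

end HomTotalQuasiIso

section HomObj

variable {V : Type*} [Category* V] [Abelian V] {H : Type v} [Group H]
  {M N : ModuleCat.{v} (GroupRing H)} [Module.Free (GroupRing H) M]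
  [Module.Finite (GroupRing H) M] [Module.Free (GroupRing H) N]
  [Module.Finite (GroupRing H) N]

/-- A morphism `X ⟶ Hom(M, A)^H` induces an additive map `M ⟶ Hom(X, A)`. -/
def evalHom {A : Action V H} {X : V} (f : X ⟶ homObj M A) : M →+ (X ⟶ A.V) where
  toFun m := ∑ k, f ≫ homπ M A k ≫ smulHom A ((basis M).repr m k)
  map_zero' := by simp [smulHom_zero]
  map_add' m m' := by simp [smulHom_add, Finset.sum_add_distrib]

lemma evalHom_apply {A : Action V H} {X : V} (f : X ⟶ homObj M A) (m : M) :
    evalHom f m = ∑ k, f ≫ homπ M A k ≫ smulHom A ((basis M).repr m k) := rfl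

lemma evalHom_basis {A : Action V H} {X : V} (f : X ⟶ homObj M A) (j : BasisIndex M) :
    evalHom f (basis M j) = f ≫ homπ M A j := by
  classical
  rw [evalHom_apply, Finset.sum_eq_single j]
  · simp [smulHom_one]
  · intro k _ hk
    simp [smulHom_zero, hk.symm]
  · simp

lemma evalHom_smul {A : Action V H} {X : V} (f : X ⟶ homObj M A) (x : GroupRing H) (m : M) :
    evalHom f (x • m) = evalHom f m ≫ smulHom A x := by
  simp only [evalHom_apply, Preadditive.sum_comp, map_smul, Finsupp.smul_apply, smul_eq_mul,
    smulHom_mul, Category.assoc]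

lemma homObj_ext_evalHom {A : Action V H} {X : V} {f g : X ⟶ homObj M A}
    (h : ∀ m, evalHom f m = evalHom g m) : f = g :=
  homObj_ext fun j => by rw [← evalHom_basis, ← evalHom_basis, h]

/-- With `homObj_ext_evalHom`, this identifies morphisms `X ⟶ Hom(M, A)^H` with `ℤH`-linear maps
from `M` to `Hom(X, A)`, independently of the chosen basis. Arguments on modules can then be carried
out with elements. -/
lemma evalHom_homLift {A : Action V H} {X : V} (l : M →+ (X ⟶ A.V))
    (hl : ∀ (x : GroupRing H) m, l (x • m) = l m ≫ smulHom A x) (m : M) :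
    evalHom (homLift M A fun j => l (basis M j)) m = l m := by
  rw [evalHom_apply]
  nth_rewrite 2 [← (basis M).sum_repr m]
  rw [map_sum]
  refine Finset.sum_congr rfl fun k _ => ?_
  rw [hl, ← Category.assoc, homLift_π]

lemma evalHom_comp_homMap {A : Action V H} {X : V} (φ : M ⟶ N) (f : X ⟶ homObj N A) (m : M) :
    evalHom (f ≫ homMap φ A) m = evalHom f (φ.hom m) := by
  nth_rewrite 2 [← (basis M).sum_repr m]
  rw [map_sum, map_sum, evalHom_apply]
  refine Finset.sum_congr rfl fun k _ => ?_
  rw [map_smul, evalHom_smul, ← Category.assoc (f ≫ _), Category.assoc f, homMap_π, evalHom_apply,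
    Preadditive.comp_sum]

lemma evalHom_homPost {A B : Action V H} {X : V} (φ : A ⟶ B) (f : X ⟶ homObj M A) (m : M) :
    evalHom (f ≫ homPost M φ) m = evalHom f m ≫ φ.hom := by
  rw [evalHom_apply, evalHom_apply, Preadditive.sum_comp]
  refine Finset.sum_congr rfl fun k _ => ?_
  rw [Category.assoc, Category.assoc, Category.assoc, smulHom_comm, ← Category.assoc (homPost M φ),
    homPost_π, Category.assoc]

lemma smulHom_of (A : Action V H) (g : H) : smulHom A (MonoidAlgebra.of ℤ H g) = actHom A g := by
  simp [smulHom]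
  rfl

end HomObj

/-! ### The augmentation and the cohomology of `Hom(F_*, A)^H` in degree zero -/

section Augmentation

variable {V : Type*} [Category* V] [Abelian V] {H : Type v} [Group H]

/-- The augmentation of a free resolution, with values in the integers. -/
def FreeResolution.augmentation (F : FreeResolution H) : F.complex.X 0 →+ ℤ :=
  (Representation.trivial ℤ H ℤ).asModuleEquiv.toAddMonoidHom.comp F.ε.toAddMonoidHom

variable (F : FreeResolution H)

lemma augmentation_of_smul (g : H) (m : F.complex.X 0) :
    F.augmentation (MonoidAlgebra.of ℤ H g • m) = F.augmentation m := by
  change (Representation.trivial ℤ H ℤ).asModuleEquiv (F.ε (MonoidAlgebra.of ℤ H g • m)) =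
    (Representation.trivial ℤ H ℤ).asModuleEquiv (F.ε m)
  rw [map_smul, Representation.asModuleEquiv_map_smul]
  simp

lemma augmentation_d (m : F.complex.X 1) : F.augmentation ((F.complex.d 1 0).hom m) = 0 := by
  change (Representation.trivial ℤ H ℤ).asModuleEquiv (F.ε _) = 0
  rw [(F.exact_zero _).2 ⟨m, rfl⟩, map_zero]

lemma exists_of_augmentation_eq_zero {m : F.complex.X 0} (h : F.augmentation m = 0) :
    ∃ m', (F.complex.d 1 0).hom m' = m :=
  (F.exact_zero _).1 ((Representation.trivial ℤ H ℤ).asModuleEquiv.map_eq_zero_iff.1 h)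

lemma exists_augmentation_eq_one : ∃ m, F.augmentation m = 1 := by
  obtain ⟨m, hm⟩ := F.surjective_ε ((Representation.trivial ℤ H ℤ).asModuleEquiv.symm 1)
  refine ⟨m, ?_⟩
  change (Representation.trivial ℤ H ℤ).asModuleEquiv (F.ε m) = 1
  rw [hm]
  exact LinearEquiv.apply_symm_apply _ _

/-- The morphism `A ⟶ Hom(F₀, A)^H` induced by the augmentation; it is meaningful on fixed
points. -/
def augLift (A : Action V H) : A.V ⟶ homObj (F.complex.X 0) A :=
  homLift _ A fun j => F.augmentation (basis _ j) • 𝟙 A.V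

lemma augLift_π (A : Action V H) (j) :
    augLift F A ≫ homπ _ A j = F.augmentation (basis _ j) • 𝟙 A.V := homLift_π _ _ _ _

/-- For invariant `t` the map `m ↦ ε(m) t` is linear over `ℤH`, since the augmentation is invariant
too; hence its values on the basis determine it. -/
lemma evalHom_augLift {A : Action V H} {X : V} (t : X ⟶ A.V) (ht : ∀ g, t ≫ actHom A g = t)
    (m : F.complex.X 0) : evalHom (t ≫ augLift F A) m = F.augmentation m • t := by
  let l : F.complex.X 0 →+ (X ⟶ A.V) := 
    { toFun := fun m => F.augmentation m • t
      map_zero' := by simp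
      map_add' := fun m m' => by rw [map_add, add_smul] }
  have hl (x : GroupRing H) (m) : l (x • m) = l m ≫ smulHom A x := by
    change F.augmentation (x • m) • t = (F.augmentation m • t) ≫ smulHom A x
    induction x using MonoidAlgebra.induction_on with
    | of g => rw [augmentation_of_smul, smulHom_of, Preadditive.zsmul_comp, ht]
    | add x y hx hy =>
      rw [smulHom_add, Preadditive.comp_add, ← hx, ← hy, ← add_smul, ← map_add]
      congr 2
      exact add_smul x y m
    | smul r x hx =>
      rw [smulHom_zsmul, Preadditive.comp_zsmul, ← hx, smul_smul, ← smul_eq_mul, ← map_zsmul]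
      congr 2
      exact smul_assoc r x m
  have h : t ≫ augLift F A = homLift _ A fun j => l (basis _ j) := homObj_ext fun j => by
    rw [homLift_π, Category.assoc, augLift_π, Preadditive.comp_zsmul, Category.comp_id]
    rfl
  rw [h, evalHom_homLift l hl]
  rfl

section

variable [HasProductsOfShape H V]

/-- The morphism from the fixed points of `A` to `Hom(F₀, A)^H` given by the augmentation. -/
def fixedAugHom (A : Action V H) : (fixedPoints V H).obj A ⟶ homObj (F.complex.X 0) A :=
  fixedPointsι A ≫ augLift F A

lemma evalHom_comp_fixedAugHom {A : Action V H} {X : V} (t : X ⟶ (fixedPoints V H).obj A)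
    (m : F.complex.X 0) :
    evalHom (t ≫ fixedAugHom F A) m = F.augmentation m • t ≫ fixedPointsι A := by
  rw [fixedAugHom, ← Category.assoc]
  exact evalHom_augLift F (t ≫ fixedPointsι A)
    (fun g => by rw [Category.assoc, fixedPointsι_actHom]) m

lemma fixedAugHom_homMap (A : Action V H) :
    fixedAugHom F A ≫ homMap (F.complex.d 1 0) A = 0 :=
  homObj_ext_evalHom fun m => by
    rw [evalHom_comp_homMap, ← Category.id_comp (fixedAugHom F A), evalHom_comp_fixedAugHom,
      augmentation_d, zero_smul]
    simp [evalHom_apply]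

lemma fixedAugHom_naturality {A B : Action V H} (f : A ⟶ B) :
    (fixedPoints V H).map f ≫ fixedAugHom F B = fixedAugHom F A ≫ homPost _ f :=
  homObj_ext_evalHom fun m => by
    rw [evalHom_homPost, evalHom_comp_fixedAugHom, ← Category.id_comp (fixedAugHom F A),
      evalHom_comp_fixedAugHom, fixedPointsι_naturality, Preadditive.zsmul_comp, Category.id_comp]

instance (A : Action V H) : Mono (fixedAugHom F A) := by
  rw [Preadditive.mono_iff_cancel_zero]
  intro X t ht
  obtain ⟨m, hm⟩ := exists_augmentation_eq_one F
  have h := evalHom_comp_fixedAugHom F t m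
  rw [ht, hm, one_smul] at h
  rw [← cancel_mono (fixedPointsι A), ← h]
  simp [evalHom_apply]

/-- A linear map on `F₀` which vanishes on boundaries factors through `ε`, so it is `m ↦ ε(m) a`,
with `a` its value at some `m₀` of augmentation `1`. Since `g m₀` also has augmentation `1`, the
value `a` is fixed by `H`. -/
lemma exact_fixedAugHom (A : Action V H) :
    (ShortComplex.mk _ _ (fixedAugHom_homMap F A)).Exact := by
  have key {X : V} (f : X ⟶ homObj (F.complex.X 0) A) (hf : f ≫ homMap (F.complex.d 1 0) A = 0) :
    ∃ l, l ≫ fixedAugHom F A = f := by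
    obtain ⟨m₀, hm₀⟩ := exists_augmentation_eq_one F
    have h (m) : evalHom f m = F.augmentation m • evalHom f m₀ := by
      obtain ⟨m', hm'⟩ := exists_of_augmentation_eq_zero F
        (m := m - F.augmentation m • m₀) (by rw [map_sub, map_zsmul, hm₀]; simp)
      rw [← map_zsmul, ← sub_eq_zero, ← map_sub, ← hm', ← evalHom_comp_homMap, hf]
      simp [evalHom_apply]
    have h' (g : H) : evalHom f m₀ ≫ actHom A g = evalHom f m₀ := by
      rw [← smulHom_of, ← evalHom_smul, h, augmentation_of_smul, hm₀, one_smul]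
    refine ⟨fixedPointsLift A (evalHom f m₀) h', homObj_ext_evalHom fun m => ?_⟩
    rw [evalHom_comp_fixedAugHom, fixedPointsLift_ι, h m]
  exact ShortComplex.exact_of_f_is_kernel _
    (KernelFork.IsLimit.ofι' _ _ fun f hf => ⟨_, (key f hf).choose_spec⟩)

end

end Augmentation

/-! ### Contraction of a free resolution over the integers -/

section Contraction

/-- The map `h` takes its values in the range of `f`, and it lifts along the surjection to this
range because `B` is free over `ℤ`. -/
lemma exists_addMonoidHom_comp_eq {A B D : Type*} [AddCommGroup A] [AddCommGroup B] [AddCommGroup D]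
    [Module.Free ℤ B] (f : A →+ B) (g : B →+ D) (hfg : ∀ b, g b = 0 → ∃ a, f a = b)
    (h : B →+ B) (hh : ∀ b, g (h b) = 0) : ∃ s : B →+ A, ∀ b, f (s b) = h b := by
  let F : A →ₗ[ℤ] f.toIntLinearMap.range := f.toIntLinearMap.rangeRestrict
  have hF : Function.Surjective F := f.toIntLinearMap.surjective_rangeRestrict
  let k : B →ₗ[ℤ] f.toIntLinearMap.range :=
    h.toIntLinearMap.codRestrict _ (fun b => hfg _ (hh b))
  obtain ⟨s, hs⟩ := Module.projective_lifting_property F k hF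
  exact ⟨s.toAddMonoidHom, fun b => congrArg Subtype.val (LinearMap.congr_fun hs b)⟩

variable {H : Type v} [Group H] (F : FreeResolution H)

/-- The group ring is itself free over `ℤ`. -/
instance (M : ModuleCat.{v} (GroupRing H)) [Module.Free (GroupRing H) M] :
    Module.Free ℤ M := by
  have : IsScalarTower ℤ (GroupRing H) M := inferInstance
  exact Module.Free.trans (S := GroupRing H)

/-- A contracting homotopy of the augmented complex satisfies `d s = 1 - s d`, whence `d s d = d`.
Only the latter is retained: it makes `1 - s d` take values in the cycles, which gives the next
step. -/
lemma exists_contraction (n : ℕ) :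
    ∃ s : F.complex.X n →+ F.complex.X (n + 1), ∀ x : F.complex.X (n + 1),
      (F.complex.d (n + 1) n).hom (s ((F.complex.d (n + 1) n).hom x)) =
        (F.complex.d (n + 1) n).hom x := by
  induction n with
  | zero =>
    obtain ⟨m₀, hm₀⟩ := exists_augmentation_eq_one F
    obtain ⟨s, hs⟩ := exists_addMonoidHom_comp_eq (F.complex.d 1 0).hom.toAddMonoidHom
      F.augmentation (fun b hb => exists_of_augmentation_eq_zero F hb)
      (AddMonoidHom.id _ - ((zmultiplesHom _ m₀).comp F.augmentation)) (fun b => by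
        simp [hm₀])
    refine ⟨s, fun x => (hs _).trans ?_⟩
    simp [augmentation_d]
  | succ n ih =>
    obtain ⟨s, hs⟩ := ih
    obtain ⟨s', hs'⟩ := exists_addMonoidHom_comp_eq (F.complex.d (n + 2) (n + 1)).hom.toAddMonoidHom
      (F.complex.d (n + 1) n).hom.toAddMonoidHom (fun b hb => (F.exact_succ n b).1 hb)
      (AddMonoidHom.id _ - s.comp (F.complex.d (n + 1) n).hom.toAddMonoidHom) (fun b => by
        simp [hs])
    refine ⟨s', fun x => (hs' _).trans ?_⟩
    have : (F.complex.d (n + 1) n).hom ((F.complex.d (n + 2) (n + 1)).hom x) = 0 :=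
      (F.exact_succ n _).2 ⟨x, rfl⟩
    simp [this]

end Contraction

/-! ### Acyclicity of coinduced objects for `Hom(F_*, ·)^H` -/

section CoinducedExact

variable {V : Type*} [Category* V] [Abelian V] {H : Type v} [Group H]

lemma map_smul_of_map_actHom {M : Type*} [AddCommGroup M] [Module (GroupRing H) M]
    {A : Action V H} {X : V} (l : M →+ (X ⟶ A.V))
    (hl : ∀ (g : H) m, l (MonoidAlgebra.of ℤ H g • m) = l m ≫ actHom A g) (x : GroupRing H) (m : M) :
    l (x • m) = l m ≫ smulHom A x := by
  induction x using MonoidAlgebra.induction_on with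
  | of g => rw [smulHom_of, hl]
  | add x y hx hy => rw [smulHom_add, Preadditive.comp_add, ← hx, ← hy, add_smul, map_add]
  | smul r x hx => rw [smulHom_zsmul, Preadditive.comp_zsmul, ← hx, smul_assoc, map_zsmul]

variable (F : FreeResolution H) [HasProductsOfShape H V]

/-- Linear maps to a coinduced object correspond to additive maps to `B`, by evaluation at `1`. A
cocycle `f` is then the coboundary of `f ∘ s`, where `s` is a contraction which is additive but not
equivariant. -/
lemma exists_comp_homMap_eq (n : ℕ) {X B : V}
    (f : X ⟶ homObj (F.complex.X (n + 1)) ((coind V H).obj B))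
    (hf : f ≫ homMap (F.complex.d (n + 2) (n + 1)) _ = 0) :
    ∃ g : X ⟶ homObj (F.complex.X n) ((coind V H).obj B),
      g ≫ homMap (F.complex.d (n + 1) n) _ = f := by
  obtain ⟨s, hs⟩ := exists_contraction F n
  have hd (m) : evalHom f ((F.complex.d (n + 2) (n + 1)).hom m) = 0 := by
    rw [← evalHom_comp_homMap, hf]
    simp [evalHom_apply]
  -- The element `s (d m) - m` is a cycle, hence a boundary, and `f` vanishes on boundaries.
  have hsd (m) : evalHom f (s ((F.complex.d (n + 1) n).hom m)) = evalHom f m := by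
    obtain ⟨m', hm'⟩ := (F.exact_succ n (s ((F.complex.d (n + 1) n).hom m) - m)).1
      (by rw [map_sub, hs, sub_self])
    rw [← sub_eq_zero, ← map_sub, ← hm', hd]
  let μ : F.complex.X n →+ (X ⟶ B) :=
    (Preadditive.rightComp X (coindπ B 1)).comp ((evalHom f).comp s)
  -- The linear map which corresponds to `μ` has component `m ↦ μ(h m)` at `h`.
  let l : F.complex.X n →+ (X ⟶ ((coind V H).obj B).V) :=
    AddMonoidHom.mk' (fun m => coindLift fun h => μ (MonoidAlgebra.of ℤ H h • m)) (fun a b =>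
      coind_hom_ext fun h => by
        rw [Preadditive.add_comp, coindLift_π, coindLift_π, coindLift_π, smul_add, map_add])
  have hlπ (m) (h : H) : l m ≫ coindπ B h = μ (MonoidAlgebra.of ℤ H h • m) := coindLift_π _ _
  have hl := map_smul_of_map_actHom l (fun g m => coind_hom_ext fun h => by
    rw [Category.assoc, coind_actHom_π, hlπ, hlπ, smul_smul, ← map_mul])
  refine ⟨homLift _ _ fun j => l (basis _ j), homObj_ext_evalHom fun m => coind_hom_ext fun h => ?_⟩
  rw [evalHom_comp_homMap, evalHom_homLift l hl, hlπ, ← map_smul]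
  change evalHom f (s _) ≫ coindπ B 1 = _
  rw [hsd, evalHom_smul, smulHom_of, Category.assoc, coind_actHom_π, one_mul]

lemma exactAt_homComplex_coind (B : V) (n : ℤ) (hn : 0 < n) :
    ((homComplex F).obj ((coind V H).obj B)).ExactAt n := by
  obtain ⟨k, rfl⟩ : ∃ k : ℕ, n = (k + 1 : ℕ) := ⟨(n - 1).toNat, by omega⟩
  refine (HomologicalComplex.extend_exactAt_iff _ ComplexShape.embeddingUpNat (j := k + 1) rfl).2 ?_
  rw [HomologicalComplex.exactAt_iff' _ k (k + 1) (k + 2) (by simp) (by simp),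
    ShortComplex.exact_iff_exact_up_to_refinements]
  intro X f hf
  obtain ⟨g, hg⟩ := exists_comp_homMap_eq F k f hf
  exact ⟨X, 𝟙 X, inferInstance, g, (Category.id_comp _).trans hg.symm⟩

end CoinducedExact

/-! ### The comparison of `K^H` with `Tot Hom(F_*, K)^H` -/

section FixedHomAug

variable {V : Type*} [Category* V] [Abelian V] {H : Type v} [Group H]
  (F : FreeResolution H) [HasProductsOfShape H V]

/-- The morphism `fixedAugHom`, viewed as a morphism to the term of degree zero of `homComplex`. -/
def fixedAugHomX (A : Action V H) : (fixedPoints V H).obj A ⟶ ((homComplex F).obj A).X 0 :=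
  fixedAugHom F A ≫ (homComplexXIso F A 0 0 rfl).inv

lemma fixedAugHomX_d (A : Action V H) : fixedAugHomX F A ≫ ((homComplex F).obj A).d 0 1 = 0 := by
  rw [fixedAugHomX, homComplex_d F A 0 1 0 1 rfl rfl, Category.assoc, Iso.inv_hom_id_assoc,
    ← Category.assoc, fixedAugHom_homMap, zero_comp]

lemma fixedAugHomX_naturality {A B : Action V H} (f : A ⟶ B) :
    (fixedPoints V H).map f ≫ fixedAugHomX F B =
      fixedAugHomX F A ≫ ((homComplex F).map f).f 0 := by
  rw [fixedAugHomX, ← Category.assoc, fixedAugHom_naturality, fixedAugHomX, Category.assoc,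
    Category.assoc, homComplex_map_f F f 0 0 rfl, Iso.inv_hom_id_assoc]

instance (A : Action V H) : Mono (fixedAugHomX F A) := mono_comp _ _

lemma exact_fixedAugHomX (A : Action V H) :
    (ShortComplex.mk _ _ (fixedAugHomX_d F A)).Exact :=
  (ShortComplex.exact_iff_of_iso (ShortComplex.isoMk (S₁ := ShortComplex.mk _ _ (fixedAugHomX_d F A))
    (S₂ := ShortComplex.mk _ _ (fixedAugHom_homMap F A)) (Iso.refl _) (homComplexXIso F A 0 0 rfl)
    (homComplexXIso F A 1 1 rfl) (by simp [fixedAugHomX])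
      (by simp [homComplex_d F A 0 1 0 1 rfl rfl]))).2 (exact_fixedAugHom F A)

/-- The augmentation of `Hom(F_*, A)^H` by the fixed points of `A`. -/
def homComplexAug : fixedPoints V H ⋙ CochainComplex.singleFunctor V 0 ⟶ homComplex F :=
  augOfX (fixedAugHomX F) (fixedAugHomX_d F) (fixedAugHomX_naturality F)

lemma augX_homComplexAug (A : Action V H) : augX (homComplexAug F) A = fixedAugHomX F A :=
  augX_augOfX (M := homComplex F) (G := fixedPoints V H) (fixedAugHomX F) (fixedAugHomX_d F)
    (fixedAugHomX_naturality F) A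

lemma quasiIso_homComplexAug_coind (B : V) :
    QuasiIso ((homComplexAug F).app ((coind V H).obj B)) := by
  have : Mono (augX (homComplexAug F) ((coind V H).obj B)) := by
    rw [augX_homComplexAug]
    infer_instance
  refine quasiIso_augmentation (homComplexAug F) _ ?_ (exactAt_homComplex_coind F B)
  convert exact_fixedAugHomX F ((coind V H).obj B) using 2
  exact augX_homComplexAug F _

/-- By naturality, a retraction of `A` from a coinduced object makes the augmentation of `A` a
retract of the one of the coinduced object. -/
lemma quasiIso_homComplexAug {A : Action V H} (hA : IsRelativelyInjective A) :
    QuasiIso ((homComplexAug F).app A) := by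
  obtain ⟨r, hr⟩ := hA
  rw [← HomologicalComplex.mem_quasiIso_iff]
  refine MorphismProperty.of_retract (P := HomologicalComplex.quasiIso _ _)
    (g := (homComplexAug F).app ((coind V H).obj A.V)) ?_ (quasiIso_homComplexAug_coind F A.V)
  exact
    { i := Arrow.homMk ((fixedPoints V H ⋙ CochainComplex.singleFunctor V 0).map (coindUnitApp A))
        ((homComplex F).map (coindUnitApp A)) ((homComplexAug F).naturality _)
      r := Arrow.homMk ((fixedPoints V H ⋙ CochainComplex.singleFunctor V 0).map r)
        ((homComplex F).map r) ((homComplexAug F).naturality _)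
      retract := by
        ext : 1
        · exact ((fixedPoints V H ⋙ CochainComplex.singleFunctor V 0).map_comp _ _).symm.trans
            ((congrArg _ hr).trans (CategoryTheory.Functor.map_id _ _))
        · exact ((homComplex F).map_comp _ _).symm.trans
            ((congrArg _ hr).trans (CategoryTheory.Functor.map_id _ _)) }

/-- The morphism from the fixed points `K^H` to the total complex of `Hom(F_q, K^p)^H`. -/
def fixedToTotal : (fixedPoints V H).mapCochainComplexPlus ⟶ homTotal F :=
  augTotal (homComplexAug F)

lemma quasiIso_fixedToTotal_app (K : CochainComplex.Plus (Action V H))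
    (hK : ∀ n, IsRelativelyInjective (K.obj.X n)) :
    CochainComplex.Plus.quasiIso V ((fixedToTotal F).app K) :=
  quasiIso_augTotal_app (homComplexAug F) K fun n => quasiIso_homComplexAug F (hK n)

end FixedHomAug

/-! ### Homotopies between total complexes -/

section TotalHomotopy

variable {E V : Type*} [Category* E] [Abelian E] [Category* V] [Abelian V]
  {M M' : E ⥤ CochainComplex V ℤ}

/-- A homotopy between natural transformations between functors to cochain complexes. -/
structure NatHomotopy (τ τ' : M ⟶ M') where
  homotopy (A : E) : Homotopy (τ.app A) (τ'.app A)
  naturality {A B : E} (f : A ⟶ B) (i j : ℤ) :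
    (M.map f).f i ≫ (homotopy B).hom i j = (homotopy A).hom i j ≫ (M'.map f).f j

variable [M.Additive] [IsNonnegative M] [M'.Additive] [IsNonnegative M'] {τ τ' : M ⟶ M'}
  (s : NatHomotopy τ τ')

lemma NatHomotopy.comm (A : E) (i j k : ℤ) (hij : i + 1 = j) (hjk : j + 1 = k) :
    (τ.app A).f j = (M.obj A).d j k ≫ (s.homotopy A).hom k j +
      (s.homotopy A).hom j i ≫ (M'.obj A).d i j + (τ'.app A).f j := by
  rw [(s.homotopy A).comm j, dNext_eq _ (show (ComplexShape.up ℤ).Rel j k from hjk),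
    prevD_eq _ (show (ComplexShape.up ℤ).Rel i j from hij)]

/-- The components of `NatHomotopy.total`. -/
def NatHomotopy.totalX (K : CochainComplex.Plus E) (n m : ℤ) (h : m + 1 = n) :
    ((totalPlus M).obj K).obj.X n ⟶ ((totalPlus M').obj K).obj.X m :=
  totDesc ((bicomplex M).obj K.obj) fun p q hpq =>
    (p.negOnePow : ℤ) • ((s.homotopy (K.obj.X p)).hom q (q - 1) ≫
      totalPlusι M' K p (q - 1) m (by omega))

lemma NatHomotopy.totalPlusι_totalX (K : CochainComplex.Plus E) (p q n q' m : ℤ) (hpq : p + q = n)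
    (hq : q' + 1 = q) (h : m + 1 = n) :
    totalPlusι M K p q n hpq ≫ s.totalX K n m h =
      (p.negOnePow : ℤ) • ((s.homotopy (K.obj.X p)).hom q q' ≫
        totalPlusι M' K p q' m (by omega)) := by
  obtain rfl : q' = q - 1 := by omega
  exact totι_totDesc ((bicomplex M).obj K.obj) _ p q hpq

/-- The sign `(-1)^p` in the homotopy cancels the one of the vertical differential. It also gives
opposite signs to the two terms with a horizontal differential, which agree by naturality of the
homotopy and so cancel. -/
lemma NatHomotopy.totalX_comm (K : CochainComplex.Plus E) (i j k : ℤ) (hij : i + 1 = j)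
    (hjk : j + 1 = k) :
    ((totalPlusNatTrans τ).app K).hom.f j =
      ((totalPlus M).obj K).obj.d j k ≫ s.totalX K k j hjk +
        s.totalX K j i hij ≫ ((totalPlus M').obj K).obj.d i j +
        ((totalPlusNatTrans τ').app K).hom.f j := by
  refine totalPlus_hom_ext fun p q h => ?_
  have h₁ : ((p + 1).negOnePow : ℤ) = - (p.negOnePow : ℤ) := by simp [Int.negOnePow_succ]
  have h₂ : (p.negOnePow : ℤ) * (p.negOnePow : ℤ) = 1 := Int.units_coe_mul_self _
  rw [Preadditive.comp_add, Preadditive.comp_add, totalPlusι_natTrans_app, totalPlusι_natTrans_app,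
    s.comm _ (q - 1) q (q + 1) (by omega) rfl, Preadditive.add_comp]
  congr 1
  rw [← Category.assoc (totalPlusι M K p q j h), ← Category.assoc (totalPlusι M K p q j h),
    totalPlusι_d M K p q j (p + 1) (q + 1) k h rfl rfl hjk,
    s.totalPlusι_totalX K p q j (q - 1) i h (by omega) hij, Preadditive.add_comp,
    Preadditive.add_comp, Category.assoc ((M.map _).f q),
    s.totalPlusι_totalX K (p + 1) q k (q - 1) j (by omega) (by omega) hjk,
    Preadditive.zsmul_comp, Category.assoc ((M.obj _).d q _) (totalPlusι _ _ _ _ _ _),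
    s.totalPlusι_totalX K p (q + 1) k q j (by omega) (by omega) hjk, Preadditive.zsmul_comp,
    Category.assoc, Category.assoc, Category.assoc,
    totalPlusι_d M' K p (q - 1) i (p + 1) q j (by omega) rfl (by omega) hij,
    Preadditive.comp_add, Preadditive.comp_zsmul, smul_add, Preadditive.comp_zsmul,
    Preadditive.comp_zsmul, smul_smul, smul_smul, h₁, h₂, one_smul, one_smul, neg_smul,
    ← Category.assoc ((M.map _).f q), s.naturality, Category.assoc]
  abel

/-- The homotopy between morphisms of total complexes given by a natural homotopy. -/
def NatHomotopy.total (K : CochainComplex.Plus E) :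
    Homotopy ((totalPlusNatTrans τ).app K).hom ((totalPlusNatTrans τ').app K).hom where
  hom n m := if h : m + 1 = n then s.totalX K n m h else 0
  zero n m h := dif_neg h
  comm j := by
    rw [dNext_eq _ (show (ComplexShape.up ℤ).Rel j (j + 1) from rfl),
      prevD_eq _ (show (ComplexShape.up ℤ).Rel (j - 1) j from by simp), dif_pos rfl,
      dif_pos (by omega)]
    exact s.totalX_comm K (j - 1) j (j + 1) (by omega) rfl

lemma plusQ_map_eq_of_homotopy [HasDerivedCategory V] {K L : CochainComplex.Plus V} {f g : K ⟶ L}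
    (h : Homotopy f.hom g.hom) : DerivedCategory.Plus.Q.map f = DerivedCategory.Plus.Q.map g := by
  have : (HomotopyCategory.Plus.quotient V).map f = (HomotopyCategory.Plus.quotient V).map g := by
    ext : 1
    exact HomotopyCategory.eq_of_homotopy _ _ h
  exact congrArg DerivedCategory.Plus.Qh.map this

end TotalHomotopy

/-! ### Homotopies between morphisms of resolutions -/

section ResolutionHomotopy

variable {V : Type*} [Category* V] [Abelian V] {H : Type v} [Group H]

lemma homMap_add {M N : ModuleCat.{v} (GroupRing H)} [Module.Free (GroupRing H) M]
    [Module.Finite (GroupRing H) M] [Module.Free (GroupRing H) N] [Module.Finite (GroupRing H) N]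
    (f g : M ⟶ N) (A : Action V H) : homMap (f + g) A = homMap f A + homMap g A :=
  homObj_ext fun j => by
    rw [Preadditive.add_comp, homMap_π, homMap_π, homMap_π, ← Finset.sum_add_distrib]
    refine Finset.sum_congr rfl fun k _ => ?_
    rw [ModuleCat.hom_add, LinearMap.add_apply, map_add, Finsupp.add_apply, smulHom_add,
      Preadditive.comp_add]

variable {F F' : FreeResolution H} {φ φ' : F.Hom F'}

/-- The components of `homComplexNatHomotopy`. -/
def homComplexNatHomotopyHom (h : Homotopy φ.hom φ'.hom) (A : Action V H) (i j : ℕ) :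
    ((homComplexNat F').obj A).X i ⟶ ((homComplexNat F).obj A).X j :=
  homMap (h.hom j i) A

/-- The homotopy between morphisms `Hom(F'_*, A)^H ⟶ Hom(F_*, A)^H` given by a homotopy. -/
def homComplexNatHomotopy (h : Homotopy φ.hom φ'.hom) (A : Action V H) :
    Homotopy ((homComplexNatMap φ).app A) ((homComplexNatMap φ').app A) where
  hom i j := homComplexNatHomotopyHom h A i j
  zero i j hij := by
    rw [homComplexNatHomotopyHom, h.zero _ _ hij]
    exact homMap_zero A
  comm j := by
    have hj := h.comm j
    -- For `j = 0` the subtraction is truncated, and the formula still holds because `F.complex.d 0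
    -- 0` is zero.
    have h₁ : dNext j h.hom = F.complex.d j (j - 1) ≫ h.hom (j - 1) j := dNext_nat _ _ _ _
    rw [prevD_eq _ (show (ComplexShape.down ℕ).Rel (j + 1) j from rfl), h₁] at hj
    refine (congrArg (fun f => homMap f A) hj).trans ?_
    -- Contravariance exchanges the two terms of the homotopy relation.
    rw [homMap_add, homMap_add, homMap_comp, homMap_comp, add_comm (_ ≫ _),
      dNext_eq _ (show (ComplexShape.up ℕ).Rel j (j + 1) from rfl), prevD_nat]
    rfl

/-- The natural homotopy between morphisms of complexes `homComplex` given by a homotopy. -/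
def homComplexHomotopy (h : Homotopy φ.hom φ'.hom) :
    NatHomotopy (homComplexMap (V := V) φ) (homComplexMap φ') where
  homotopy A := (homComplexNatHomotopy h A).extend ComplexShape.embeddingUpNat
  naturality {A B} f i j := by
    by_cases hi : i < 0
    · exact (IsNonnegative.isZero (M := homComplex F') A i hi).eq_of_src _ _
    by_cases hj : j < 0
    · exact (IsNonnegative.isZero (M := homComplex F) B j hj).eq_of_tgt _ _
    obtain ⟨n, rfl⟩ := Int.eq_ofNat_of_zero_le (not_lt.1 hi)
    obtain ⟨m, rfl⟩ := Int.eq_ofNat_of_zero_le (not_lt.1 hj)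
    have h₁ (A : Action V H) : ((homComplexNatHomotopy h A).extend
      ComplexShape.embeddingUpNat).hom n m = (homComplexXIso F' A n n rfl).hom ≫
        homMap (h.hom m n) A ≫ (homComplexXIso F A m m rfl).inv :=
      Homotopy.extend_hom_eq _ _ _ _
    rw [h₁, h₁, homComplex_map_f F' f n n rfl, homComplex_map_f F f m m rfl]
    simp only [Category.assoc, Iso.inv_hom_id_assoc]
    rw [← Category.assoc (homPost _ _), ← homMap_naturality, Category.assoc]

end ResolutionHomotopy

/-! ### Comparison of two free resolutions -/

section Comparison

variable {H : Type v} [Group H] (F F' : FreeResolution H)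

/-- The trivial module `ℤ`, in the universe of the group. -/
abbrev trivialModule (H : Type v) [Group H] : ModuleCat.{v} (GroupRing H) :=
  ModuleCat.of _ (ULift.{v} (Representation.trivial ℤ H ℤ).asModule)

/-- The augmentation of a resolution, as a morphism of modules. -/
def FreeResolution.εHom : F.complex.X 0 ⟶ trivialModule H :=
  ModuleCat.ofHom (ULift.moduleEquiv.symm.toLinearMap ∘ₗ F.ε)

lemma d_εHom : F.complex.d 1 0 ≫ F.εHom = 0 := by
  ext x
  exact ((F.exact_zero _).2 ⟨x, rfl⟩)

lemma exact_εHom : (ShortComplex.mk _ _ (d_εHom F)).Exact :=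
  (ShortComplex.moduleCat_exact_iff _).2 fun x hx =>
    (F.exact_zero x).1 (congrArg ULift.down hx)

instance : Epi F.εHom := (ModuleCat.epi_iff_surjective _).2 fun ⟨x⟩ => by
  obtain ⟨y, hy⟩ := F.surjective_ε x
  exact ⟨y, congrArg ULift.up hy⟩

lemma exactAt_complex_succ (n : ℕ) : F.complex.ExactAt (n + 1) := by
  rw [HomologicalComplex.exactAt_iff' _ (n + 2) (n + 1) n (by simp) (by simp),
    ShortComplex.moduleCat_exact_iff]
  exact fun x hx => (F.exact_succ n x).1 hx

/-- A resolution by free modules is a projective resolution. -/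
def FreeResolution.projectiveResolution : ProjectiveResolution (trivialModule H) where
  complex := F.complex
  projective n := ModuleCat.projective_of_free (basis (F.complex.X n))
  π := (ChainComplex.toSingle₀Equiv _ _).symm ⟨F.εHom, d_εHom F⟩
  quasiIso := ⟨fun n => by
    cases n
    · rw [ChainComplex.quasiIsoAt₀_iff, ShortComplex.quasiIso_iff_of_zeros']
      · exact (ShortComplex.exact_and_epi_g_iff_of_iso (ShortComplex.isoMk
          (S₂ := ShortComplex.mk _ _ (d_εHom F)) (Iso.refl _) (Iso.refl _) (Iso.refl _)
          (by simp) (by simp))).2 ⟨exact_εHom F, inferInstance⟩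
      · exact F.complex.shape 0 0 (by simp)
      · rfl
      · rfl
    · rw [quasiIsoAt_iff_exactAt']
      · exact exactAt_complex_succ F _
      · exact ChainComplex.exactAt_succ_single_obj _ _⟩

lemma projectiveResolution_π_f_zero : F.projectiveResolution.π.f 0 = F.εHom :=
  ChainComplex.toSingle₀Equiv_symm_apply_f_zero _ _

/-- There are morphisms between any two resolutions. -/
def FreeResolution.homOf (F F' : FreeResolution H) : F.Hom F' where
  hom := ProjectiveResolution.lift (𝟙 _) F.projectiveResolution F'.projectiveResolution
  comm x := by
    have h := ProjectiveResolution.lift_commutes_zero (𝟙 _) F.projectiveResolution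
      F'.projectiveResolution
    rw [projectiveResolution_π_f_zero, projectiveResolution_π_f_zero] at h
    exact congrArg ULift.down (ConcreteCategory.congr_hom h x)

variable {F F'} in
lemma FreeResolution.Hom.comp_π (φ : F.Hom F') :
    φ.hom ≫ F'.projectiveResolution.π = F.projectiveResolution.π := by
  refine (ChainComplex.toSingle₀Equiv _ _).injective (Subtype.ext ?_)
  change φ.hom.f 0 ≫ F'.projectiveResolution.π.f 0 = F.projectiveResolution.π.f 0
  rw [projectiveResolution_π_f_zero, projectiveResolution_π_f_zero]
  exact ModuleCat.hom_ext (LinearMap.ext fun x => congrArg ULift.up (φ.comm x))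

variable {F F'} in
/-- Any two morphisms between two resolutions are homotopic. -/
def FreeResolution.Hom.homotopy (φ φ' : F.Hom F') : Homotopy φ.hom φ'.hom :=
  have h : F.projectiveResolution.π = F.projectiveResolution.π ≫
      (ChainComplex.single₀ _).map (𝟙 (trivialModule H)) := by simp
  ProjectiveResolution.liftHomotopy (P := F.projectiveResolution) (Q := F'.projectiveResolution)
    (𝟙 _) φ.hom φ'.hom (φ.comp_π.trans h) (φ'.comp_π.trans h)

variable {V : Type*} [Category* V] [Abelian V] [HasDerivedCategory V]

-- Morphisms of resolutions over the identity of `ℤ` are homotopic, so their effect in the derived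
-- category is independent of choices. All compatibilities with resolutions in (a) rest on this.
variable {F F'} in
lemma plusQ_map_homTotalMap (φ φ' : F.Hom F') (K : CochainComplex.Plus (Action V H)) :
    DerivedCategory.Plus.Q.map ((homTotalMap φ).app K) =
      DerivedCategory.Plus.Q.map ((homTotalMap φ').app K) :=
  plusQ_map_eq_of_homotopy ((homComplexHomotopy (φ.homotopy φ')).total K)

end Comparison

/-! ### Compatibility of `Hom(F_*, ·)^H` with exact functors -/

section ExactComparison

variable {V W : Type*} [Category* V] [Abelian V] [Category* W] [Abelian W] {H : Type v} [Group H]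
  (G : V ⥤ W) [G.Additive]

lemma smulHom_mapAction (A : Action V H) (x : GroupRing H) :
    smulHom ((G.mapAction H).obj A) x = G.map (smulHom A x) := by
  induction x using MonoidAlgebra.induction_on with
  | of g =>
    rw [smulHom_of, smulHom_of]
    rfl
  | add x y hx hy => rw [smulHom_add, smulHom_add, hx, hy, G.map_add]; rfl
  | smul r x hx => rw [smulHom_zsmul, smulHom_zsmul, hx, G.map_zsmul]; rfl

section

variable (M : ModuleCat.{v} (GroupRing H)) [Module.Free (GroupRing H) M]
  [Module.Finite (GroupRing H) M]

/-- The comparison between `G(Hom(M, A)^H)` and `Hom(M, G(A))^H`. -/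
def homObjComparison (A : Action V H) :
    G.obj (homObj M A) ⟶ homObj M ((G.mapAction H).obj A) :=
  homLift _ _ fun j => G.map (homπ M A j)

lemma homObjComparison_π (A : Action V H) (j : BasisIndex M) :
    homObjComparison G M A ≫ homπ M ((G.mapAction H).obj A) j = G.map (homπ M A j) :=
  homLift_π _ _ _ _

/-- The basis of `M` is finite, so only finite products have to be preserved. -/
instance [PreservesFiniteLimits G] (A : Action V H) : IsIso (homObjComparison G M A) :=
  have : PreservesFiniteProducts G := inferInstance
  inferInstanceAs (IsIso (piComparison G fun _ : BasisIndex M => A.V))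

lemma homObjComparison_homPost {A B : Action V H} (f : A ⟶ B) :
    homObjComparison G M A ≫ homPost M ((G.mapAction H).map f) =
      G.map (homPost M f) ≫ homObjComparison G M B :=
  homObj_ext fun j => by
    have h : G.map (homPost M f) ≫ G.map (homπ M B j) = G.map (homπ M A j) ≫ G.map f.hom := by
      rw [← G.map_comp, homPost_π, G.map_comp]
    rw [Category.assoc, Category.assoc, homObjComparison_π, homPost_π, ← Category.assoc,
      homObjComparison_π]
    exact h.symm

variable {M} in
lemma homObjComparison_homMap {N : ModuleCat.{v} (GroupRing H)} [Module.Free (GroupRing H) N]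
    [Module.Finite (GroupRing H) N] (f : M ⟶ N) (A : Action V H) :
    homObjComparison G N A ≫ homMap f ((G.mapAction H).obj A) =
      G.map (homMap f A) ≫ homObjComparison G M A :=
  homObj_ext fun j => by
    have h : G.map (homMap f A) ≫ G.map (homπ M A j) = ∑ k, G.map (homπ N A k) ≫
        G.map (smulHom A ((basis N).repr (f.hom (basis M j)) k)) := by
      rw [← G.map_comp, homMap_π, G.map_sum]
      exact Finset.sum_congr rfl fun k _ => G.map_comp _ _
    rw [Category.assoc, Category.assoc, homObjComparison_π, homMap_π, Preadditive.comp_sum]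
    refine Eq.trans (Finset.sum_congr rfl fun k _ => ?_) h.symm
    rw [← Category.assoc, homObjComparison_π, smulHom_mapAction]
    rfl

end

variable [PreservesFiniteLimits G] (F : FreeResolution H)

/-- The components of `homComplexComparison`. -/
def homComplexComparisonX (A : Action V H) :
    ∀ q : ℤ, G.obj (((homComplex F).obj A).X q) ≅
      ((homComplex F).obj ((G.mapAction H).obj A)).X q
  | Int.ofNat n => G.mapIso (homComplexXIso F A n n rfl) ≪≫
      asIso (homObjComparison G (F.complex.X n) A) ≪≫
      (homComplexXIso F ((G.mapAction H).obj A) n n rfl).symm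
  | Int.negSucc n => (G.map_isZero (IsNonnegative.isZero (M := homComplex F) A _
      (Int.negSucc_lt_zero n))).iso (IsNonnegative.isZero (M := homComplex F) _ _
        (Int.negSucc_lt_zero n))

lemma homComplexComparisonX_hom (A : Action V H) (n : ℕ) :
    (homComplexComparisonX G F A n).hom = G.map (homComplexXIso F A n n rfl).hom ≫
      homObjComparison G (F.complex.X n) A ≫
      (homComplexXIso F ((G.mapAction H).obj A) n n rfl).inv := rfl

lemma homComplexComparisonX_d (A : Action V H) (q q' : ℤ) (h : q + 1 = q') :
    (homComplexComparisonX G F A q).hom ≫ ((homComplex F).obj ((G.mapAction H).obj A)).d q q' =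
      G.map (((homComplex F).obj A).d q q') ≫ (homComplexComparisonX G F A q').hom := by
  by_cases hq : q < 0
  · exact (G.map_isZero (IsNonnegative.isZero (M := homComplex F) A q hq)).eq_of_src _ _
  · obtain ⟨n, rfl⟩ := Int.eq_ofNat_of_zero_le (not_lt.1 hq)
    obtain rfl : q' = (n + 1 : ℕ) := h.symm
    rw [homComplexComparisonX_hom, homComplexComparisonX_hom,
      homComplex_d F _ n (n + 1) n (n + 1 : ℕ) rfl rfl,
      homComplex_d F _ n (n + 1) n (n + 1 : ℕ) rfl rfl, G.map_comp, G.map_comp]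
    simp only [Category.assoc, Iso.inv_hom_id_assoc]
    rw [← Category.assoc (homObjComparison _ _ _), homObjComparison_homMap,
      ← Category.assoc (G.map (homComplexXIso F A (n + 1) _ rfl).inv), ← G.map_comp,
      Iso.inv_hom_id, G.map_id, Category.id_comp, Category.assoc]

lemma homComplexComparisonX_naturality {A B : Action V H} (f : A ⟶ B) (q : ℤ) :
    G.map (((homComplex F).map f).f q) ≫ (homComplexComparisonX G F B q).hom =
      (homComplexComparisonX G F A q).hom ≫ ((homComplex F).map ((G.mapAction H).map f)).f q := by
  by_cases hq : q < 0
  · exact (G.map_isZero (IsNonnegative.isZero (M := homComplex F) A q hq)).eq_of_src _ _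
  · obtain ⟨n, rfl⟩ := Int.eq_ofNat_of_zero_le (not_lt.1 hq)
    rw [homComplexComparisonX_hom, homComplexComparisonX_hom, homComplex_map_f F _ n n rfl,
      homComplex_map_f F _ n n rfl, G.map_comp, G.map_comp]
    simp only [Category.assoc, Iso.inv_hom_id_assoc]
    rw [← Category.assoc (G.map (homComplexXIso F B n _ rfl).inv), ← G.map_comp,
      Iso.inv_hom_id, G.map_id, Category.id_comp, ← Category.assoc (homObjComparison _ _ _),
      homObjComparison_homPost, Category.assoc]

/-- The isomorphism `G(Hom(F_*, A)^H) ≅ Hom(F_*, G(A))^H`, for an additive functor `G` which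
preserves finite products. -/
def homComplexComparison :
    compMap (homComplex F) G ≅ G.mapAction H ⋙ homComplex F :=
  NatIso.ofComponents (fun A => HomologicalComplex.Hom.isoOfComponents
    (homComplexComparisonX G F A) (fun q q' h => homComplexComparisonX_d G F A q q' h))
    (fun {A B} f => by
      ext q
      exact homComplexComparisonX_naturality G F f q)

end ExactComparison

section HomTotalComparison

variable {V W : Type*} [Category* V] [Abelian V] [Category* W] [Abelian W] {H : Type v} [Group H]
  (G : V ⥤ W) [G.Additive] [PreservesFiniteLimits G] (F : FreeResolution H)

instance : IsNonnegative (G.mapAction H ⋙ homComplex F) where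
  isZero _ _ hq := IsNonnegative.isZero (M := homComplex F) _ _ hq

/-- The comparison, for an exact functor `G`, between the image by `G` of the total complex of
`Hom(F_q, K^p)^H` and the total complex of `Hom(F_q, G(K^p))^H`. -/
def homTotalComparison : homTotal F ⋙ G.mapCochainComplexPlus ⟶
    (G.mapAction H).mapCochainComplexPlus ⋙ homTotal F :=
  (totalPlusComparison (homComplex F) G).inv ≫ totalPlusNatTrans (homComplexComparison G F).hom

lemma homTotalComparison_app (K : CochainComplex.Plus (Action V H)) :
    (homTotalComparison G F).app K = (totalPlusComparison (homComplex F) G).inv.app K ≫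
      (totalPlusNatTrans (homComplexComparison G F).hom).app K := rfl

lemma quasiIso_homTotalComparison_app (K : CochainComplex.Plus (Action V H)) :
    CochainComplex.Plus.quasiIso W ((homTotalComparison G F).app K) := by
  rw [homTotalComparison_app]
  refine MorphismProperty.comp_mem _ _ _ ?_ (quasiIso_totalPlusNatTrans_app _ K fun n => ?_)
  · have : QuasiIso ((CochainComplex.Plus.ι W).map
      ((totalPlusComparison (homComplex F) G).inv.app K)) := inferInstance
    exact this
  · infer_instance

/-- The components of `homTotalComparison`. -/
def homTotalComparisonX (K : CochainComplex.Plus (Action V H)) (n : ℤ) :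
    G.obj (((homTotal F).obj K).obj.X n) ⟶
      ((homTotal F).obj ((G.mapAction H).mapCochainComplexPlus.obj K)).obj.X n :=
  ((homTotalComparison G F).app K).hom.f n

lemma map_homTotalι_homTotalComparisonX (K : CochainComplex.Plus (Action V H)) (p q n : ℤ)
    (h : p + q = n) :
    G.map (homTotalι F K p q n h) ≫ homTotalComparisonX G F K n =
      (homComplexComparisonX G F (K.obj.X p) q).hom ≫
        homTotalι F ((G.mapAction H).mapCochainComplexPlus.obj K) p q n h := by
  have h₁ : totalPlusComparisonX (homComplex F) G K n ≫
      ((totalPlusComparison (homComplex F) G).inv.app K).hom.f n = 𝟙 _ :=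
    congrArg (fun f => f.hom.f n) ((totalPlusComparison (homComplex F) G).hom_inv_id_app K)
  have h₂ : homTotalComparisonX G F K n =
    ((totalPlusComparison (homComplex F) G).inv.app K).hom.f n ≫
      ((totalPlusNatTrans (homComplexComparison G F).hom).app K).hom.f n := rfl
  have h₃ := totalPlusι_natTrans_app (homComplexComparison G F).hom K p q n h
  have h₄ := compMapι_totalPlusComparisonX (homComplex F) G K p q n h
  have h₅ : G.map (homTotalι F K p q n h) ≫
      ((totalPlusComparison (homComplex F) G).inv.app K).hom.f n =
      compMapι (homComplex F) G K p q n h :=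
    (h₄.symm =≫ _).trans ((Category.assoc _ _ _).trans ((_ ≫= h₁).trans (Category.comp_id _)))
  exact (_ ≫= h₂).trans ((Category.assoc _ _ _).symm.trans ((h₅ =≫ _).trans h₃))

end HomTotalComparison

/-! ### Compatibility of the augmentations with resolutions and with pro-objects -/

section FixedComparison

variable {V : Type*} [Category* V] [Abelian V] {H : Type v} [Group H] [HasProductsOfShape H V]

lemma fixedAugHom_homMap_hom {F F' : FreeResolution H} (φ : F.Hom F') (A : Action V H) :
    fixedAugHom F' A ≫ homMap (φ.hom.f 0) A = fixedAugHom F A :=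
  homObj_ext_evalHom fun m => by
    rw [evalHom_comp_homMap, ← Category.id_comp (fixedAugHom F' A), evalHom_comp_fixedAugHom,
      ← Category.id_comp (fixedAugHom F A), evalHom_comp_fixedAugHom]
    congr 1
    exact congrArg (Representation.trivial ℤ H ℤ).asModuleEquiv (φ.comm m)

end FixedComparison

section ProComparison

variable {C : Type u} [Category.{v} C] [Abelian C] {H : Type v} [Group H]

/-- The augmentation used for the lift has its target in the image of `C`; the other one is formed
directly in `Pro C`. The two agree under the comparison isomorphism. -/
lemma fixedAug_homObjComparison (F : FreeResolution H) (A : Action C H) :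
    fixedAug F A ≫ homObjComparison (proEmbedding C) (F.complex.X 0) A =
      fixedAugHom F ((proAction C H).obj A) :=
  homObj_ext fun j => by
    rw [Category.assoc, homObjComparison_π, fixedAugHom, Category.assoc, augLift_π, fixedAug]
    have h : augHom F A ≫ homπ _ A j = F.augmentation (basis _ j) • 𝟙 A.V := homLift_π _ _ _ _
    have h' : (proEmbedding C).map (augHom F A) ≫ (proEmbedding C).map (homπ _ A j) =
        F.augmentation (basis _ j) • 𝟙 _ := by
      rw [← Functor.map_comp, h, Functor.map_zsmul, CategoryTheory.Functor.map_id]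
    exact (Category.assoc _ _ _).trans (_ ≫= h')

lemma fixedAug_map_homMap {F F' : FreeResolution H} (φ : F.Hom F') (A : Action C H) :
    fixedAug F' A ≫ (proEmbedding C).map (homMap (φ.hom.f 0) A) = fixedAug F A := by
  rw [← cancel_mono (homObjComparison (proEmbedding C) (F.complex.X 0) A), Category.assoc,
    ← homObjComparison_homMap, ← Category.assoc, fixedAug_homObjComparison,
    fixedAug_homObjComparison, fixedAugHom_homMap_hom]

lemma fixedAugX_map {F F' : FreeResolution H} (φ : F.Hom F') (A : Action C H) :
    fixedAugX F' A ≫ (proEmbedding C).map (((homComplexMap φ).app A).f 0) = fixedAugX F A := by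
  have h : ((homComplexMap φ).app A).f 0 = (homComplexXIso F' A 0 0 rfl).hom ≫
      homMap (φ.hom.f 0) A ≫ (homComplexXIso F A 0 0 rfl).inv :=
    HomologicalComplex.extendMap_f _ ComplexShape.embeddingUpNat rfl
  rw [h, fixedAugX, Category.assoc, ← Functor.map_comp, Iso.inv_hom_id_assoc, Functor.map_comp,
    ← Category.assoc, fixedAug_map_homMap, fixedAugX]

lemma fixedToHomTotal_map {F F' : FreeResolution H} (φ : F.Hom F')
    (K : CochainComplex.Plus (Action C H)) :
    fixedToHomTotal F' K ≫ (proEmbedding C).mapCochainComplexPlus.map ((homTotalMap φ).app K) =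
      fixedToHomTotal F K := by
  ext n : 3
  change (fixedAugX F' (K.obj.X n) ≫ (proEmbedding C).map (homTotalι F' K n 0 n (add_zero n))) ≫
    (proEmbedding C).map (((homTotalMap φ).app K).hom.f n) =
    fixedAugX F (K.obj.X n) ≫ (proEmbedding C).map (homTotalι F K n 0 n (add_zero n))
  have h : homTotalι F' K n 0 n (add_zero n) ≫ ((homTotalMap φ).app K).hom.f n =
      ((homComplexMap φ).app (K.obj.X n)).f 0 ≫ homTotalι F K n 0 n (add_zero n) :=
    totalPlusι_natTrans_app (homComplexMap φ) K n 0 n (add_zero n)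
  rw [Category.assoc, ← Functor.map_comp, h, Functor.map_comp, ← Category.assoc, fixedAugX_map]

lemma fixedAugX_homComplexComparisonX (F : FreeResolution H) (A : Action C H) :
    fixedAugX F A ≫ (homComplexComparisonX (proEmbedding C) F A 0).hom =
      fixedAugHomX F ((proAction C H).obj A) := by
  have h : (homComplexComparisonX (proEmbedding C) F A 0).hom = _ :=
    homComplexComparisonX_hom (proEmbedding C) F A 0
  rw [h, fixedAugX, Category.assoc, ← Category.assoc ((proEmbedding C).map _), ← Functor.map_comp]
  refine (_ ≫= (congrArg (proEmbedding C).map (Iso.inv_hom_id _) =≫ _)).trans ?_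
  rw [CategoryTheory.Functor.map_id, Category.id_comp, ← Category.assoc, fixedAug_homObjComparison]
  rfl

/-- This identifies the canonical morphism in `RGammaLift` with the one for which the derived
functor on pro-objects has been computed. -/
lemma fixedToHomTotal_homTotalComparison (F : FreeResolution H)
    (K : CochainComplex.Plus (Action C H)) :
    fixedToHomTotal F K ≫ (homTotalComparison (proEmbedding C) F).app K =
      (fixedToTotal F).app ((proAction C H).mapCochainComplexPlus.obj K) := by
  ext n : 3
  change (fixedAugX F (K.obj.X n) ≫ (proEmbedding C).map (homTotalι F K n 0 n (add_zero n))) ≫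
    homTotalComparisonX (proEmbedding C) F K n =
    augX (homComplexAug F) ((proAction C H).obj (K.obj.X n)) ≫
      homTotalι F ((proAction C H).mapCochainComplexPlus.obj K) n 0 n (add_zero n)
  rw [Category.assoc, map_homTotalι_homTotalComparisonX, augX_homComplexAug]
  exact (Category.assoc _ _ _).symm.trans (fixedAugX_homComplexComparisonX F (K.obj.X n) =≫ _)

end ProComparison

/-! ### Functors and transformations on the derived category, defined on complexes -/

section LiftAlongQ

variable {E : Type*} [Category* E] [Abelian E] [HasDerivedCategory E] {D : Type*} [Category* D]

lemma plusQ_natTrans_ext {R R' : DerivedCategory.Plus E ⥤ D} {τ τ' : R ⟶ R'}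
    (h : ∀ K, τ.app (DerivedCategory.Plus.Q.obj K) = τ'.app (DerivedCategory.Plus.Q.obj K)) :
    τ = τ' :=
  Localization.natTrans_ext DerivedCategory.Plus.Q (CochainComplex.Plus.quasiIso E) h

/-- A natural isomorphism between functors from the derived category, given by a natural isomorphism
on complexes. -/
def plusQLiftIso {R R' : DerivedCategory.Plus E ⥤ D}
    (e : DerivedCategory.Plus.Q ⋙ R ≅ DerivedCategory.Plus.Q ⋙ R') : R ≅ R' :=
  Localization.liftNatIso DerivedCategory.Plus.Q (CochainComplex.Plus.quasiIso E) _ _ _ _ e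

lemma plusQLiftIso_hom_app {R R' : DerivedCategory.Plus E ⥤ D}
    (e : DerivedCategory.Plus.Q ⋙ R ≅ DerivedCategory.Plus.Q ⋙ R') (K : CochainComplex.Plus E) :
    (plusQLiftIso e).hom.app (DerivedCategory.Plus.Q.obj K) = e.hom.app K :=
  (Localization.liftNatTrans_app DerivedCategory.Plus.Q (CochainComplex.Plus.quasiIso E)
    _ _ _ _ _ K).trans ((Category.id_comp _).trans (Category.comp_id _))

instance : (HomotopyCategory.Plus.quotient E).Additive where
  map_add {_ _ f g} := by
    ext : 1
    exact (HomotopyCategory.quotient E _).map_add (f := f.hom) (g := g.hom)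

/-- Additivity passes from complexes to the homotopy category because the quotient functor is full
and essentially surjective, and then to the derived category by localization. -/
lemma additive_of_plusQ_comp [Preadditive D] (R : DerivedCategory.Plus E ⥤ D)
    [h : (DerivedCategory.Plus.Q ⋙ R).Additive] : R.Additive := by
  have h₁ : (HomotopyCategory.Plus.quotient E ⋙ DerivedCategory.Plus.Qh ⋙ R).Additive := h
  have h₂ : (DerivedCategory.Plus.Qh ⋙ R).Additive :=
    Functor.additive_of_full_essSurj_comp (HomotopyCategory.Plus.quotient E) _
  exact (Localization.functor_additive_iff DerivedCategory.Plus.Qh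
    (HomotopyCategory.Plus.subcategoryAcyclic E).trW R).2 h₂

end LiftAlongQ

/-! ### The functor defined by one resolution is computed by all resolutions -/

section ResolutionIso

variable {V : Type*} [Category* V] [Abelian V] {H : Type v} [Group H] [HasDerivedCategory V]

/-- The identity of a resolution. -/
def FreeResolution.Hom.id (F : FreeResolution H) : F.Hom F := ⟨𝟙 _, fun _ => rfl⟩

/-- The composition of morphisms of resolutions. -/
def FreeResolution.Hom.comp {F F' F'' : FreeResolution H} (φ : F.Hom F') (ψ : F'.Hom F'') :
    F.Hom F'' := ⟨φ.hom ≫ ψ.hom, fun x => (ψ.comm _).trans (φ.comm x)⟩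

lemma homComplexMap_id (F : FreeResolution H) :
    homComplexMap (V := V) (.id F) = 𝟙 _ := by
  have : homComplexNatMap (V := V) (.id F) = 𝟙 _ := by
    ext A n : 4
    exact homMap_id A
  rw [homComplexMap, this]
  exact Functor.whiskerRight_id' _

lemma homComplexMap_comp {F F' F'' : FreeResolution H} (φ : F.Hom F') (ψ : F'.Hom F'') :
    homComplexMap (V := V) (φ.comp ψ) = homComplexMap ψ ≫ homComplexMap φ := by
  have : homComplexNatMap (V := V) (φ.comp ψ) = homComplexNatMap ψ ≫ homComplexNatMap φ := by
    ext A n : 4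
    exact homMap_comp _ _ A
  rw [homComplexMap, this]
  exact Functor.whiskerRight_comp _ _ _

lemma homTotalMap_id (F : FreeResolution H) : homTotalMap (V := V) (.id F) = 𝟙 _ := by
  rw [homTotalMap_eq, homComplexMap_id]
  ext K n : 5
  refine totalPlus_hom_ext fun p q h => ?_
  exact (totalPlusι_natTrans_app _ _ _ _ _ _).trans
    ((Category.id_comp _).trans (Category.comp_id _).symm)

lemma homTotalMap_comp {F F' F'' : FreeResolution H} (φ : F.Hom F') (ψ : F'.Hom F'') :
    homTotalMap (V := V) (φ.comp ψ) = homTotalMap ψ ≫ homTotalMap φ := by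
  rw [homTotalMap_eq, homTotalMap_eq, homTotalMap_eq, homComplexMap_comp]
  ext K n : 5
  refine totalPlus_hom_ext fun p q h => ?_
  refine (totalPlusι_natTrans_app _ _ _ _ _ _).trans ?_
  refine Eq.trans ?_ (Category.assoc _ _ _)
  refine Eq.trans ?_ (totalPlusι_natTrans_app _ _ _ _ _ _ =≫ _).symm
  refine Eq.trans ?_ (Category.assoc _ _ _).symm
  exact (Category.assoc _ _ _).trans (_ ≫= (totalPlusι_natTrans_app _ _ _ _ _ _).symm)

/-- No relation between `χ` and the composite of `φ` and `ψ` is needed: any two morphisms of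
resolutions act in the same way. Consequently morphisms in both directions are mutually inverse. -/
lemma plusQ_map_homTotalMap_comp {F F' F'' : FreeResolution H} (φ : F.Hom F') (ψ : F'.Hom F'')
    (χ : F.Hom F'') (K : CochainComplex.Plus (Action V H)) :
    DerivedCategory.Plus.Q.map ((homTotalMap ψ).app K) ≫
      DerivedCategory.Plus.Q.map ((homTotalMap φ).app K) =
        DerivedCategory.Plus.Q.map ((homTotalMap χ).app K) := by
  rw [plusQ_map_homTotalMap χ (φ.comp ψ), homTotalMap_comp, NatTrans.comp_app, Functor.map_comp]

lemma plusQ_map_homTotalMap_id {F : FreeResolution H} (φ : F.Hom F)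
    (K : CochainComplex.Plus (Action V H)) :
    DerivedCategory.Plus.Q.map ((homTotalMap φ).app K) = 𝟙 _ := by
  rw [plusQ_map_homTotalMap φ (.id F), homTotalMap_id, NatTrans.id_app,
    CategoryTheory.Functor.map_id]

/-- In the derived category, the functors `homTotal F` and `homTotal F'` are isomorphic. -/
def homTotalIso (F F' : FreeResolution H) :
    homTotal (V := V) F' ⋙ DerivedCategory.Plus.Q ≅ homTotal F ⋙ DerivedCategory.Plus.Q where
  hom := Functor.whiskerRight (homTotalMap (F.homOf F')) _
  inv := Functor.whiskerRight (homTotalMap (F'.homOf F)) _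
  hom_inv_id := by
    ext K : 2
    exact (plusQ_map_homTotalMap_comp _ _ (.id F') K).trans (plusQ_map_homTotalMap_id _ K)
  inv_hom_id := by
    ext K : 2
    exact (plusQ_map_homTotalMap_comp _ _ (.id F) K).trans (plusQ_map_homTotalMap_id _ K)

variable [HasDerivedCategory (Action V H)]

/-- The functor between derived categories which is induced by `homTotal F`. -/
abbrev derivedHomTotal (F : FreeResolution H) :
    DerivedCategory.Plus (Action V H) ⥤ DerivedCategory.Plus V :=
  inducedPlus (homTotal F) (quasiIso_homTotal_map F)

/-- The functor `derivedHomTotal F` is computed by the functor `homTotal F`. -/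
def derivedHomTotalFac (F : FreeResolution H) :
    homTotal (V := V) F ⋙ DerivedCategory.Plus.Q ≅ DerivedCategory.Plus.Q ⋙ derivedHomTotal F :=
  (inducedPlusFac (E := Action V H) (V := V) (homTotal F) (quasiIso_homTotal_map F) :)

/-- The functor `derivedHomTotal F₀` is computed by all the functors `homTotal F`. -/
def derivedHomTotalIso (F₀ F : FreeResolution H) :
    homTotal (V := V) F ⋙ DerivedCategory.Plus.Q ≅ DerivedCategory.Plus.Q ⋙ derivedHomTotal F₀ :=
  homTotalIso F₀ F ≪≫ derivedHomTotalFac F₀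

lemma derivedHomTotalIso_hom_app (F₀ F : FreeResolution H) (φ : F₀.Hom F)
    (K : CochainComplex.Plus (Action V H)) :
    (derivedHomTotalIso F₀ F).hom.app K =
      DerivedCategory.Plus.Q.map ((homTotalMap φ).app K) ≫
        (derivedHomTotalFac F₀).hom.app K :=
  plusQ_map_homTotalMap _ _ K =≫ _

lemma derivedHomTotalIso_comp (F₀ : FreeResolution H) {F F' : FreeResolution H} (φ : F.Hom F') :
    Functor.whiskerRight (homTotalMap φ) DerivedCategory.Plus.Q ≫
      (derivedHomTotalIso (V := V) F₀ F).hom = (derivedHomTotalIso F₀ F').hom := by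
  ext K : 2
  refine ((Category.assoc _ _ _).symm.trans ?_ :
    DerivedCategory.Plus.Q.map ((homTotalMap φ).app K) ≫
      DerivedCategory.Plus.Q.map ((homTotalMap (F₀.homOf F)).app K) ≫
        (derivedHomTotalFac F₀).hom.app K =
    DerivedCategory.Plus.Q.map ((homTotalMap (F₀.homOf F')).app K) ≫
        (derivedHomTotalFac F₀).hom.app K)
  rw [plusQ_map_homTotalMap_comp]

instance (F : FreeResolution H) : (homTotal (V := V) F).Additive :=
  inferInstanceAs (totalPlus (homComplex F)).Additive

instance : (DerivedCategory.Plus.Q (C := V)).Additive :=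
  inferInstanceAs (HomotopyCategory.Plus.quotient V ⋙ DerivedCategory.Plus.Qh).Additive

instance (F : FreeResolution H) : (derivedHomTotal (V := V) F).Additive := by
  have : (DerivedCategory.Plus.Q ⋙ derivedHomTotal (V := V) F).Additive :=
    Functor.additive_of_iso (derivedHomTotalFac F)
  exact additive_of_plusQ_comp _

end ResolutionIso

/-! ### The derived functor on pro-objects is computed by a free resolution -/

section DerivedIso

/-- Right derived functors are unique up to an isomorphism compatible with the units. So if `T`
computes one of them, it computes each of them, with the unit given by `t`. -/
lemma exists_iso_of_isRightDerivedFunctor {E V : Type*} [Category* E] [Abelian E] [Category* V]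
    [Abelian V] [HasDerivedCategory E] [HasDerivedCategory V] {G : E ⥤ V} [G.Additive]
    {T : CochainComplex.Plus E ⥤ CochainComplex.Plus V} (t : G.mapCochainComplexPlus ⟶ T)
    {R R' : DerivedCategory.Plus E ⥤ DerivedCategory.Plus V}
    (e : T ⋙ DerivedCategory.Plus.Q ≅ DerivedCategory.Plus.Q ⋙ R)
    (α : G.mapHomotopyCategoryPlus ⋙ DerivedCategory.Plus.Qh ⟶ DerivedCategory.Plus.Qh ⋙ R')
    [R.IsRightDerivedFunctor (inducedUnit t e) (HomotopyCategory.Plus.quasiIso E)]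
    [R'.IsRightDerivedFunctor α (HomotopyCategory.Plus.quasiIso E)] :
    ∃ e' : T ⋙ DerivedCategory.Plus.Q ≅ DerivedCategory.Plus.Q ⋙ R',
      ∀ K, inducedUnitApp t e' K = α.app ((HomotopyCategory.Plus.quotient E).obj K) := by
  let u := Functor.rightDerivedUnique _ _ (inducedUnit t e) α (HomotopyCategory.Plus.quasiIso E)
  have hu : inducedUnit t e ≫ Functor.whiskerLeft DerivedCategory.Plus.Qh u.hom = α := by
    simp [u]
  refine ⟨e ≪≫ Functor.isoWhiskerLeft DerivedCategory.Plus.Q u, fun K => ?_⟩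
  rw [← hu, NatTrans.comp_app, inducedUnit_app]
  exact (Category.assoc _ _ _).symm

variable {V : Type*} [Category* V] [Abelian V] {H : Type v} [Group H] [HasProductsOfShape H V]
  [PreservesFiniteColimits (powerFunctor V H)] [HasDerivedCategory (Action V H)]
  [HasDerivedCategory V]

/-- The right derived functor of the fixed point functor is computed by `homTotal F`. -/
lemma exists_iso_homTotal (F : FreeResolution H)
    (RF : DerivedCategory.Plus (Action V H) ⥤ DerivedCategory.Plus V)
    (α : (fixedPoints V H).mapHomotopyCategoryPlus ⋙ DerivedCategory.Plus.Qh ⟶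
      DerivedCategory.Plus.Qh ⋙ RF)
    [RF.IsRightDerivedFunctor α (HomotopyCategory.Plus.quasiIso (Action V H))] :
    ∃ e : homTotal F ⋙ DerivedCategory.Plus.Q ≅ DerivedCategory.Plus.Q ⋙ RF,
      ∀ K, inducedUnitApp (fixedToTotal F) e K =
        α.app ((HomotopyCategory.Plus.quotient _).obj K) := by
  have := isRightDerivedFunctor_fixedPoints (V := V) (fixedToTotal F) (derivedHomTotalFac F)
    (quasiIso_fixedToTotal_app F)
  exact exists_iso_of_isRightDerivedFunctor (fixedToTotal F) (derivedHomTotalFac F) α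

end DerivedIso

/-- The diagram chase for the field `square_comp` of `rGammaLift`, stated in an arbitrary category:
three inverse pairs cancel, and the remaining factors form `h₅`. -/
lemma comp_eq_of_factorizations {D : Type*} [Category* D] {X X₁ X₂ X₃ Y₁ Y₂ Z W W' : D} {a : X ⟶ X₁}
    {b : X₁ ⟶ X₂} {c : X₂ ⟶ X₃} {q : X₁ ⟶ Y₁} {i : Y₁ ⟶ Y₂} {m : Y₂ ⟶ X₃} {m' : X₃ ⟶ Y₂}
    {j : Y₂ ⟶ Y₁} {t : Y₁ ⟶ Z} {ε : Z ⟶ W} {r : W ⟶ W'} {r' : W' ⟶ W} {x : X ⟶ Z}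
    (h₁ : b ≫ c = q ≫ i ≫ m) (h₂ : i ≫ j = 𝟙 _) (h₃ : m ≫ m' = 𝟙 _) (h₄ : r ≫ r' = 𝟙 _)
    (h₅ : a ≫ q ≫ t = x) :
    a ≫ b ≫ c ≫ (m' ≫ j ≫ t ≫ ε ≫ r) ≫ r' = x ≫ ε := by
  simp only [Category.assoc, h₄, Category.comp_id, ← h₅]
  rw [← Category.assoc b, h₁]
  simp only [Category.assoc]
  rw [← Category.assoc m, h₃, Category.id_comp, ← Category.assoc i, h₂, Category.id_comp]

/-! ### Existence and uniqueness of the lift -/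

section Lift

variable {C : Type u} [Category.{v} C] [Abelian C] {H : Type v} [Group H]
  [HasDerivedCategory.{w₁} (Action C H)] [HasDerivedCategory.{w₂} C]
  [HasDerivedCategory.{w₃} (Action (Pro C) H)] [HasDerivedCategory.{w₄} (Pro C)]
  (F : FreeResolution H)
  {RΓ : DerivedCategory.Plus (Action (Pro C) H) ⥤ DerivedCategory.Plus (Pro C)}

/-- The isomorphism `homTotalComparison` in the derived category. -/
def derivedHomTotalComparison :
    (homTotal F ⋙ (proEmbedding C).mapCochainComplexPlus) ⋙ DerivedCategory.Plus.Q ≅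
      ((proAction C H).mapCochainComplexPlus ⋙ homTotal F) ⋙ DerivedCategory.Plus.Q :=
  NatIso.ofComponents (fun K =>
    have := isIso_plusQ_map _ (quasiIso_homTotalComparison_app (proEmbedding C) F K)
    asIso (DerivedCategory.Plus.Q.map
    ((homTotalComparison (proEmbedding C) F).app K)))
    (fun f => (Functor.whiskerRight (homTotalComparison (proEmbedding C) F)
      DerivedCategory.Plus.Q).naturality f)

/-- The square in the definition of `RGammaLift`, on complexes. -/
def squareOfIso (e : homTotal F ⋙ DerivedCategory.Plus.Q ≅ DerivedCategory.Plus.Q ⋙ RΓ) :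
    DerivedCategory.Plus.Q ⋙ derivedHomTotal F ⋙ mapDerivedPlus (proEmbedding C) ≅
      DerivedCategory.Plus.Q ⋙ mapDerivedPlus (proAction C H) ⋙ RΓ :=
  Functor.isoWhiskerRight (derivedHomTotalFac F).symm (mapDerivedPlus (proEmbedding C)) ≪≫
  Functor.isoWhiskerLeft (homTotal F) (mapDerivedPlusFactors (proEmbedding C)) ≪≫
  derivedHomTotalComparison F ≪≫
  Functor.isoWhiskerLeft (proAction C H).mapCochainComplexPlus e ≪≫
  Functor.isoWhiskerRight (mapDerivedPlusFactors (proAction C H)).symm RΓ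

lemma squareOfIso_hom_app (e : homTotal F ⋙ DerivedCategory.Plus.Q ≅ DerivedCategory.Plus.Q ⋙ RΓ)
    (K : CochainComplex.Plus (Action C H)) :
    (squareOfIso F e).hom.app K =
      (mapDerivedPlus (proEmbedding C)).map ((derivedHomTotalFac F).inv.app K) ≫
      (mapDerivedPlusFactors (proEmbedding C)).hom.app ((homTotal F).obj K) ≫
      DerivedCategory.Plus.Q.map ((homTotalComparison (proEmbedding C) F).app K) ≫
      e.hom.app ((proAction C H).mapCochainComplexPlus.obj K) ≫
      RΓ.map ((mapDerivedPlusFactors (proAction C H)).inv.app K) := rfl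

/-- The lift of `RΓ` given by a resolution. -/
def rGammaLift (α : fixedPointsPlus C H ⟶ DerivedCategory.Plus.Qh ⋙ RΓ)
    (e : homTotal F ⋙ DerivedCategory.Plus.Q ≅ DerivedCategory.Plus.Q ⋙ RΓ)
    (he : ∀ K, inducedUnitApp (fixedToTotal F) e K =
      α.app ((HomotopyCategory.Plus.quotient _).obj K)) : RGammaLift RΓ α where
  functor := derivedHomTotal F
  additive := inferInstance
  resolutionIso F' := derivedHomTotalIso F F'
  resolutionIso_comp φ := derivedHomTotalIso_comp F φ
  square := plusQLiftIso (squareOfIso F e)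
  square_comp F' K := by
    -- The resolution `F'` is arbitrary, while the functor and the square are built from `F`. A
    -- morphism `F ⟶ F'` reduces the assertion to `F`.
    have h₁ : (mapDerivedPlusFactors (proEmbedding C)).inv.app ((homTotal F').obj K) ≫
        (mapDerivedPlus (proEmbedding C)).map ((derivedHomTotalIso F F').hom.app K) =
        DerivedCategory.Plus.Q.map ((proEmbedding C).mapCochainComplexPlus.map
          ((homTotalMap (F.homOf F')).app K)) ≫
        (mapDerivedPlusFactors (proEmbedding C)).inv.app ((homTotal F).obj K) ≫
        (mapDerivedPlus (proEmbedding C)).map ((derivedHomTotalFac F).hom.app K) := by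
      rw [derivedHomTotalIso_hom_app F F' (F.homOf F'), Functor.map_comp]
      refine (Category.assoc _ _ _).symm.trans (Eq.trans (Eq.symm ?_ =≫ _) (Category.assoc _ _ _))
      exact (mapDerivedPlusFactors (proEmbedding C)).inv.naturality
        ((homTotalMap (F.homOf F')).app K)
    have h₂ : (mapDerivedPlusFactors (proEmbedding C)).inv.app ((homTotal F).obj K) ≫
        (mapDerivedPlusFactors (proEmbedding C)).hom.app ((homTotal F).obj K) = 𝟙 _ :=
      Iso.inv_hom_id_app _ _
    have h₃ : (mapDerivedPlus (proEmbedding C)).map ((derivedHomTotalFac F).hom.app K) ≫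
        (mapDerivedPlus (proEmbedding C)).map ((derivedHomTotalFac F).inv.app K) = 𝟙 _ := by
      rw [← Functor.map_comp, Iso.hom_inv_id_app, CategoryTheory.Functor.map_id]
    have h₄ : RΓ.map ((mapDerivedPlusFactors (proAction C H)).inv.app K) ≫
        RΓ.map ((mapDerivedPlusFactors (proAction C H)).hom.app K) = 𝟙 _ := by
      rw [← Functor.map_comp, Iso.inv_hom_id_app, CategoryTheory.Functor.map_id]
    have h₅ : DerivedCategory.Plus.Q.map (fixedToHomTotal F' K) ≫
        DerivedCategory.Plus.Q.map ((proEmbedding C).mapCochainComplexPlus.map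
          ((homTotalMap (F.homOf F')).app K)) ≫
        DerivedCategory.Plus.Q.map ((homTotalComparison (proEmbedding C) F).app K) =
        DerivedCategory.Plus.Q.map ((fixedToTotal F).app
          ((proAction C H).mapCochainComplexPlus.obj K)) := by
      rw [← Category.assoc, ← Functor.map_comp, fixedToHomTotal_map, ← Functor.map_comp,
        fixedToHomTotal_homTotalComparison]
    rw [plusQLiftIso_hom_app, squareOfIso_hom_app, ← he]
    exact comp_eq_of_factorizations h₁ h₂ h₃ h₄ h₅

/-- A lift of `RΓ` is determined by its values on complexes. -/
lemma existsUnique_iso_of_rGammaLift (F : FreeResolution H)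
    {α : fixedPointsPlus C H ⟶ DerivedCategory.Plus.Qh ⋙ RΓ}
    (L L' : RGammaLift RΓ α) : ∃! e : L.functor ≅ L'.functor, ∀ F : FreeResolution H,
      (L.resolutionIso F).hom ≫ Functor.whiskerLeft DerivedCategory.Plus.Q e.hom =
        (L'.resolutionIso F).hom := by
  -- The isomorphism is forced by the single resolution `F`. Compatibility with another resolution
  -- `F'` follows from a morphism `F ⟶ F'` and from `resolutionIso_comp` for both lifts.
  refine ⟨plusQLiftIso ((L.resolutionIso F).symm ≪≫ L'.resolutionIso F), fun F' => ?_,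
    fun e he => ?_⟩
  · have h : Functor.whiskerLeft DerivedCategory.Plus.Q
        (plusQLiftIso ((L.resolutionIso F).symm ≪≫ L'.resolutionIso F)).hom =
        (L.resolutionIso F).inv ≫ (L'.resolutionIso F).hom := by
      ext K : 2
      exact plusQLiftIso_hom_app _ K
    rw [h, ← L.resolutionIso_comp (F.homOf F'), Category.assoc, Iso.hom_inv_id_assoc,
      L'.resolutionIso_comp]
  · ext : 1
    refine plusQ_natTrans_ext fun K => ?_
    rw [plusQLiftIso_hom_app, Iso.trans_hom, ← he F, Iso.symm_hom, Iso.inv_hom_id_assoc]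
    rfl

end Lift

/-! ### Bounded complexes and groups of type `FL` -/

section Bounded

variable {E V : Type*} [Category* E] [Abelian E] [Category* V] [Abelian V]

lemma isStrictlyLE_totalPlus (M : E ⥤ CochainComplex V ℤ) [M.Additive] [IsNonnegative M]
    (K : CochainComplex.Plus E) (a b : ℤ) [K.obj.IsStrictlyLE a]
    (hM : ∀ A q, b < q → IsZero ((M.obj A).X q)) :
    ((totalPlus M).obj K).obj.IsStrictlyLE (a + b) := by
  refine (CochainComplex.isStrictlyLE_iff _ _).2 fun i hi => ?_
  rw [IsZero.iff_id_eq_zero]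
  refine totalPlus_hom_ext fun p q h => IsZero.eq_of_src ?_ _ _
  by_cases hp : a < p
  · exact (M ⋙ HomologicalComplex.eval _ _ q).map_isZero (K.obj.isZero_of_isStrictlyLE a p hp)
  · exact hM _ _ (by omega)

variable {H : Type v} [Group H]

lemma isZero_homObj (M : ModuleCat.{v} (GroupRing H)) [Module.Free (GroupRing H) M]
    [Module.Finite (GroupRing H) M] (hM : IsZero M) (A : Action V H) : IsZero (homObj M A) := by
  rw [IsZero.iff_id_eq_zero, ← homMap_id, hM.eq_of_src (𝟙 M) 0, homMap_zero]

lemma isZero_homComplex_X (F : FreeResolution H) (n : ℕ)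
    (hF : ∀ i, n < i → IsZero (F.complex.X i)) (A : Action V H) (q : ℤ) (hq : n < q) :
    IsZero (((homComplex F).obj A).X q) := by
  obtain ⟨k, rfl⟩ := Int.eq_ofNat_of_zero_le (a := q) (by omega)
  exact (isZero_homObj (F.complex.X k) (hF k (by omega)) A).of_iso (homComplexXIso F A k k rfl)

/-- The images in the derived category of a bounded below complex. -/
def plusQObjIso [HasDerivedCategory E] (K : CochainComplex.Plus E) :
    (DerivedCategory.Plus.Q.obj K).obj ≅ DerivedCategory.Q.obj K.obj :=
  (DerivedCategory.quotientCompQhIso E).app K.obj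

/-- Boundedness for the t-structure concerns cohomology only. A representing complex whose terms
vanish outside an interval is needed to bound the total complex. -/
lemma exists_iso_plusQ_of_bounded [HasDerivedCategory E] (X : DerivedCategory.Plus E)
    (hX : DerivedCategory.TStructure.t.bounded X.obj) :
    ∃ (K : CochainComplex.Plus E) (n : ℤ) (_ : K.obj.IsStrictlyLE n),
      Nonempty (X ≅ DerivedCategory.Plus.Q.obj K) := by
  obtain ⟨⟨a, ha⟩, ⟨b, hb⟩⟩ := hX
  have : DerivedCategory.IsGE X.obj a := ha
  have : DerivedCategory.IsLE X.obj b := hb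
  obtain ⟨K, h₁, h₂, ⟨e⟩⟩ := DerivedCategory.exists_iso_Q_obj_of_isGE_of_isLE X.obj a b
  let K' : CochainComplex.Plus E := ⟨K, a, h₁⟩
  exact ⟨K', b, h₂, ⟨DerivedCategory.Plus.ι.preimageIso (e ≪≫ (plusQObjIso K').symm)⟩⟩

lemma bounded_of_iso_plusQ [HasDerivedCategory E] (X : DerivedCategory.Plus E)
    (K : CochainComplex.Plus E) (n : ℤ) [K.obj.IsStrictlyLE n]
    (e : X ≅ DerivedCategory.Plus.Q.obj K) :
    DerivedCategory.TStructure.t.bounded X.obj :=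
  ⟨X.property, n, DerivedCategory.TStructure.t.isLE_of_iso
    ((DerivedCategory.Plus.ι.mapIso e ≪≫ plusQObjIso K).symm : DerivedCategory.Q.obj K.obj ≅ X.obj)
      n⟩

end Bounded

section BoundedLift

variable {C : Type u} [Category.{v} C] [Abelian C] {H : Type v} [Group H]
  [HasDerivedCategory.{w₁} (Action C H)] [HasDerivedCategory.{w₂} C]
  [HasDerivedCategory.{w₃} (Action (Pro C) H)] [HasDerivedCategory.{w₄} (Pro C)]
  {RΓ : DerivedCategory.Plus (Action (Pro C) H) ⥤ DerivedCategory.Plus (Pro C)}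
  {α : fixedPointsPlus C H ⟶ DerivedCategory.Plus.Qh ⋙ RΓ}

/-- On a complex zero above degree `m`, a resolution of length `n` gives a total complex zero above
`m + n`. Every lift is computed by this resolution, so the bound holds for every `L`. -/
lemma RGammaLift.bounded (L : RGammaLift RΓ α) (F : FreeResolution H) (n : ℕ)
    (hF : ∀ i, n < i → IsZero (F.complex.X i)) (X : DerivedCategory.Plus (Action C H))
    (hX : DerivedCategory.TStructure.t.bounded X.obj) :
    DerivedCategory.TStructure.t.bounded (L.functor.obj X).obj := by
  obtain ⟨K, m, hm, ⟨e⟩⟩ := exists_iso_plusQ_of_bounded X hX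
  have : ((homTotal F).obj K).obj.IsStrictlyLE (m + n) :=
    isStrictlyLE_totalPlus (homComplex F) K m n (fun A q hq => isZero_homComplex_X F n hF A q hq)
  exact bounded_of_iso_plusQ _ ((homTotal F).obj K) (m + n)
    (L.functor.mapIso e ≪≫ ((L.resolutionIso F).app K).symm)

variable (L : RGammaLift RΓ α) (hL : ∀ X : DerivedCategory.Plus (Action C H),
  DerivedCategory.TStructure.t.bounded X.obj →
    DerivedCategory.TStructure.t.bounded (L.functor.obj X).obj)

/-- The functor between bounded derived categories induced by a lift of `RΓ`. -/
def RGammaLift.boundedFunctor : DerivedCategory.Bounded (Action C H) ⥤ DerivedCategory.Bounded C :=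
  ObjectProperty.lift _ (boundedToPlus (Action C H) ⋙ L.functor ⋙ DerivedCategory.Plus.ι)
    fun X => hL _ X.property

/-- The compatibility of `RGammaLift.boundedFunctor` with the inclusions. -/
def RGammaLift.boundedIso : L.boundedFunctor hL ⋙ boundedToPlus C ≅
    boundedToPlus (Action C H) ⋙ L.functor := Iso.refl _

/-- The restriction of the square of `RGammaLift` to bounded derived categories. -/
def RGammaLift.boundedSquare :
    L.boundedFunctor hL ⋙ boundedToPlus C ⋙ mapDerivedPlus (proEmbedding C) ≅
      boundedToPlus (Action C H) ⋙ mapDerivedPlus (proAction C H) ⋙ RΓ :=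
  Functor.isoWhiskerRight (L.boundedIso hL) (mapDerivedPlus (proEmbedding C)) ≪≫
    Functor.isoWhiskerLeft (boundedToPlus (Action C H)) L.square

lemma RGammaLift.boundedSquare_hom_app (X : DerivedCategory.Bounded (Action C H)) :
    (L.boundedSquare hL).hom.app X =
      (mapDerivedPlus (proEmbedding C)).map ((L.boundedIso hL).hom.app X) ≫
        L.square.hom.app ((boundedToPlus (Action C H)).obj X) := rfl

end BoundedLift

/-! ### The cohomology objects of a single object -/

section SinglePlus

variable {E V : Type*} [Category* E] [Abelian E] [Category* V] [Abelian V]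

/-- The complex concentrated in degree zero, as a bounded below complex. -/
def singlePlus (A : E) : CochainComplex.Plus E :=
  ⟨(CochainComplex.singleFunctor E 0).obj A, 0, inferInstance⟩

/-- The image in the derived category of the complex `singlePlus A`. -/
def plusQSingleIso [HasDerivedCategory E] (A : E) :
    (DerivedCategory.Plus.singleFunctor E 0).obj A ≅ DerivedCategory.Plus.Q.obj (singlePlus A) :=
  DerivedCategory.Plus.ι.preimageIso
    ((DerivedCategory.singleFunctorIsoCompQ E 0).app A ≪≫ (plusQObjIso (singlePlus A)).symm)

/-- An additive functor sends a single complex to a single complex. -/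
def mapSinglePlusIso (G : E ⥤ V) [G.Additive] (A : E) :
    G.mapCochainComplexPlus.obj (singlePlus A) ≅ singlePlus (G.obj A) :=
  (CochainComplex.Plus.ι V).preimageIso
    ((HomologicalComplex.singleMapHomologicalComplex G (ComplexShape.up ℤ) 0).app A)

/-- The homology of the image of a complex in the derived category. -/
def homologyPlusQIso [HasDerivedCategory E] (K : CochainComplex.Plus E) (p : ℤ) :
    (DerivedCategory.Plus.homologyFunctor E p).obj (DerivedCategory.Plus.Q.obj K) ≅
      K.obj.homology p :=
  (DerivedCategory.homologyFunctor E p).mapIso (plusQObjIso K) ≪≫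
    (DerivedCategory.homologyFunctorFactors E p).app K.obj

/-- An exact functor commutes with homology. -/
def mapHomologyPlusIso (G : E ⥤ V) [G.Additive] [PreservesFiniteLimits G]
    [PreservesFiniteColimits G] (K : CochainComplex.Plus E) (p : ℤ) :
    (G.mapCochainComplexPlus.obj K).obj.homology p ≅ G.obj (K.obj.homology p) :=
  (K.obj.sc p).mapHomologyIso G

end SinglePlus

section Cohomology

variable {C : Type u} [Category.{v} C] [Abelian C] {H : Type v} [Group H]
  [HasDerivedCategory.{w₁} (Action (Pro C) H)] [HasDerivedCategory.{w₂} (Pro C)]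

/-- The cohomology is computed by `Tot Hom(F_*, A)^H` formed in `Pro C`, which is the image of the
same complex in `C`; the exact embedding commutes with homology. -/
lemma nonempty_iso_cohomology (F : FreeResolution H)
    {RΓ : DerivedCategory.Plus (Action (Pro C) H) ⥤ DerivedCategory.Plus (Pro C)}
    (e : homTotal F ⋙ DerivedCategory.Plus.Q ≅ DerivedCategory.Plus.Q ⋙ RΓ) (A : Action C H)
    (p : ℤ) :
    Nonempty ((proEmbedding C).obj (((homTotal F).obj (singlePlus A)).obj.homology p) ≅
      cohomology RΓ p A) := by
  have := isIso_plusQ_map _ (quasiIso_homTotalComparison_app (proEmbedding C) F (singlePlus A))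
  let e₁ : RΓ.obj ((DerivedCategory.Plus.singleFunctor _ 0).obj ((proAction C H).obj A)) ≅
      DerivedCategory.Plus.Q.obj ((proEmbedding C).mapCochainComplexPlus.obj
        ((homTotal F).obj (singlePlus A))) :=
    RΓ.mapIso (plusQSingleIso _ ≪≫
      DerivedCategory.Plus.Q.mapIso (mapSinglePlusIso (proAction C H) A).symm) ≪≫
    e.symm.app ((proAction C H).mapCochainComplexPlus.obj (singlePlus A)) ≪≫
    (asIso (DerivedCategory.Plus.Q.map
      ((homTotalComparison (proEmbedding C) F).app (singlePlus A)))).symm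
  exact ⟨((DerivedCategory.Plus.homologyFunctor (Pro C) p).mapIso e₁ ≪≫
    homologyPlusQIso _ p ≪≫ mapHomologyPlusIso (proEmbedding C) _ p).symm⟩

end Cohomology

/-! ### Irreducible factors in the semi-simple case -/

section Semisimple

variable {C : Type*} [Category* C] [Abelian C]

lemma IsSemisimpleCategory.nonempty_retract_of_mono (hC : IsSemisimpleCategory C) {X Y : C}
    (f : X ⟶ Y) [Mono f] : Nonempty (Retract X Y) := by
  obtain ⟨s⟩ := hC (ShortComplex.mk f (cokernel.π f) (cokernel.condition f))
    { exact := ShortComplex.exact_cokernel f }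
  exact ⟨⟨f, s.r, s.f_r⟩⟩

lemma IsSemisimpleCategory.nonempty_retract_of_epi (hC : IsSemisimpleCategory C) {X Y : C}
    (f : X ⟶ Y) [Epi f] : Nonempty (Retract Y X) := by
  obtain ⟨s⟩ := hC (ShortComplex.mk (kernel.ι f) f (kernel.condition f))
    { exact := ShortComplex.exact_kernel f }
  exact ⟨⟨s.s, f, s.s_g⟩⟩

/-- Homology is a quotient of the cycles, which are a subobject of the term; both are direct factors
in a semi-simple category. -/
lemma IsSemisimpleCategory.nonempty_retract_homology (hC : IsSemisimpleCategory C)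
    (K : CochainComplex C ℤ) (p : ℤ) : Nonempty (Retract (K.homology p) (K.X p)) := by
  obtain ⟨r⟩ := hC.nonempty_retract_of_epi (K.homologyπ p)
  obtain ⟨r'⟩ := hC.nonempty_retract_of_mono (K.iCycles p)
  exact ⟨r.trans r'⟩

variable {H : Type v} [Group H]

lemma IsSupportedGE.hom_tot_eq_zero {B : Bicomplex C} {a b : ℤ} (h : IsSupportedGE B a b) {S : C}
    [B.HasTotal (ComplexShape.up ℤ)] (hS : ∀ (i j : ℤ) (f : S ⟶ (B.X i).X j), f = 0) {n : ℤ} (s : S ⟶ (tot B).X n) : s = 0 := by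
  rw [← Category.comp_id s, ← sum_totπ_totι h n, Preadditive.comp_sum]
  exact Finset.sum_eq_zero fun i _ => by rw [← Category.assoc, hS _ _ (s ≫ _), zero_comp]

/-- The terms are finite sums of objects which are zero or finite powers of `A`, and a morphism to a
power is determined by its components. -/
lemma homTotal_singlePlus_hom_eq_zero (F : FreeResolution H) (A : Action C H) (p : ℤ) {S : C}
    (hS : ∀ f : S ⟶ A.V, f = 0) (s : S ⟶ ((homTotal F).obj (singlePlus A)).obj.X p) : s = 0 := by
  obtain ⟨a, h⟩ := exists_isSupportedGE_bicomplex (homComplex F) (singlePlus A)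
  have hi (i j : ℤ) (f : S ⟶ ((homComplex F).obj ((singlePlus A).obj.X i)).X j) : f = 0 := by
    by_cases hi : i = 0
    · subst hi
      by_cases hj : j < 0
      · exact (IsNonnegative.isZero (M := homComplex F) _ j hj).eq_of_tgt _ _
      · obtain ⟨n, rfl⟩ := Int.eq_ofNat_of_zero_le (not_lt.1 hj)
        let e : ((singlePlus A).obj.X 0) ≅ A :=
          HomologicalComplex.singleObjXSelf (ComplexShape.up ℤ) 0 A
        have he := (homComplex F ⋙ HomologicalComplex.eval _ _ (n : ℤ)).mapIso e ≪≫
          homComplexXIso F A n n rfl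
        exact (cancel_mono he.hom).1 (homObj_ext fun k => (hS _).trans (hS _).symm)
    · refine IsZero.eq_of_tgt ((homComplex F ⋙ HomologicalComplex.eval _ _ j).map_isZero ?_) _ _
      exact HomologicalComplex.isZero_single_obj_X _ _ _ _ hi
  exact h.hom_tot_eq_zero hi s

lemma IsSemisimpleCategory.isIrreducibleFactor_of_homology (hC : IsSemisimpleCategory C)
    (F : FreeResolution H) (A : Action C H) (p : ℤ) {S : C}
    (hS : IsIrreducibleFactor S (((homTotal F).obj (singlePlus A)).obj.homology p)) :
    IsIrreducibleFactor S A.V := by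
  obtain ⟨hS, ⟨r⟩⟩ := hS
  refine ⟨hS, ?_⟩
  -- If there is no nonzero morphism `S ⟶ A`, then `S`, a retract of a term of the complex, has zero
  -- identity, which is impossible for a simple object. Otherwise a nonzero morphism is a
  -- monomorphism, and it splits.
  by_cases h : ∀ f : S ⟶ A.V, f = 0
  · obtain ⟨r'⟩ := hC.nonempty_retract_homology ((homTotal F).obj (singlePlus A)).obj p
    have h' := homTotal_singlePlus_hom_eq_zero F A p h (r.trans r').i
    have h'' := (r.trans r').retract
    rw [h', zero_comp] at h''
    exact (id_nonzero S h''.symm).elim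
  · push Not at h
    obtain ⟨f, hf⟩ := h
    have := mono_of_nonzero_from_simple hf
    exact hC.nonempty_retract_of_mono f

lemma IsIrreducibleFactor.of_iso {S X Y : C} (h : IsIrreducibleFactor S X) (e : X ≅ Y) :
    IsIrreducibleFactor S Y := ⟨h.1, h.2.map fun r => r.trans (Retract.ofIso e)⟩

end Semisimple

section ProFullyFaithful

variable (C : Type u) [Category.{v} C]

instance : (proEmbedding C).Full := inferInstanceAs (Ind.yoneda (C := Cᵒᵖ)).rightOp.Full

instance : (proEmbedding C).Faithful := inferInstanceAs (Ind.yoneda (C := Cᵒᵖ)).rightOp.Faithful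

end ProFullyFaithful

end GroupCohomologyPro

end

/-! ### The main theorem -/

open CategoryTheory Limits GroupCohomologyPro in
theorem mainTheorem7 {C : Type u} [Category.{v} C] [Abelian C] (H : Type v) [Group H]
    [HasDerivedCategory.{w₁} (Action C H)] [HasDerivedCategory.{w₂} C]
    [HasDerivedCategory.{w₃} (Action (Pro C) H)] [HasDerivedCategory.{w₄} (Pro C)] :
    -- the fixed point functor on pro-objects is right derivable
    (fixedPointsPlus C H).HasRightDerivedFunctor
      (HomotopyCategory.Plus.quasiIso (Action (Pro C) H)) ∧
    ∀ (RΓ : DerivedCategory.Plus (Action (Pro C) H) ⥤ DerivedCategory.Plus (Pro C))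
      (α : fixedPointsPlus C H ⟶ DerivedCategory.Plus.Qh ⋙ RΓ)
      [RΓ.IsRightDerivedFunctor α (HomotopyCategory.Plus.quasiIso (Action (Pro C) H))],
      -- (a) existence of the lift, and its uniqueness up to a unique isomorphism
      (IsTypeFPInfty H →
        Nonempty (RGammaLift RΓ α) ∧
        ∀ L L' : RGammaLift RΓ α, ∃! e : L.functor ≅ L'.functor, ∀ F : FreeResolution H,
          (L.resolutionIso F).hom ≫ Functor.whiskerLeft DerivedCategory.Plus.Q e.hom =
            (L'.resolutionIso F).hom) ∧
      -- (b) the lift respects the bounded derived categories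
      (IsTypeFL H →
        ∃ L : RGammaLift RΓ α,
          (∀ X : DerivedCategory.Plus (Action C H),
            DerivedCategory.TStructure.t.bounded X.obj →
              DerivedCategory.TStructure.t.bounded (L.functor.obj X).obj) ∧
          ∃ (G : DerivedCategory.Bounded (Action C H) ⥤ DerivedCategory.Bounded C)
            (e : G ⋙ boundedToPlus C ≅ boundedToPlus (Action C H) ⋙ L.functor)
            (sq : G ⋙ boundedToPlus C ⋙ mapDerivedPlus (proEmbedding C) ≅
              boundedToPlus (Action C H) ⋙ mapDerivedPlus (proAction C H) ⋙ RΓ),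
            ∀ X, sq.hom.app X = (mapDerivedPlus (proEmbedding C)).map (e.hom.app X) ≫
              L.square.hom.app ((boundedToPlus (Action C H)).obj X)) ∧
      -- (c) the irreducible factors of the cohomology objects
      (IsTypeFPInfty H → IsSemisimpleCategory C → ∀ (A : Action C H) (p : ℤ),
        (∃ X : C, Nonempty ((proEmbedding C).obj X ≅ cohomology RΓ p A)) ∧
        ∀ X : C, Nonempty ((proEmbedding C).obj X ≅ cohomology RΓ p A) →
          ∀ S : C, IsIrreducibleFactor S X → IsIrreducibleFactor S A.V) := by
  refine ⟨hasRightDerivedFunctor_fixedPointsPlus C H, fun RΓ α _ => ⟨?_, ?_, ?_⟩⟩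
  · rintro ⟨F⟩
    obtain ⟨e, he⟩ := exists_iso_homTotal F RΓ α
    exact ⟨⟨rGammaLift F α e he⟩, fun L L' => existsUnique_iso_of_rGammaLift F L L'⟩
  · rintro ⟨F, n, hF⟩
    obtain ⟨e, he⟩ := exists_iso_homTotal F RΓ α
    let L := rGammaLift F α e he
    have hL := L.bounded F n hF
    exact ⟨L, hL, L.boundedFunctor hL, L.boundedIso hL, L.boundedSquare hL,
      L.boundedSquare_hom_app hL⟩
  · rintro ⟨F⟩ hC A p
    obtain ⟨e, _⟩ := exists_iso_homTotal F RΓ α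
    obtain ⟨e'⟩ := nonempty_iso_cohomology F e A p
    refine ⟨⟨_, ⟨e'⟩⟩, ?_⟩
    rintro X ⟨eX⟩ S hS
    -- The embedding of `C` in `Pro C` is fully faithful, so `X` is isomorphic in `C` to the
    -- homology of `Tot Hom(F_*, A)^H`.
    exact hC.isIrreducibleFactor_of_homology F A p
      (hS.of_iso ((proEmbedding C).preimageIso (eX ≪≫ e'.symm)))
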